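/- Let $(M^6,J,g)$ be a smooth strict nearly Kähler 6-manifold: $g$ is a Riemannian metric, $J$ is a $g$-orthogonal almost complex structure, $(\nabla^{LC}_XJ)X=0$ for all $X\in TM$, and $\nabla^{LC}_XJ\neq 0$ for all $X\in TM\setminus\{0\}$. Put $\omega(X,Y)=g(JX,Y)$. Let $\iota:L^3\to M^6$ be an immersed (in particular, possibly embedded) Lagrangian submanifold, i.e. $\iota^*\omega=0$, with the induced metric $\iota^*g$. For a vector field $V$ along $L$ write $L_\omega(V)=(V\lrcorner\,\omega)|_L$; this is an isomorphism from the normal bundle of $L$ onto $T^*L$. A smooth variation of $\iota$ with variation field $V$ is a smooth family of maps $\phi_t:L\to M$, defined for small $|t|$, with $\phi_0=\iota$ and $\partial_t\phi_t|_{t=0}=V$. A smooth normal field $V$ on $L$ is called a formal infinitesimal Lagrangian deformation if it solves the linearized Lagrangian equation, that is, $\frac{d}{dt}\big|_{t=0}\phi_t^*\omega=0$ for a smooth variation $\phi_t$ of $\iota$ with variation field $V$ (the derivative depends on $V$ only: it is $dL_\omega(V)+(V\lrcorner\,d\omega)|_L$). A smooth normal field $V$ is called a Jacobi field if it lies in the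 null space of the second variation of volume: for every smooth two-parameter variation $\phi_{s,t}$ of $\phi_{0,0}=\iota$ with $\partial_s\phi|_{s=t=0}=V$, with $\partial_t\phi|_{s=t=0}$ normal, and with $\phi_{s,t}=\phi_{s,0}$ outside a compact set $K$, the derivative $\frac{\partial^2}{\partial s\,\partial t}\big|_{s=t=0}\mathrm{vol}(\phi_{s,t}(K))$ exists and is $0$. Volumes are computed with the induced metrics, i.e. $\mathrm{vol}(\phi(K))=\int_K\sqrt{\det\phi^*g}$. 1. Every compactly supported formal infinitesimal Lagrangian deformation of $L^3$ is a Jacobi field. 2. Suppose that $L$ is compact and let $\beta\neq 0$ be a smooth 1-form on $L$ that is harmonic for the induced metric, $\triangle\beta=(d+d^*)^2\beta=0$. Let $V=L_\omega^{-1}(\beta)$ be the normal field with $L_\omega(V)=\beta$. Then every smooth variation $\phi_t$ of $\iota$ with variation field $V$ decreases the volume: the function $t\mapsto\mathrm{vol}(\phi_t(L))$ is differentiable near $0$ and twice differentiable at $0$, with $$\frac{d}{dt}\Big|_{t=0}\mathrm{vol}(\phi_t(L))=0,\qquad \frac{d^2}{dt^2}\Big|_{t=0}\mathrm{vol}(\phi_t(L))<0,$$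 and $\mathrm{vol}(\phi_t(L))<\mathrm{vol}(L)$ for all sufficiently small $t\neq0$. -/

import Mathlib

open scoped Manifold ContDiff Topology
open Set Filter MeasureTheory Bundle

noncomputable section

namespace NearlyKahler

/-- The model space `ℝⁿ`. -/
abbrev Eucl (n : ℕ) : Type := EuclideanSpace ℝ (Fin n)

/-! ### Calculus in the coordinates of a chart -/

/-- The partial derivative `∂ᵢ f` at `y` of a function on `ℝⁿ`. -/
def pderiv {n : ℕ} (i : Fin n) (f : Eucl n → ℝ) (y : Eucl n) : ℝ :=
  fderiv ℝ f y (EuclideanSpace.single i 1)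

section Coordinates

variable {n : ℕ} {X : Type*} [TopologicalSpace X] [ChartedSpace (Eucl n) X]

/-- The chart around `c`, with values in `ℝⁿ`. -/
abbrev chart (c : X) : PartialEquiv X (Eucl n) := extChartAt 𝓘(ℝ, Eucl n) c

/-- The coordinate vector `∂ᵢ` of the chart around `c`, at the point with coordinates `y`. -/
def coordVec (c : X) (y : Eucl n) (i : Fin n) :
    TangentSpace 𝓘(ℝ, Eucl n) ((chart c).symm y) :=
  mfderiv 𝓘(ℝ, Eucl n) 𝓘(ℝ, Eucl n) (chart c).symm y
    (EuclideanSpace.single i 1 : Eucl n)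

/-- The components `Aᵏⱼ` of a field `A` of endomorphisms of the tangent spaces in the chart
around `c`: `A ∂ⱼ = ∑ₖ Aᵏⱼ ∂ₖ`. -/
def endoMatrix (A : ∀ x : X, TangentSpace 𝓘(ℝ, Eucl n) x →L[ℝ] TangentSpace 𝓘(ℝ, Eucl n) x)
    (c : X) (y : Eucl n) (k j : Fin n) : ℝ :=
  let x : X := (chart c).symm y
  let w : Eucl n := mfderiv 𝓘(ℝ, Eucl n) 𝓘(ℝ, Eucl n) (chart (n := n) c) x (A x (coordVec c y j))
  w k

/-- The components `βᵢ = β(∂ᵢ)` of a 1-form in the chart around `c`. -/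
def formComp (β : ∀ x : X, TangentSpace 𝓘(ℝ, Eucl n) x →L[ℝ] ℝ)
    (c : X) (y : Eucl n) (i : Fin n) : ℝ :=
  β ((chart c).symm y) (coordVec c y i)

/-- Smoothness of a 1-form: its components in the charts are smooth. -/
def IsSmoothForm (β : ∀ x : X, TangentSpace 𝓘(ℝ, Eucl n) x →L[ℝ] ℝ) : Prop :=
  ∀ (c : X) (i : Fin n), ContDiffOn ℝ ∞ (fun y => formComp β c y i) (chart c).target

end Coordinates

/-! ### Levi-Civita connection and Hodge Laplacian of a metric given in coordinates

Here `h` is the matrix-valued function `y ↦ (hᵢⱼ(y))` of metric coefficients. -/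

section LocalGeometry

variable {n : ℕ} (h : Eucl n → Matrix (Fin n) (Fin n) ℝ)

/-- The Christoffel symbols `Γᵏᵢⱼ = ½ ∑ₗ hᵏˡ (∂ᵢ hⱼₗ + ∂ⱼ hᵢₗ - ∂ₗ hᵢⱼ)` of the Levi-Civita
connection. -/
def christoffel (k i j : Fin n) (y : Eucl n) : ℝ :=
  (1 / 2) * ∑ l, (h y)⁻¹ k l *
    (pderiv i (fun z => h z j l) y + pderiv j (fun z => h z i l) y - pderiv l (fun z => h z i j) y)

/-- The Levi-Civita covariant derivative of a field of endomorphisms with components `Aᵏⱼ`: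
`(∇ᵢ A)ᵏⱼ = ∂ᵢ Aᵏⱼ + ∑ₗ Γᵏᵢₗ Aˡⱼ - ∑ₗ Γˡᵢⱼ Aᵏₗ`. -/
def covDerivEndo (A : Eucl n → Fin n → Fin n → ℝ) (i k j : Fin n) (y : Eucl n) : ℝ :=
  pderiv i (fun z => A z k j) y + ∑ l, christoffel h k i l y * A y l j
    - ∑ l, christoffel h l i j y * A y k l

/-- The Riemannian volume density `√(det h)`. -/
def density (y : Eucl n) : ℝ := Real.sqrt (h y).det

/-- The exterior derivative of a 1-form: `(db)ᵢⱼ = ∂ᵢ bⱼ - ∂ⱼ bᵢ`. -/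
def extDeriv₁ (b : Eucl n → Fin n → ℝ) (y : Eucl n) (i j : Fin n) : ℝ :=
  pderiv i (fun z => b z j) y - pderiv j (fun z => b z i) y

/-- The codifferential of a 1-form, `d^* b = - ∇ⁱ bᵢ`:
minus the divergence of the vector field `bⁱ = ∑ⱼ hⁱʲ bⱼ`. -/
def codiff₁ (b : Eucl n → Fin n → ℝ) (y : Eucl n) : ℝ :=
  -((density h y)⁻¹ *
    ∑ i, pderiv i (fun z => density h z * ∑ j, (h z)⁻¹ i j * b z j) y)

/-- The codifferential of a 2-form, `(d^* F)ₖ = - ∇ⁱ Fᵢₖ`: minus the divergence of the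
antisymmetric tensor `Fⁱˡ = ∑ₐ ∑ₑ hⁱᵃ hˡᵉ Fₐₑ`, with the free index lowered. -/
def codiff₂ (F : Eucl n → Fin n → Fin n → ℝ) (y : Eucl n) (k : Fin n) : ℝ :=
  -((density h y)⁻¹ * ∑ l, h y k l *
    ∑ i, pderiv i (fun z => density h z * ∑ a, ∑ e, (h z)⁻¹ i a * (h z)⁻¹ l e * F z a e) y)

/-- The Hodge Laplacian `Δ = (d + d^*)² = d d^* + d^* d` on 1-forms. -/
def hodgeLaplacian (b : Eucl n → Fin n → ℝ) (y : Eucl n) (k : Fin n) : ℝ :=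
  pderiv k (codiff₁ h b) y + codiff₂ h (extDeriv₁ b) y k

end LocalGeometry

/-! ### Almost Hermitian and nearly Kähler structures -/

section Ambient

variable (M : Type*) [TopologicalSpace M] [ChartedSpace (Eucl 6) M]
  [IsManifold 𝓘(ℝ, Eucl 6) ∞ M]

/-- A smooth almost Hermitian structure `(J, g)` on a 6-manifold. -/
structure AlmostHermitian where
  /-- the Riemannian metric `g` -/
  metric : ContMDiffRiemannianMetric 𝓘(ℝ, Eucl 6) ∞ (Eucl 6)
    (fun x : M => TangentSpace 𝓘(ℝ, Eucl 6) x)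
  /-- the almost complex structure `J` -/
  J : ∀ x : M, TangentSpace 𝓘(ℝ, Eucl 6) x →L[ℝ] TangentSpace 𝓘(ℝ, Eucl 6) x
  smooth_J : ∀ (c : M) (k j : Fin 6),
    ContDiffOn ℝ ∞ (fun y => endoMatrix J c y k j) (chart c).target
  J_J : ∀ x v, J x (J x v) = -v
  metric_J_J : ∀ x v w, metric.inner x (J x v) (J x w) = metric.inner x v w

variable {M} (S : AlmostHermitian M)

namespace AlmostHermitian

/-- The fundamental 2-form `ω(X, Y) = g(JX, Y)`. -/
def omega (x : M) (v w : TangentSpace 𝓘(ℝ, Eucl 6) x) : ℝ :=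
  S.metric.inner x (S.J x v) w

/-- The metric coefficients `gᵢⱼ` in the chart around `c`. -/
def metricMatrix (c : M) (y : Eucl 6) : Matrix (Fin 6) (Fin 6) ℝ :=
  Matrix.of fun i j => S.metric.inner ((chart c).symm y) (coordVec c y i) (coordVec c y j)

/-- The components `(∇ᵢ J)ᵏⱼ` of the Levi-Civita covariant derivative of `J` in the chart
around `c`. -/
def nablaJ (c : M) (i k j : Fin 6) (y : Eucl 6) : ℝ :=
  covDerivEndo (S.metricMatrix c) (endoMatrix S.J c) i k j y

/-- Strict nearly Kähler: `(∇_X J) X = 0` for every tangent vector `X`, and `∇_X J ≠ 0` for every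
tangent vector `X ≠ 0`. Tangent vectors are written as `X = ∑ᵢ vᵢ ∂ᵢ`. -/
structure IsStrictNearlyKahler : Prop where
  nearly : ∀ (c : M), ∀ y ∈ (chart c).target, ∀ v : Fin 6 → ℝ, ∀ k : Fin 6,
    ∑ i, ∑ j, v i * v j * S.nablaJ c i k j y = 0
  strict : ∀ (c : M), ∀ y ∈ (chart c).target, ∀ v : Fin 6 → ℝ, v ≠ 0 →
    ∃ k j : Fin 6, ∑ i, v i * S.nablaJ c i k j y ≠ 0

end AlmostHermitian

end Ambient

/-! ### Lagrangian immersions, their variations and volume -/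

section Submanifold

variable {M : Type*} [TopologicalSpace M] [ChartedSpace (Eucl 6) M]
  [IsManifold 𝓘(ℝ, Eucl 6) ∞ M] (S : AlmostHermitian M)
  {L : Type*} [TopologicalSpace L] [ChartedSpace (Eucl 3) L]

/-- The differential of a map `L³ → M⁶`. -/
abbrev diff (f : L → M) (x : L) :
    TangentSpace 𝓘(ℝ, Eucl 3) x →L[ℝ] TangentSpace 𝓘(ℝ, Eucl 6) (f x) :=
  mfderiv 𝓘(ℝ, Eucl 3) 𝓘(ℝ, Eucl 6) f x

/-- A smooth immersion `ι : L³ → M⁶` with `ι^* ω = 0`. -/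
structure IsLagrangianImmersion (ι : L → M) : Prop where
  smooth : ContMDiff 𝓘(ℝ, Eucl 3) 𝓘(ℝ, Eucl 6) ∞ ι
  immersive : ∀ x, Function.Injective (diff ι x)
  isotropic : ∀ x (u w : TangentSpace 𝓘(ℝ, Eucl 3) x),
    S.omega (ι x) (diff ι x u) (diff ι x w) = 0

/-- A smooth normal vector field along `ι`, i.e. a smooth section of the normal bundle. -/
structure IsNormalField (ι : L → M) (V : ∀ x : L, TangentSpace 𝓘(ℝ, Eucl 6) (ι x)) : Prop where
  smooth : ContMDiff 𝓘(ℝ, Eucl 3) 𝓘(ℝ, Eucl 6).tangent ∞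
    (fun x => (⟨ι x, V x⟩ : TangentBundle 𝓘(ℝ, Eucl 6) M))
  normal : ∀ x (u : TangentSpace 𝓘(ℝ, Eucl 3) x), S.metric.inner (ι x) (V x) (diff ι x u) = 0

/-- The initial velocity `∂/∂t φ_t(x)` at `t = 0`, as a tangent vector at `φ_0(x)`. -/
def velocity (φ : ℝ → L → M) (x : L) : TangentBundle 𝓘(ℝ, Eucl 6) M :=
  ⟨φ 0 x, mfderiv 𝓘(ℝ, ℝ) 𝓘(ℝ, Eucl 6) (fun t => φ t x) 0 (1 : ℝ)⟩

/-- `φ` is a smooth variation of `ι`, defined for small times, with `φ_0 = ι` and variation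
field `V`. (The equality of tangent vectors contains the equality of their base points.) -/
def IsVariation (ι : L → M) (V : ∀ x : L, TangentSpace 𝓘(ℝ, Eucl 6) (ι x))
    (φ : ℝ → L → M) : Prop :=
  (∃ ε > 0, ContMDiffOn (𝓘(ℝ, ℝ).prod 𝓘(ℝ, Eucl 3)) 𝓘(ℝ, Eucl 6) ∞
    (fun p : ℝ × L => φ p.1 p.2) (Ioo (-ε) ε ×ˢ univ)) ∧
  ∀ x, velocity φ x = ⟨ι x, V x⟩

/-- A formal infinitesimal Lagrangian deformation of `ι`: a normal field `V` which solves the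
linearised Lagrangian equation, i.e. `d/dt (φ_t^* ω) = 0` at `t = 0` for a smooth variation `φ`
of `ι` with variation field `V`. (This derivative is `d(V ⌟ ω) + V ⌟ dω` restricted to `L`, so it
depends on the variation only through `V`.) -/
def IsFormalLagrangianDeformation (ι : L → M)
    (V : ∀ x : L, TangentSpace 𝓘(ℝ, Eucl 6) (ι x)) : Prop :=
  IsNormalField S ι V ∧ ∃ φ : ℝ → L → M, IsVariation ι V φ ∧
    ∀ x (u w : TangentSpace 𝓘(ℝ, Eucl 3) x),
      HasDerivAt (fun t => S.omega (φ t x) (diff (φ t) x u) (diff (φ t) x w)) 0 0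

/-- The coefficients `(f^* g)ᵢⱼ` of the metric induced by `f : L³ → M⁶`, in the chart around
`c`. -/
def inducedMetric (f : L → M) (c : L) (y : Eucl 3) : Matrix (Fin 3) (Fin 3) ℝ :=
  Matrix.of fun i j => S.metric.inner (f ((chart c).symm y))
    (diff f ((chart c).symm y) (coordVec c y i)) (diff f ((chart c).symm y) (coordVec c y j))

/-- The 1-form `β` is harmonic, `Δβ = 0`, for the metric induced on `L³` by `ι`. -/
def IsHarmonic (ι : L → M) (β : ∀ x : L, TangentSpace 𝓘(ℝ, Eucl 3) x →L[ℝ] ℝ) : Prop :=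
  ∀ (c : L), ∀ y ∈ (chart c).target, ∀ k : Fin 3,
    hodgeLaplacian (inducedMetric S ι c) (formComp β c) y k = 0

variable [IsManifold 𝓘(ℝ, Eucl 3) ∞ L] [T2Space L] [SigmaCompactSpace L]

variable (L) in
/-- A smooth partition of unity on `L` subordinate to the charts. -/
def chartPartition : SmoothPartitionOfUnity L 𝓘(ℝ, Eucl 3) L univ :=
  (SmoothPartitionOfUnity.exists_isSubordinate_chartAt_source 𝓘(ℝ, Eucl 3) L).choose

/-- The volume of `K ⊆ L` for the metric induced by `f : L³ → M⁶`, that is `∫_K √(det f^* g)`,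
computed with a partition of unity. It is used for compact `K`, where only finitely many
summands are nonzero. -/
def vol (f : L → M) (K : Set L) : ℝ :=
  ∑ᶠ c : L, ∫ y in (chart c).target ∩ (chart c).symm ⁻¹' K,
    chartPartition L c ((chart c).symm y) * density (inducedMetric S f c) y

/-- `V` is a Jacobi field on the (minimal) immersed submanifold `ι`: it is a normal field in the
null space of the second variation of volume. That is, for every smooth two-parameter variation
`φ_{s,t}` of `ι` whose `s`-variation field is `V`, whose `t`-variation field `W` is normal, and
whose `t`-variation is supported in a compact set `K`, the mixed derivative
`∂²/∂s∂t vol(φ_{s,t}(K))` exists at `s = t = 0` and is zero. -/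
def IsJacobiField (ι : L → M) (V : ∀ x : L, TangentSpace 𝓘(ℝ, Eucl 6) (ι x)) : Prop :=
  IsNormalField S ι V ∧
  ∀ (φ : ℝ → ℝ → L → M) (W : ∀ x : L, TangentSpace 𝓘(ℝ, Eucl 6) (ι x)) (K : Set L) (ε : ℝ),
    0 < ε →
    ContMDiffOn (𝓘(ℝ, ℝ).prod (𝓘(ℝ, ℝ).prod 𝓘(ℝ, Eucl 3))) 𝓘(ℝ, Eucl 6) ∞
      (fun p : ℝ × ℝ × L => φ p.1 p.2.1 p.2.2) (Ioo (-ε) ε ×ˢ Ioo (-ε) ε ×ˢ univ) →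
    (∀ x, velocity (fun s => φ s 0) x = ⟨ι x, V x⟩) →
    (∀ x, velocity (fun t => φ 0 t) x = ⟨ι x, W x⟩) →
    IsNormalField S ι W →
    IsCompact K →
    (∀ s ∈ Ioo (-ε) ε, ∀ t ∈ Ioo (-ε) ε, ∀ x ∉ K, φ s t x = φ s 0 x) →
    ∃ D : ℝ → ℝ, (∀ᶠ s in 𝓝 0, HasDerivAt (fun t => vol S (φ s t) K) (D s) 0) ∧
      HasDerivAt D 0 0

end Submanifold

end NearlyKahler

end

/-!
Let `ω` be the fundamental form of a strict nearly Kähler 6-manifold and `ψ = dω / 3`, so that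
`ψ(X, Y, Z) = g((∇_X J) Y, Z)`. The form `ψ` is the real part of a complex volume form, whose
imaginary part is, up to sign, `σ = ψ(J·, ·, ·)`. Differentiating the algebraic symmetries of `ψ`
and using `dψ = 0` gives `dσ = 4 k² (ω ∧ ω / 2)`, where `k > 0` is the norm of the volume form
(`LocalNK.dThree_sigmaL`); then `d(dσ) = 0` shows that `k` is locally constant
(`LocalNK.fderiv_norm_eq_zero`).

For a map `φ` from a 3-manifold, written in coordinates, let `w`, `p` and `s` be the components of
`φ^* ω` (as a vector), `φ^* ψ` and `φ^* σ`. The complex Gram determinant of the three coordinate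
vectors gives `k² det(φ^* g) = p² + s² + k² ∑ wᵢ wⱼ gᵢⱼ` (`famNorm`). On a Lagrangian submanifold
`w = 0`, hence also `3 p = div w = 0`. So, near a Lagrangian submanifold and with `κ = ± 1 / k`, the
volume density is `κ s` plus a remainder which is quadratic in `w` and `p` (`fderiv_density`). By
the structure equation for `σ`, the variation of `s` is a divergence plus a multiple of
`⟨V ⌟ ω, w⟩`. Hence the first variation of the volume density is a divergence, and its second
variation is a divergence plus a term `hessRest`, in which only the first variations of `w` and `p`
occur (`fderiv_famVol_eq_div`). By the divergence theorem (`IsVectorDensity.sum_integral_div`)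
Lagrangian submanifolds are critical for the volume, with second variation `∫ hessRest`
(`exists_second_variation`).

The first variation of `w` depends on the variation field `V` only (`fderiv_famW_congr`). If `V` is
an infinitesimal Lagrangian deformation, it vanishes, and so does that of `p`, whose triple is its
divergence (`three_fderiv_famP`). Thus `hessRest = 0`, and `V` is a Jacobi field.

If the submanifold is compact and `V ⌟ ω = β` is harmonic, then `β` is closed and coclosed
(`closed_coclosed_of_harmonic`). Since `dβ = 0`, the first variation of `w` is `3 V ⌟ ψ`, and since
`V` is normal, this is a multiple of the Hodge dual of `β` (`kappa_mul_fderiv_famW`). Its divergence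
vanishes because `d^* β = 0`, so the first variation of `p` is zero. What is left of `hessRest` is
`-3 k² |β|² √(det g)`: the two terms involving `w` contribute `-12` and `+9`. So the second
variation is negative (`second_variation_neg`), and the second derivative test concludes.
-/

set_option maxSynthPendingDepth 3
set_option synthInstance.maxHeartbeats 200000

noncomputable section

namespace NearlyKahler

section Calculus

variable {P E : Type*} [NormedAddCommGroup P] [NormedSpace ℝ P]
  [NormedAddCommGroup E] [NormedSpace ℝ E]

/-- The exterior derivative of a 1-form on a normed space. -/
def dOne (β : E → E →L[ℝ] ℝ) (x : E) (a b : E) : ℝ :=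
  fderiv ℝ β x a b - fderiv ℝ β x b a

/-- The exterior derivative of a 2-form on a normed space. Forms are encoded as curried
multilinear maps; that they are alternating is a hypothesis where it matters. -/
def dTwo (η : E → E →L[ℝ] E →L[ℝ] ℝ) (x : E) (a b c : E) : ℝ :=
  fderiv ℝ η x a b c + fderiv ℝ η x b c a + fderiv ℝ η x c a b

/-- The exterior derivative of a 3-form on a normed space. -/
def dThree (σ : E → E →L[ℝ] E →L[ℝ] E →L[ℝ] ℝ) (x : E) (a b c d : E) : ℝ :=
  fderiv ℝ σ x a b c d - fderiv ℝ σ x b a c d + fderiv ℝ σ x c a b d - fderiv ℝ σ x d a b c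

lemma hasFDerivAt_fderiv_apply {F : P → E} {z : P} (hF : ContDiffAt ℝ 2 F z) (b : P) :
    HasFDerivAt (fun z => fderiv ℝ F z b) ((fderiv ℝ (fderiv ℝ F) z).flip b) z := by
  have h : DifferentiableAt ℝ (fderiv ℝ F) z :=
    (hF.fderiv_right (m := 1) (by norm_num)).differentiableAt one_ne_zero
  convert h.hasFDerivAt.clm_apply (hasFDerivAt_const b z) using 1
  ext v
  simp

lemma fderiv_fderiv_apply {F : P → E} {z : P} (hF : ContDiffAt ℝ 2 F z) (a b : P) :
    fderiv ℝ (fun z => fderiv ℝ F z b) z a = fderiv ℝ (fderiv ℝ F) z a b := by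
  rw [(hasFDerivAt_fderiv_apply hF b).fderiv]; rfl

lemma fderiv_fderiv_symm {F : P → E} {z : P} (hF : ContDiffAt ℝ 2 F z) (a b : P) :
    fderiv ℝ (fderiv ℝ F) z a b = fderiv ℝ (fderiv ℝ F) z b a :=
  (hF.isSymmSndFDerivAt (by simp)).eq a b

lemma hasFDerivAt_comp_of {G : Type*} [NormedAddCommGroup G] [NormedSpace ℝ G]
    {β : E → G} {F : P → E} {z : P} (hβ : DifferentiableAt ℝ β (F z))
    (hF : ContDiffAt ℝ 2 F z) :
    HasFDerivAt (fun z => β (F z)) ((fderiv ℝ β (F z)).comp (fderiv ℝ F z)) z :=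
  hβ.hasFDerivAt.comp z (hF.differentiableAt two_ne_zero).hasFDerivAt

lemma fderiv_pullback_one {β : E → E →L[ℝ] ℝ} {F : P → E} {z : P}
    (hβ : DifferentiableAt ℝ β (F z)) (hF : ContDiffAt ℝ 2 F z) (a b : P) :
    fderiv ℝ (fun z => β (F z) (fderiv ℝ F z b)) z a =
      fderiv ℝ β (F z) (fderiv ℝ F z a) (fderiv ℝ F z b)
        + β (F z) (fderiv ℝ (fderiv ℝ F) z a b) := by
  rw [((hasFDerivAt_comp_of hβ hF).clm_apply (hasFDerivAt_fderiv_apply hF b)).fderiv]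
  simp [add_comm]

lemma fderiv_pullback_two {η : E → E →L[ℝ] E →L[ℝ] ℝ} {F : P → E} {z : P}
    (hη : DifferentiableAt ℝ η (F z)) (hF : ContDiffAt ℝ 2 F z) (a b c : P) :
    fderiv ℝ (fun z => η (F z) (fderiv ℝ F z b) (fderiv ℝ F z c)) z a =
      fderiv ℝ η (F z) (fderiv ℝ F z a) (fderiv ℝ F z b) (fderiv ℝ F z c)
        + η (F z) (fderiv ℝ (fderiv ℝ F) z a b) (fderiv ℝ F z c)
        + η (F z) (fderiv ℝ F z b) (fderiv ℝ (fderiv ℝ F) z a c) := by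
  rw [(((hasFDerivAt_comp_of hη hF).clm_apply (hasFDerivAt_fderiv_apply hF b)).clm_apply
    (hasFDerivAt_fderiv_apply hF c)).fderiv]
  simp
  ring

lemma fderiv_pullback_three {σ : E → E →L[ℝ] E →L[ℝ] E →L[ℝ] ℝ} {F : P → E} {z : P}
    (hσ : DifferentiableAt ℝ σ (F z)) (hF : ContDiffAt ℝ 2 F z) (a b c d : P) :
    fderiv ℝ (fun z => σ (F z) (fderiv ℝ F z b) (fderiv ℝ F z c) (fderiv ℝ F z d)) z a =
      fderiv ℝ σ (F z) (fderiv ℝ F z a) (fderiv ℝ F z b) (fderiv ℝ F z c) (fderiv ℝ F z d)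
        + σ (F z) (fderiv ℝ (fderiv ℝ F) z a b) (fderiv ℝ F z c) (fderiv ℝ F z d)
        + σ (F z) (fderiv ℝ F z b) (fderiv ℝ (fderiv ℝ F) z a c) (fderiv ℝ F z d)
        + σ (F z) (fderiv ℝ F z b) (fderiv ℝ F z c) (fderiv ℝ (fderiv ℝ F) z a d) := by
  rw [((((hasFDerivAt_comp_of hσ hF).clm_apply (hasFDerivAt_fderiv_apply hF b)).clm_apply
    (hasFDerivAt_fderiv_apply hF c)).clm_apply (hasFDerivAt_fderiv_apply hF d)).fderiv]
  simp
  ring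

/-- Naturality of the exterior derivative of 1-forms under pullback. -/
lemma dOne_pullback {β : E → E →L[ℝ] ℝ} {F : P → E} {z : P}
    (hβ : DifferentiableAt ℝ β (F z)) (hF : ContDiffAt ℝ 2 F z) (a b : P) :
    fderiv ℝ (fun z => β (F z) (fderiv ℝ F z b)) z a
      - fderiv ℝ (fun z => β (F z) (fderiv ℝ F z a)) z b
      = dOne β (F z) (fderiv ℝ F z a) (fderiv ℝ F z b) := by
  rw [fderiv_pullback_one hβ hF, fderiv_pullback_one hβ hF, fderiv_fderiv_symm hF b a, dOne]
  ring

/-- Naturality of the exterior derivative of 2-forms under pullback. -/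
lemma dTwo_pullback {η : E → E →L[ℝ] E →L[ℝ] ℝ} {F : P → E} {z : P}
    (hη : DifferentiableAt ℝ η (F z)) (hF : ContDiffAt ℝ 2 F z)
    (alt : ∀ u v, η (F z) u v = - η (F z) v u) (a b c : P) :
    fderiv ℝ (fun z => η (F z) (fderiv ℝ F z b) (fderiv ℝ F z c)) z a
      + fderiv ℝ (fun z => η (F z) (fderiv ℝ F z c) (fderiv ℝ F z a)) z b
      + fderiv ℝ (fun z => η (F z) (fderiv ℝ F z a) (fderiv ℝ F z b)) z c
      = dTwo η (F z) (fderiv ℝ F z a) (fderiv ℝ F z b) (fderiv ℝ F z c) := by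
  rw [fderiv_pullback_two hη hF, fderiv_pullback_two hη hF, fderiv_pullback_two hη hF,
    fderiv_fderiv_symm hF b a, fderiv_fderiv_symm hF c a, fderiv_fderiv_symm hF c b, dTwo,
    alt (fderiv ℝ F z b) (fderiv ℝ (fderiv ℝ F) z a c),
    alt (fderiv ℝ F z c) (fderiv ℝ (fderiv ℝ F) z a b),
    alt (fderiv ℝ F z a) (fderiv ℝ (fderiv ℝ F) z b c)]
  ring

/-- Naturality of the exterior derivative of 3-forms under pullback. -/
lemma dThree_pullback {σ : E → E →L[ℝ] E →L[ℝ] E →L[ℝ] ℝ} {F : P → E} {z : P}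
    (hσ : DifferentiableAt ℝ σ (F z)) (hF : ContDiffAt ℝ 2 F z)
    (alt₁ : ∀ u v w, σ (F z) u v w = - σ (F z) v u w)
    (alt₂ : ∀ u v w, σ (F z) u v w = - σ (F z) u w v) (a b c d : P) :
    fderiv ℝ (fun z => σ (F z) (fderiv ℝ F z b) (fderiv ℝ F z c) (fderiv ℝ F z d)) z a
      - fderiv ℝ (fun z => σ (F z) (fderiv ℝ F z a) (fderiv ℝ F z c) (fderiv ℝ F z d)) z b
      + fderiv ℝ (fun z => σ (F z) (fderiv ℝ F z a) (fderiv ℝ F z b) (fderiv ℝ F z d)) z c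
      - fderiv ℝ (fun z => σ (F z) (fderiv ℝ F z a) (fderiv ℝ F z b) (fderiv ℝ F z c)) z d
      = dThree σ (F z) (fderiv ℝ F z a) (fderiv ℝ F z b) (fderiv ℝ F z c) (fderiv ℝ F z d) := by
  rw [fderiv_pullback_three hσ hF, fderiv_pullback_three hσ hF, fderiv_pullback_three hσ hF,
    fderiv_pullback_three hσ hF, dThree,
    fderiv_fderiv_symm hF b a, fderiv_fderiv_symm hF c a, fderiv_fderiv_symm hF c b,
    fderiv_fderiv_symm hF d a, fderiv_fderiv_symm hF d b, fderiv_fderiv_symm hF d c]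
  have e1 := alt₁ (fderiv ℝ F z b) (fderiv ℝ (fderiv ℝ F) z a c) (fderiv ℝ F z d)
  have e2 := alt₂ (fderiv ℝ F z b) (fderiv ℝ F z c) (fderiv ℝ (fderiv ℝ F) z a d)
  have e2' := alt₁ (fderiv ℝ F z b) (fderiv ℝ (fderiv ℝ F) z a d) (fderiv ℝ F z c)
  have e3 := alt₁ (fderiv ℝ F z a) (fderiv ℝ (fderiv ℝ F) z b c) (fderiv ℝ F z d)
  have e4 := alt₂ (fderiv ℝ F z a) (fderiv ℝ F z c) (fderiv ℝ (fderiv ℝ F) z b d)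
  have e4' := alt₁ (fderiv ℝ F z a) (fderiv ℝ (fderiv ℝ F) z b d) (fderiv ℝ F z c)
  have e5 := alt₂ (fderiv ℝ F z a) (fderiv ℝ F z b) (fderiv ℝ (fderiv ℝ F) z c d)
  have e5' := alt₁ (fderiv ℝ F z a) (fderiv ℝ (fderiv ℝ F) z c d) (fderiv ℝ F z b)
  linarith

/-! ### Second derivatives of products and of a square root -/

section SecondDerivative

variable {z : P} {f h : P → ℝ}

lemma fderiv_fderiv_add (hf : ContDiffAt ℝ 2 f z) (hh : ContDiffAt ℝ 2 h z) (a b : P) :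
    fderiv ℝ (fderiv ℝ (fun z => f z + h z)) z a b =
      fderiv ℝ (fderiv ℝ f) z a b + fderiv ℝ (fderiv ℝ h) z a b := by
  have e : fderiv ℝ (fun z => f z + h z) =ᶠ[𝓝 z] fun z => fderiv ℝ f z + fderiv ℝ h z := by
    filter_upwards [hf.eventually (by simp), hh.eventually (by simp)] with y hy hy'
    exact fderiv_fun_add (hy.differentiableAt two_ne_zero) (hy'.differentiableAt two_ne_zero)
  rw [e.fderiv_eq, fderiv_fun_add
    ((hf.fderiv_right (m := 1) (by norm_num)).differentiableAt one_ne_zero)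
    ((hh.fderiv_right (m := 1) (by norm_num)).differentiableAt one_ne_zero)]
  rfl

lemma fderiv_fderiv_sum {ι : Type*} (s : Finset ι) {f : ι → P → ℝ}
    (hf : ∀ i, ContDiffAt ℝ 2 (f i) z) (a b : P) :
    fderiv ℝ (fderiv ℝ (fun z => ∑ i ∈ s, f i z)) z a b =
      ∑ i ∈ s, fderiv ℝ (fderiv ℝ (f i)) z a b := by
  classical
  induction s using Finset.induction_on with
  | empty =>
    have : fderiv ℝ (fun _ : P => (0 : ℝ)) = fun _ => 0 := by ext1; simp
    simp [this]
  | insert i s hi ih =>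
    simp only [Finset.sum_insert hi]
    rw [fderiv_fderiv_add (hf i) (ContDiffAt.sum fun j _ => hf j), ih]

lemma fderiv_fderiv_mul (hf : ContDiffAt ℝ 2 f z) (hh : ContDiffAt ℝ 2 h z) (a b : P) :
    fderiv ℝ (fderiv ℝ (fun z => f z * h z)) z a b =
      f z * fderiv ℝ (fderiv ℝ h) z a b + fderiv ℝ f z a * fderiv ℝ h z b
        + fderiv ℝ f z b * fderiv ℝ h z a + h z * fderiv ℝ (fderiv ℝ f) z a b := by
  have e : fderiv ℝ (fun z => f z * h z) =ᶠ[𝓝 z]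
      fun z => f z • fderiv ℝ h z + h z • fderiv ℝ f z := by
    filter_upwards [hf.eventually (by simp), hh.eventually (by simp)] with y hy hy'
    exact fderiv_fun_mul (hy.differentiableAt two_ne_zero) (hy'.differentiableAt two_ne_zero)
  have df := hf.differentiableAt two_ne_zero
  have dh := hh.differentiableAt two_ne_zero
  have ddf := (hf.fderiv_right (m := 1) (by norm_num)).differentiableAt one_ne_zero
  have ddh := (hh.fderiv_right (m := 1) (by norm_num)).differentiableAt one_ne_zero
  rw [e.fderiv_eq, fderiv_fun_add (df.fun_smul ddh) (dh.fun_smul ddf), fderiv_fun_smul df ddh,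
    fderiv_fun_smul dh ddf]
  simp
  ring

/-- The Hessian at a common zero of `f` and `h` of `f h k` only sees first derivatives. -/
lemma fderiv_fderiv_mul_mul_of_zero {k : P → ℝ} (hf : ContDiffAt ℝ 2 f z)
    (hh : ContDiffAt ℝ 2 h z) (hk : ContDiffAt ℝ 2 k z) (f0 : f z = 0) (h0 : h z = 0) (a b : P) :
    fderiv ℝ (fderiv ℝ (fun z => f z * h z * k z)) z a b =
      (fderiv ℝ f z a * fderiv ℝ h z b + fderiv ℝ f z b * fderiv ℝ h z a) * k z := by
  rw [fderiv_fderiv_mul (hf.mul hh) hk, fderiv_fderiv_mul hf hh,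
    fderiv_fun_mul (hf.differentiableAt two_ne_zero) (hh.differentiableAt two_ne_zero)]
  simp [f0, h0]
  ring

lemma fderiv_mul_mul_of_zero {k : P → ℝ} (hf : ContDiffAt ℝ 2 f z)
    (hh : ContDiffAt ℝ 2 h z) (hk : ContDiffAt ℝ 2 k z) (f0 : f z = 0) (h0 : h z = 0) :
    fderiv ℝ (fun z => f z * h z * k z) z = 0 := by
  rw [fderiv_fun_mul ((hf.mul hh).differentiableAt two_ne_zero) (hk.differentiableAt two_ne_zero),
    fderiv_fun_mul (hf.differentiableAt two_ne_zero) (hh.differentiableAt two_ne_zero)]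
  simp [f0, h0]

end SecondDerivative

/-- First and second derivatives of a volume density `√Q` at a point where the functions `p` and
`w i` vanish, when `c² Q = p² + q² + c² ∑ w i w j G i j`: the difference of `√Q` and `ε q / c` is
quadratic in `p` and the `w i`. -/
lemma fderiv_density {z : P} {Q p q : P → ℝ} {w : Fin 3 → P → ℝ} {G : Fin 3 → Fin 3 → P → ℝ}
    {c ε : ℝ} (hc : 0 < c) (hε : ε * ε = 1)
    (hQ : ContDiffAt ℝ 2 Q z) (hp : ContDiffAt ℝ 2 p z) (hq : ContDiffAt ℝ 2 q z)
    (hw : ∀ i, ContDiffAt ℝ 2 (w i) z) (hG : ∀ i j, ContDiffAt ℝ 2 (G i j) z)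
    (hQ0 : 0 < Q z) (hp0 : p z = 0) (hq0 : 0 < ε * q z) (hw0 : ∀ i, w i z = 0)
    (key : ∀ᶠ y in 𝓝 z, c ^ 2 * Q y =
      p y ^ 2 + q y ^ 2 + c ^ 2 * ∑ i, ∑ j, w i y * w j y * G i j y) :
    √(Q z) = ε / c * q z ∧
    (∀ b, fderiv ℝ (fun y => √(Q y)) z b = ε / c * fderiv ℝ q z b) ∧
    ∀ a b, fderiv ℝ (fun y => fderiv ℝ (fun y => √(Q y)) y b) z a =
      ε / c * fderiv ℝ (fun y => fderiv ℝ q y b) z a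
      + (fderiv ℝ p z a * fderiv ℝ p z b) / (c ^ 2 * √(Q z))
      + ∑ i, ∑ j, (fderiv ℝ (w i) z a * fderiv ℝ (w j) z b +
          fderiv ℝ (w i) z b * fderiv ℝ (w j) z a) * G i j z / (2 * √(Q z)) := by
  have hv : ContDiffAt ℝ 2 (fun y => √(Q y)) z := hQ.sqrt hQ0.ne'
  set v : P → ℝ := fun y => √(Q y) with hvdef
  set m : P → ℝ := fun y => (v y + ε / c * q y)⁻¹ with hm
  have hv0 : 0 < v z := Real.sqrt_pos.2 hQ0
  have hden0 : 0 < v z + ε / c * q z := by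
    have : 0 < ε / c * q z := by rw [div_mul_eq_mul_div]; positivity
    linarith
  have hden : ContDiffAt ℝ 2 (fun y => v y + ε / c * q y) z :=
    hv.add (contDiffAt_const.mul hq)
  have hmC : ContDiffAt ℝ 2 m z := hden.inv hden0.ne'
  have hcq : ContDiffAt ℝ 2 (fun y => ε / c * q y) z := contDiffAt_const.mul hq
  have hvz : v z = ε / c * q z := by
    have k0 := key.self_of_nhds
    simp only [hp0, hw0] at k0
    have h1 : (c * v z) ^ 2 = (ε * q z) ^ 2 := by
      rw [mul_pow, hvdef]; simp only; rw [Real.sq_sqrt hQ0.le, k0, mul_pow, sq ε, hε]; simp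
    have h2 : c * v z = ε * q z := by
      rcases sq_eq_sq_iff_eq_or_eq_neg.1 h1 with h | h
      · exact h
      · have : 0 < c * v z := by positivity
        linarith
    field_simp
    linarith
  have hmz : m z = (2 * v z)⁻¹ := by rw [hm]; simp only; rw [← hvz, two_mul]
  have hk1 : ContDiffAt ℝ 2 (fun y => (c ^ 2)⁻¹ * m y) z := contDiffAt_const.mul hmC
  have hk2 : ∀ i j, ContDiffAt ℝ 2 (fun y => G i j y * m y) z := fun i j => (hG i j).mul hmC
  have hT1 : ContDiffAt ℝ 2 (fun y => p y * p y * ((c ^ 2)⁻¹ * m y)) z := (hp.mul hp).mul hk1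
  have hT2 : ∀ i j, ContDiffAt ℝ 2 (fun y => w i y * w j y * (G i j y * m y)) z :=
    fun i j => ((hw i).mul (hw j)).mul (hk2 i j)
  have hT3 : ∀ i, ContDiffAt ℝ 2 (fun y => ∑ j, w i y * w j y * (G i j y * m y)) z :=
    fun i => ContDiffAt.sum fun j _ => hT2 i j
  have hT4 : ContDiffAt ℝ 2 (fun y => ∑ i, ∑ j, w i y * w j y * (G i j y * m y)) z :=
    ContDiffAt.sum fun i _ => hT3 i
  -- `(v - ε q / c) (v + ε q / c)` is quadratic in `p` and `w`, and the second factor is positive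
  have dec : v =ᶠ[𝓝 z] fun y => ε / c * q y + (p y * p y * ((c ^ 2)⁻¹ * m y) +
      ∑ i, ∑ j, w i y * w j y * (G i j y * m y)) := by
    filter_upwards [key, hQ.continuousAt.eventually (lt_mem_nhds hQ0),
      hden.continuousAt.eventually (lt_mem_nhds hden0)] with y h1 h2 h3
    have e1 : ∑ i, ∑ j, w i y * w j y * (G i j y * m y) =
        (∑ i, ∑ j, w i y * w j y * G i j y) * m y := by
      simp only [Finset.sum_mul, mul_assoc]
    have e2 : v y ^ 2 = Q y := Real.sq_sqrt h2.le
    have e3 : (v y - ε / c * q y) * (v y + ε / c * q y) =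
        (c ^ 2)⁻¹ * p y ^ 2 + ∑ i, ∑ j, w i y * w j y * G i j y := by
      have : (v y - ε / c * q y) * (v y + ε / c * q y) = v y ^ 2 - (ε * ε) / c ^ 2 * q y ^ 2 := by
        ring
      rw [this, hε, e2]
      field_simp
      linarith
    have e4 : v y - ε / c * q y = ((c ^ 2)⁻¹ * p y ^ 2 +
        ∑ i, ∑ j, w i y * w j y * G i j y) * m y := by
      rw [← e3, hm]; simp only; rw [mul_assoc, mul_inv_cancel₀ h3.ne', mul_one]
    rw [e1]
    linear_combination e4
  refine ⟨hvz, fun b => ?_, fun a b => ?_⟩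
  · rw [dec.fderiv_eq, fderiv_fun_add (hcq.differentiableAt two_ne_zero)
      ((hT1.add hT4).differentiableAt two_ne_zero),
      fderiv_fun_add (hT1.differentiableAt two_ne_zero) (hT4.differentiableAt two_ne_zero),
      fderiv_fun_sum (fun i _ => (hT3 i).differentiableAt two_ne_zero),
      fderiv_mul_mul_of_zero hp hp hk1 hp0 hp0,
      fderiv_const_mul (hq.differentiableAt two_ne_zero)]
    have : ∀ i, fderiv ℝ (fun y => ∑ j, w i y * w j y * (G i j y * m y)) z = 0 := fun i => by
      rw [fderiv_fun_sum (fun j _ => (hT2 i j).differentiableAt two_ne_zero)]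
      exact Finset.sum_eq_zero fun j _ =>
        fderiv_mul_mul_of_zero (hw i) (hw j) (hk2 i j) (hw0 i) (hw0 j)
    simp [this]
  · rw [fderiv_fderiv_apply hv, fderiv_fderiv_apply hq, (dec.fderiv).fderiv_eq,
      fderiv_fderiv_add hcq (hT1.add hT4), fderiv_fderiv_add hT1 hT4,
      fderiv_fderiv_sum _ hT3, fderiv_fderiv_mul_mul_of_zero hp hp hk1 hp0 hp0,
      fderiv_fderiv_mul contDiffAt_const hq]
    simp_rw [fderiv_fderiv_sum _ (hT2 _),
      fun i j => fderiv_fderiv_mul_mul_of_zero (hw i) (hw j) (hk2 i j) (hw0 i) (hw0 j) a b, hmz]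
    have h0 : fderiv ℝ (fun _ : P => ε / c) = fun _ => 0 := by ext1; simp
    simp only [h0, fderiv_fun_const, Pi.zero_apply, _root_.zero_apply]
    have : (fderiv ℝ p z a * fderiv ℝ p z b + fderiv ℝ p z b * fderiv ℝ p z a) *
        ((c ^ 2)⁻¹ * (2 * v z)⁻¹) = fderiv ℝ p z a * fderiv ℝ p z b / (c ^ 2 * v z) := by
      field_simp; ring
    rw [this]
    simp only [zero_mul, add_zero, mul_zero, div_eq_mul_inv, mul_assoc]
    ring

end Calculus

/-! ### Hermitian linear algebra in real dimension six -/

section HermitianAlgebra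

variable {E : Type*} [NormedAddCommGroup E] [NormedSpace ℝ E]

/-- A scalar product `g` and a `g`-orthogonal complex structure `J` on a real vector space. -/
structure IsHermitianPair (g : E →L[ℝ] E →L[ℝ] ℝ) (J : E →L[ℝ] E) : Prop where
  symm : ∀ u v, g u v = g v u
  pos : ∀ u, u ≠ 0 → 0 < g u u
  J_J : ∀ u, J (J u) = -u
  isom : ∀ u v, g (J u) (J v) = g u v

/-- A trilinear form which is alternating and for which `J` may be moved between the arguments:
the real part of a complex volume form. -/
structure IsPureForm (J : E →L[ℝ] E) (ψ : E →L[ℝ] E →L[ℝ] E →L[ℝ] ℝ) : Prop where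
  alt₁ : ∀ u v w, ψ u v w = -ψ v u w
  alt₂ : ∀ u v w, ψ u v w = -ψ u w v
  shift : ∀ u v w, ψ (J u) v w = ψ u (J v) w

variable {g : E →L[ℝ] E →L[ℝ] ℝ} {J : E →L[ℝ] E}

namespace IsHermitianPair

lemma skew (h : IsHermitianPair g J) (u v : E) : g (J u) v = -g u (J v) := by
  have := h.isom u (J v)
  rw [h.J_J] at this
  simp only [map_neg] at this
  linarith

lemma J_self (h : IsHermitianPair g J) (u : E) : g (J u) u = 0 := by
  have h1 := h.skew u u
  have h2 := h.symm u (J u)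
  linarith

lemma eq_of_forall (h : IsHermitianPair g J) {u v : E} (H : ∀ w, g u w = g v w) : u = v := by
  by_contra hne
  have h1 := h.pos (u - v) (sub_ne_zero.2 hne)
  have h2 : g (u - v) = 0 := by ext w; simp [H]
  simp [h2] at h1

/-- Fewer than `dim E` vectors have a common unit normal. -/
lemma exists_unit_normal [FiniteDimensional ℝ E] (h : IsHermitianPair g J) {k : ℕ}
    (v : Fin k → E) (hk : k < Module.finrank ℝ E) :
    ∃ u, g u u = 1 ∧ ∀ i, g (v i) u = 0 := by
  let f : E →ₗ[ℝ] (Fin k → ℝ) := LinearMap.pi fun i => (g (v i) : E →ₗ[ℝ] ℝ)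
  have hker : LinearMap.ker f ≠ ⊥ := LinearMap.ker_ne_bot_of_finrank_lt (by simpa using hk)
  obtain ⟨u, hu, hu0⟩ := (Submodule.ne_bot_iff _).1 hker
  have hp := h.pos u hu0
  have hf : ∀ i, g (v i) u = 0 := fun i => congrFun (LinearMap.mem_ker.1 hu) i
  refine ⟨(√(g u u))⁻¹ • u, ?_, fun i => by simp [hf]⟩
  simp only [map_smul, _root_.smul_apply, smul_eq_mul]
  rw [← mul_assoc, ← mul_inv, Real.mul_self_sqrt hp.le, inv_mul_cancel₀ hp.ne']

/-- Unit vectors `X`, `Y` such that `X`, `JX`, `Y`, `JY` are orthogonal to each other and to a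
given vector. -/
lemma exists_hermitian_normals [FiniteDimensional ℝ E] (h : IsHermitianPair g J)
    (hd : Module.finrank ℝ E = 6) (Z : E) :
    ∃ X Y, g X X = 1 ∧ g Y Y = 1 ∧ g X Y = 0 ∧ g (J X) Y = 0 ∧ g Z X = 0 ∧ g (J Z) X = 0 ∧
      g Z Y = 0 ∧ g (J Z) Y = 0 := by
  obtain ⟨X, hX, hX'⟩ := h.exists_unit_normal ![Z, J Z] (by omega)
  obtain ⟨Y, hY, hY'⟩ := h.exists_unit_normal ![Z, J Z, X, J X] (by omega)
  exact ⟨X, Y, hX, hY, hY' 2, hY' 3, hX' 0, hX' 1, hY' 0, hY' 1⟩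

/-- A unitary frame: a complex linear isometric isomorphism `ℂ³ ≃ E`. -/
lemma exists_unitary_frame [FiniteDimensional ℝ E] (h : IsHermitianPair g J)
    (hd : Module.finrank ℝ E = 6) :
    ∃ T : (Fin 3 → ℂ) ≃ₗ[ℝ] E, (∀ z, T (Complex.I • z) = J (T z)) ∧
      ∀ z w, g (T z) (T w) = ∑ k, ((z k).re * (w k).re + (z k).im * (w k).im) := by
  obtain ⟨e₁, h1, -⟩ := h.exists_unit_normal (![] : Fin 0 → E) (by omega)
  obtain ⟨e₂, e₃, h2, h3, h23, h23', h12, h12', h13, h13'⟩ := h.exists_hermitian_normals hd e₁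
  let T₀ : (Fin 3 → ℂ) →ₗ[ℝ] E :=
    { toFun := fun z => (z 0).re • e₁ + (z 0).im • J e₁ + ((z 1).re • e₂ + (z 1).im • J e₂)
        + ((z 2).re • e₃ + (z 2).im • J e₃)
      map_add' := fun z w => by simp only [Pi.add_apply, Complex.add_re, Complex.add_im]; module
      map_smul' := fun c z => by
        simp only [Pi.smul_apply, Complex.smul_re, Complex.smul_im, smul_eq_mul,
          RingHom.id_apply]
        module }
  have hT : ∀ z, T₀ z = (z 0).re • e₁ + (z 0).im • J e₁ + ((z 1).re • e₂ + (z 1).im • J e₂)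
        + ((z 2).re • e₃ + (z 2).im • J e₃) := fun z => rfl
  have hg : ∀ z w, g (T₀ z) (T₀ w) = ∑ k, ((z k).re * (w k).re + (z k).im * (w k).im) := by
    intro z w
    have k12 : g e₁ (J e₂) = 0 := by have := h.skew e₁ e₂; linarith
    have k13 : g e₁ (J e₃) = 0 := by have := h.skew e₁ e₃; linarith
    have k23 : g e₂ (J e₃) = 0 := by have := h.skew e₂ e₃; linarith
    have k11 : g e₁ (J e₁) = 0 := by rw [h.symm, h.J_self]
    have k22 : g e₂ (J e₂) = 0 := by rw [h.symm, h.J_self]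
    have k33 : g e₃ (J e₃) = 0 := by rw [h.symm, h.J_self]
    rw [hT, hT, Fin.sum_univ_three]
    simp only [map_add, map_smul, _root_.add_apply, _root_.smul_apply, smul_eq_mul, h.isom,
      h.J_self, h1, h2, h3, h23, h23', h12, h12', h13, h13', k12, k13, k23, k11, k22, k33,
      h.symm e₂ e₁, h.symm e₃ e₁, h.symm e₃ e₂, h.symm e₂ (J e₁), h.symm e₃ (J e₁),
      h.symm e₃ (J e₂), h.symm (J e₂) e₁, h.symm (J e₃) e₁, h.symm (J e₃) e₂]
    ring
  have hinj : Function.Injective T₀ := by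
    rw [injective_iff_map_eq_zero]
    intro z hz
    have h0 := hg z z
    rw [hz] at h0
    simp only [map_zero] at h0
    rw [eq_comm, Finset.sum_eq_zero_iff_of_nonneg
      (fun k _ => add_nonneg (mul_self_nonneg _) (mul_self_nonneg _))] at h0
    ext1 k
    have hk := h0 k (Finset.mem_univ k)
    exact Complex.ext (by simp; nlinarith) (by simp; nlinarith)
  have hfin : Module.finrank ℝ (Fin 3 → ℂ) = Module.finrank ℝ E := by
    rw [hd, Module.finrank_pi_fintype]; simp
  refine ⟨LinearEquiv.ofInjectiveOfFinrankEq T₀ hinj hfin, fun z => ?_, fun z w => hg z w⟩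
  change T₀ _ = J (T₀ z)
  rw [hT, hT]
  simp only [map_add, map_smul, h.J_J, Pi.smul_apply, smul_eq_mul, Complex.mul_re, Complex.mul_im,
    Complex.I_re, Complex.I_im]
  module

/-- A form of degree four on a Hermitian space of real dimension six vanishes as soon as it
vanishes on the quadruples `(X, JX, Y, Z)`: four elements of a unitary frame always contain a
pair of that kind. -/
lemma fourForm_eq_zero [FiniteDimensional ℝ E] (h : IsHermitianPair g J)
    (hd : Module.finrank ℝ E = 6) {Θ : E → E → E → E → ℝ}
    (add : ∀ a a' b c d, Θ (a + a') b c d = Θ a b c d + Θ a' b c d)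
    (smul : ∀ (r : ℝ) a b c d, Θ (r • a) b c d = r * Θ a b c d)
    (alt₁ : ∀ a b c d, Θ a b c d = -Θ b a c d) (alt₂ : ∀ a b c d, Θ a b c d = -Θ a c b d)
    (alt₃ : ∀ a b c d, Θ a b c d = -Θ a b d c)
    (H : ∀ a c d, Θ a (J a) c d = 0) (a b c d : E) : Θ a b c d = 0 := by
  obtain ⟨T, hTJ, -⟩ := h.exists_unitary_frame hd
  let e : Fin 3 → E := fun k => T (Pi.single k 1)
  have key : ∀ f : E → ℝ, (∀ a b, f (a + b) = f a + f b) → (∀ (r : ℝ) a, f (r • a) = r * f a) →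
      (∀ k, f (e k) = 0) → (∀ k, f (J (e k)) = 0) → ∀ a, f a = 0 := by
    intro f fadd fsmul he hJe a
    have ha : a = ∑ k, (((T.symm a) k).re • e k + ((T.symm a) k).im • J (e k)) := by
      apply T.symm.injective
      simp only [map_sum, map_add, map_smul, e, ← hTJ, LinearEquiv.symm_apply_apply]
      ext1 k
      simp only [Finset.sum_apply, Pi.add_apply, Pi.smul_apply, Pi.single_apply, smul_eq_mul]
      rw [Finset.sum_eq_single k (by intro j _ hj; simp [hj.symm]) (by simp)]
      apply Complex.ext <;> simp
    have f0 : f 0 = 0 := by simpa using fsmul 0 0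
    rw [ha, Fin.sum_univ_three]
    simp [fadd, fsmul, he, hJe]
  -- the pairs `(e, e)`, `(e, Je)`, `(Je, e)`, `(Je, Je)` all kill the form
  have diag : ∀ a c d, Θ a a c d = 0 := fun a c d => by linarith [alt₁ a a c d]
  let B : E → Fin 3 → Prop := fun x k => x = e k ∨ x = J (e k)
  have p12 : ∀ x y k, B x k → B y k → ∀ c d, Θ x y c d = 0 := by
    rintro x y k (rfl | rfl) (rfl | rfl) c d
    · exact diag _ _ _
    · exact H _ _ _
    · rw [alt₁, H, neg_zero]
    · exact diag _ _ _
  -- of four indices in `Fin 3`, two agree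
  have main : ∀ x y u v i j k l, B x i → B y j → B u k → B v l → Θ x y u v = 0 := by
    intro x y u v i j k l hx hy hu hv
    by_cases hij : i = j
    · subst hij; exact p12 x y i hx hy _ _
    by_cases hik : i = k
    · subst hik; rw [alt₂, p12 x u i hx hu, neg_zero]
    by_cases hil : i = l
    · subst hil; rw [alt₃, alt₂, p12 x v i hx hv, neg_zero, neg_zero]
    by_cases hjk : j = k
    · subst hjk; rw [alt₁, alt₂, p12 y u j hy hu, neg_zero, neg_zero]
    by_cases hjl : j = l
    · subst hjl; rw [alt₁, alt₃, alt₂, p12 y v j hy hv, neg_zero, neg_zero, neg_zero]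
    have hkl : k = l := by omega
    subst hkl
    rw [alt₂, alt₁, alt₃, alt₂, p12 u v k hu hv]
    simp
  -- pass from elements of the frame to general vectors, one argument at a time
  have s1 : ∀ a y u v j k l, B y j → B u k → B v l → Θ a y u v = 0 := fun a y u v j k l hy hu hv =>
    key (fun a => Θ a y u v) (fun a b => add a b y u v) (fun r a => smul r a y u v)
      (fun i => main _ _ _ _ i j k l (.inl rfl) hy hu hv)
      (fun i => main _ _ _ _ i j k l (.inr rfl) hy hu hv) a
  have s2 : ∀ a b u v k l, B u k → B v l → Θ b a u v = 0 := fun a b u v k l hu hv =>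
    key (fun b => Θ b a u v) (fun x y => add x y a u v) (fun r x => smul r x a u v)
      (fun i => by rw [alt₁, s1 _ _ _ _ i k l (.inl rfl) hu hv, neg_zero])
      (fun i => by rw [alt₁, s1 _ _ _ _ i k l (.inr rfl) hu hv, neg_zero]) b
  have s3 : ∀ a b c v l, B v l → Θ c a b v = 0 := fun a b c v l hv =>
    key (fun c => Θ c a b v) (fun x y => add x y a b v) (fun r x => smul r x a b v)
      (fun i => by rw [alt₁, alt₂, s2 _ _ _ _ i l (.inl rfl) hv, neg_zero, neg_zero])
      (fun i => by rw [alt₁, alt₂, s2 _ _ _ _ i l (.inr rfl) hv, neg_zero, neg_zero]) c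
  exact key (fun a => Θ a b c d) (fun x y => add x y b c d) (fun r x => smul r x b c d)
      (fun i => by rw [alt₁, alt₂, alt₃, s3 _ _ _ _ i (.inl rfl)]; simp)
      (fun i => by rw [alt₁, alt₂, alt₃, s3 _ _ _ _ i (.inr rfl)]; simp) a

end IsHermitianPair

/-- In a unitary frame a pure form is the real part of a multiple of the complex determinant. -/
lemma IsPureForm.exists_eq_re_det {ψ : E →L[ℝ] E →L[ℝ] E →L[ℝ] ℝ} (hψ : IsPureForm J ψ)
    {T : (Fin 3 → ℂ) ≃ₗ[ℝ] E} (hT : ∀ z, T (Complex.I • z) = J (T z)) (JJ : ∀ u, J (J u) = -u) :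
    ∃ l : ℂ, ∀ x y z, ψ (T x) (T y) (T z) = (l * (Matrix.of ![x, y, z]).det).re := by
  -- `Ψ`, with real part `ψ`, is complex trilinear and alternating, hence a multiple of `det`
  let Ψ : (Fin 3 → ℂ) → (Fin 3 → ℂ) → (Fin 3 → ℂ) → ℂ := fun x y z =>
    ⟨ψ (T x) (T y) (T z), -ψ (J (T x)) (T y) (T z)⟩
  have Tsmul : ∀ (c : ℂ) x, T (c • x) = c.re • T x + c.im • J (T x) := by
    intro c x
    have : c • x = c.re • x + c.im • (Complex.I • x) := by
      ext1 k
      apply Complex.ext <;> simp [sub_eq_add_neg]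
    rw [this, map_add, map_smul, map_smul, hT]
  have add1 : ∀ x x' y z, Ψ (x + x') y z = Ψ x y z + Ψ x' y z := by
    intro x x' y z; apply Complex.ext <;> simp [Ψ]; ring
  have smul1 : ∀ (c : ℂ) x y z, Ψ (c • x) y z = c * Ψ x y z := by
    intro c x y z; apply Complex.ext <;> simp [Ψ, Tsmul, JJ]; ring
  have alt1 : ∀ x y z, Ψ x y z = -Ψ y x z := by
    intro x y z
    apply Complex.ext
    · simpa [Ψ] using hψ.alt₁ (T x) (T y) (T z)
    · have := hψ.alt₁ (J (T y)) (T x) (T z)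
      simp [Ψ, this, hψ.shift (T x)]
  have alt2 : ∀ x y z, Ψ x y z = -Ψ x z y := by
    intro x y z
    apply Complex.ext
    · simpa [Ψ] using hψ.alt₂ (T x) (T y) (T z)
    · have := hψ.alt₂ (J (T x)) (T y) (T z)
      simp [Ψ, this]
  let e : Fin 3 → Fin 3 → ℂ := fun k => Pi.single k 1
  have exp : ∀ x : Fin 3 → ℂ, x = x 0 • e 0 + x 1 • e 1 + x 2 • e 2 := by
    intro x; ext1 k; fin_cases k <;> simp [e]
  have lin1 : ∀ x y z, Ψ x y z = x 0 * Ψ (e 0) y z + x 1 * Ψ (e 1) y z + x 2 * Ψ (e 2) y z := by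
    intro x y z
    conv_lhs => rw [exp x]
    simp only [add1, smul1]
  have lin2 : ∀ x y z, Ψ x y z = y 0 * Ψ x (e 0) z + y 1 * Ψ x (e 1) z + y 2 * Ψ x (e 2) z := by
    intro x y z
    rw [alt1, lin1 y, alt1 (e 0), alt1 (e 1), alt1 (e 2)]; ring
  have lin3 : ∀ x y z, Ψ x y z = z 0 * Ψ x y (e 0) + z 1 * Ψ x y (e 1) + z 2 * Ψ x y (e 2) := by
    intro x y z
    rw [alt2, lin2 x z, alt2 x (e 0), alt2 x (e 1), alt2 x (e 2)]; ring
  have d1 : ∀ x z, Ψ x x z = 0 := fun x z => self_eq_neg.1 (alt1 x x z)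
  have d2 : ∀ x z, Ψ x z z = 0 := fun x z => self_eq_neg.1 (alt2 x z z)
  have d3 : ∀ x z, Ψ x z x = 0 := fun x z => by rw [alt1, d2, neg_zero]
  refine ⟨Ψ (e 0) (e 1) (e 2), fun x y z => ?_⟩
  have : Ψ x y z = Ψ (e 0) (e 1) (e 2) * (Matrix.of ![x, y, z]).det := by
    rw [lin1 x, lin2 _ y, lin2 _ y, lin2 _ y]
    simp only [lin3 _ _ z, d1, d2, d3]
    rw [alt2 (e 0) (e 2) (e 1), alt1 (e 1) (e 0) (e 2), alt2 (e 1) (e 2) (e 0),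
      alt1 (e 1) (e 0) (e 2), alt1 (e 2) (e 0) (e 1), alt2 (e 0) (e 2) (e 1),
      alt2 (e 2) (e 1) (e 0), alt1 (e 2) (e 0) (e 1), alt2 (e 0) (e 2) (e 1), Matrix.det_fin_three]
    simp
    ring
  rw [← this]

/-- The complex Gram determinant of three vectors, in terms of the real Gram matrix and of
`ω(u, v) = g(Ju, v)`. -/
def hermGram (g : E →L[ℝ] E →L[ℝ] ℝ) (J : E →L[ℝ] E) (u v w : E) : ℝ :=
  (g u u * g v v * g w w + 2 * g u v * g v w * g u w - g u u * g v w ^ 2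
      - g v v * g u w ^ 2 - g w w * g u v ^ 2)
    - (g (J v) w ^ 2 * g u u + g (J w) u ^ 2 * g v v + g (J u) v ^ 2 * g w w
      + 2 * g (J v) w * g (J w) u * g u v + 2 * g (J v) w * g (J u) v * g u w
      + 2 * g (J w) u * g (J u) v * g v w)

/-- A unitary frame has complex Gram determinant one. -/
lemma IsHermitianPair.exists_hermGram_eq_one [FiniteDimensional ℝ E] (hh : IsHermitianPair g J)
    (hd : Module.finrank ℝ E = 6) : ∃ u v w, hermGram g J u v w = 1 := by
  obtain ⟨u, hu, -⟩ := hh.exists_unit_normal (![] : Fin 0 → E) (by omega)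
  obtain ⟨v, w, hv, hw, hvw, hJvw, huv, hJuv, huw, hJuw⟩ := hh.exists_hermitian_normals hd u
  refine ⟨u, v, w, ?_⟩
  have : g (J w) u = 0 := by rw [hh.skew, hh.symm, hJuw, neg_zero]
  simp [hermGram, hu, hv, hw, hvw, hJvw, huv, hJuv, huw, this]

/-- The two pointwise identities for a pure form `ψ` of squared norm `a`: the Hermitian Gram
determinant formula `|Ψ(u, v, w)|² = a det_ℂ`, and the polarised norm of the contraction with two
vectors. -/
lemma IsPureForm.exists_norm [FiniteDimensional ℝ E] {ψ : E →L[ℝ] E →L[ℝ] E →L[ℝ] ℝ}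
    (hψ : IsPureForm J ψ) (h : IsHermitianPair g J) (hd : Module.finrank ℝ E = 6) :
    ∃ a : ℝ, (∀ u v w, ψ u v w ^ 2 + ψ (J u) v w ^ 2 =
      a * hermGram g J u v w) ∧
      ∀ X Y Z U V, (∀ K, g U K = ψ X Y K) → (∀ K, g V K = ψ X Z K) →
        g U V = a * (g X X * g Y Z - g X Y * g X Z - g (J X) Y * g (J X) Z) := by
  obtain ⟨T, hTJ, hTg⟩ := h.exists_unitary_frame hd
  obtain ⟨l, hl⟩ := hψ.exists_eq_re_det hTJ h.J_J
  refine ⟨Complex.normSq l, fun u v w => ?_, fun X Y Z U V hU hV => ?_⟩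
  · obtain ⟨x, rfl⟩ := T.surjective u
    obtain ⟨y, rfl⟩ := T.surjective v
    obtain ⟨z, rfl⟩ := T.surjective w
    have e1 : (Matrix.of ![Complex.I • x, y, z]).det = Complex.I * (Matrix.of ![x, y, z]).det := by
      simp only [Matrix.det_fin_three]; simp; ring
    rw [← hTJ, hl, hl, e1]
    have e2 : (l * (Matrix.of ![x, y, z]).det).re ^ 2 +
        (l * (Complex.I * (Matrix.of ![x, y, z]).det)).re ^ 2 =
        Complex.normSq l * Complex.normSq (Matrix.of ![x, y, z]).det := by
      rw [Complex.normSq_apply, Complex.normSq_apply]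
      simp only [Complex.mul_re, Complex.mul_im, Complex.I_re, Complex.I_im]
      ring
    rw [e2]
    congr 1
    simp only [hermGram, ← hTJ, hTg, Fin.sum_univ_three, Pi.smul_apply, smul_eq_mul,
      Matrix.det_fin_three,
      Complex.normSq_apply]
    simp
    ring
  · obtain ⟨x, rfl⟩ := T.surjective X
    obtain ⟨y, rfl⟩ := T.surjective Y
    obtain ⟨z, rfl⟩ := T.surjective Z
    -- the contraction is the conjugate of the complex cross product
    have cross : ∀ (y : Fin 3 → ℂ) (U : E), (∀ K, g U K = ψ (T x) (T y) K) →
        U = T ![(starRingEnd ℂ) (l * (x 1 * y 2 - x 2 * y 1)),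
          (starRingEnd ℂ) (l * (x 2 * y 0 - x 0 * y 2)),
          (starRingEnd ℂ) (l * (x 0 * y 1 - x 1 * y 0))] := by
      intro y U hU
      refine h.eq_of_forall fun K => ?_
      obtain ⟨k, rfl⟩ := T.surjective K
      rw [hU, hl, hTg, Fin.sum_univ_three, Matrix.det_fin_three]
      simp
      ring
    rw [cross y U hU, cross z V hV, ← hTJ]
    simp only [hTg, Fin.sum_univ_three, Complex.normSq_apply]
    simp
    ring

end HermitianAlgebra

/-! ### Nearly Kähler geometry on an open subset of a vector space -/

section LocalNearlyKahler

variable {E : Type*} [NormedAddCommGroup E] [NormedSpace ℝ E]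

/-- Cyclic rotation of the arguments of a trilinear map: `cyc D X Y Z = D Y Z X`. -/
def cyc : (E →L[ℝ] E →L[ℝ] E →L[ℝ] ℝ) →L[ℝ] (E →L[ℝ] E →L[ℝ] E →L[ℝ] ℝ) :=
  (ContinuousLinearMap.flipₗᵢ ℝ E E (E →L[ℝ] ℝ) :
      (E →L[ℝ] E →L[ℝ] E →L[ℝ] ℝ) →L[ℝ] (E →L[ℝ] E →L[ℝ] E →L[ℝ] ℝ)).comp
    (ContinuousLinearMap.compL ℝ E (E →L[ℝ] E →L[ℝ] ℝ) (E →L[ℝ] E →L[ℝ] ℝ)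
      (ContinuousLinearMap.flipₗᵢ ℝ E E ℝ : (E →L[ℝ] E →L[ℝ] ℝ) →L[ℝ] (E →L[ℝ] E →L[ℝ] ℝ)))

/-- One third of the sum over the cyclic rotations of the arguments. -/
def cycMean : (E →L[ℝ] E →L[ℝ] E →L[ℝ] ℝ) →L[ℝ] (E →L[ℝ] E →L[ℝ] E →L[ℝ] ℝ) :=
  (1 / 3 : ℝ) • (ContinuousLinearMap.id ℝ (E →L[ℝ] E →L[ℝ] E →L[ℝ] ℝ) + (cyc (E := E)) +
    (cyc (E := E)).comp (cyc (E := E)))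

lemma cycMean_apply (D : E →L[ℝ] E →L[ℝ] E →L[ℝ] ℝ) (X Y Z : E) :
    cycMean D X Y Z = (D X Y Z + D Y Z X + D Z X Y) / 3 := by
  change (1 / 3 : ℝ) * (D X Y Z + D Y Z X + D Z X Y) = _
  ring

variable (g : E → E →L[ℝ] E →L[ℝ] ℝ) (J : E → E →L[ℝ] E)

/-- The fundamental form `ω(X, Y) = g(JX, Y)`. -/
def omegaL (y : E) : E →L[ℝ] E →L[ℝ] ℝ := (g y).comp (J y)

/-- The 3-form `ψ = dω / 3`. -/
def psiL (y : E) : E →L[ℝ] E →L[ℝ] E →L[ℝ] ℝ :=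
  cycMean (fderiv ℝ (omegaL g J) y)

/-- The 3-form `ψ(JX, Y, Z)`. -/
def sigmaL (y : E) : E →L[ℝ] E →L[ℝ] E →L[ℝ] ℝ := (psiL g J y).comp (J y)

/-- The 4-form `ω ∧ ω / 2`. -/
def pfaff (w : E →L[ℝ] E →L[ℝ] ℝ) (a b c d : E) : ℝ :=
  w a b * w c d - w a c * w b d + w a d * w b c

/-- A strict nearly Kähler structure on an open set `U`. The Levi-Civita connection enters at each
point through its (symmetric, metric) Christoffel tensor. -/
structure LocalNK (U : Set E) : Prop where
  isOpen : IsOpen U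
  smooth_g : ContDiffOn ℝ ∞ g U
  smooth_J : ContDiffOn ℝ ∞ J U
  herm : ∀ y ∈ U, IsHermitianPair (g y) (J y)
  conn : ∀ y ∈ U, ∃ Γ : E →L[ℝ] E →L[ℝ] E, (∀ X Y, Γ X Y = Γ Y X) ∧
    (∀ X Y Z, fderiv ℝ g y X Y Z = g y (Γ X Y) Z + g y Y (Γ X Z)) ∧
    (∀ X, fderiv ℝ J y X X + Γ X (J y X) - J y (Γ X X) = 0) ∧
    ∀ X, X ≠ 0 → ∃ Y, fderiv ℝ J y X Y + Γ X (J y Y) - J y (Γ X Y) ≠ 0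

variable {g J}

lemma omegaL_apply (y X Y : E) : omegaL g J y X Y = g y (J y X) Y := rfl

lemma sigmaL_apply (y X Y Z : E) : sigmaL g J y X Y Z = psiL g J y (J y X) Y Z := rfl

lemma psiL_apply (y X Y Z : E) : psiL g J y X Y Z = dTwo (omegaL g J) y X Y Z / 3 := by
  rw [psiL, cycMean_apply, dTwo]

namespace LocalNK

variable {U : Set E} (H : LocalNK g J U)
include H

lemma contDiffAt_g {y : E} (hy : y ∈ U) : ContDiffAt ℝ ∞ g y :=
  H.smooth_g.contDiffAt (H.isOpen.mem_nhds hy)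

lemma contDiffAt_J {y : E} (hy : y ∈ U) : ContDiffAt ℝ ∞ J y :=
  H.smooth_J.contDiffAt (H.isOpen.mem_nhds hy)

lemma contDiffAt_omegaL {y : E} (hy : y ∈ U) : ContDiffAt ℝ ∞ (omegaL g J) y :=
  (H.contDiffAt_g hy).clm_comp (H.contDiffAt_J hy)

lemma contDiffAt_fderiv_omegaL {y : E} (hy : y ∈ U) :
    ContDiffAt ℝ ∞ (fderiv ℝ (omegaL g J)) y :=
  (H.contDiffAt_omegaL hy).fderiv_right (by simp)

lemma contDiffAt_psiL {y : E} (hy : y ∈ U) : ContDiffAt ℝ ∞ (psiL g J) y :=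
  cycMean.contDiff.contDiffAt.comp y (H.contDiffAt_fderiv_omegaL hy)

lemma contDiffAt_sigmaL {y : E} (hy : y ∈ U) : ContDiffAt ℝ ∞ (sigmaL g J) y :=
  (H.contDiffAt_psiL hy).clm_comp (H.contDiffAt_J hy)

lemma omegaL_skew {y : E} (hy : y ∈ U) (X Y : E) : omegaL g J y X Y = -omegaL g J y Y X := by
  rw [omegaL_apply, omegaL_apply, (H.herm y hy).skew, (H.herm y hy).symm]

omit H in
/-- Differentiating an identity which holds on an open set. -/
lemma fderiv_eq_of_eqOn {F : Type*} [NormedAddCommGroup F] [NormedSpace ℝ F] {U : Set E}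
    (hU : IsOpen U) {f h : E → F} (e : ∀ y ∈ U, f y = h y) {y : E} (hy : y ∈ U) :
    fderiv ℝ f y = fderiv ℝ h y :=
  (eventuallyEq_of_mem (hU.mem_nhds hy) e).fderiv_eq

lemma fderiv_omegaL {y : E} (hy : y ∈ U) (X Y Z : E) :
    fderiv ℝ (omegaL g J) y X Y Z = fderiv ℝ g y X (J y Y) Z + g y (fderiv ℝ J y X Y) Z := by
  have h := ((H.contDiffAt_g hy).differentiableAt (by simp)).hasFDerivAt.clm_comp
    ((H.contDiffAt_J hy).differentiableAt (by simp)).hasFDerivAt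
  rw [show omegaL g J = fun y => (g y).comp (J y) from rfl, h.fderiv]
  simp [add_comm]

omit H in
lemma fderiv_apply₂ {w : E → E →L[ℝ] E →L[ℝ] ℝ} {y : E} (h : DifferentiableAt ℝ w y)
    (V X Y : E) : fderiv ℝ (fun y => w y X Y) y V = fderiv ℝ w y V X Y := by
  rw [((h.hasFDerivAt.clm_apply (hasFDerivAt_const X y)).clm_apply (hasFDerivAt_const Y y)).fderiv]
  simp

omit H in
lemma fderiv_apply₃ {w : E → E →L[ℝ] E →L[ℝ] E →L[ℝ] ℝ} {y : E} (h : DifferentiableAt ℝ w y)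
    (V X Y Z : E) : fderiv ℝ (fun y => w y X Y Z) y V = fderiv ℝ w y V X Y Z := by
  rw [(((h.hasFDerivAt.clm_apply (hasFDerivAt_const X y)).clm_apply
    (hasFDerivAt_const Y y)).clm_apply (hasFDerivAt_const Z y)).fderiv]
  simp

lemma fderiv_omegaL_skew {y : E} (hy : y ∈ U) (V X Y : E) :
    fderiv ℝ (omegaL g J) y V X Y = -fderiv ℝ (omegaL g J) y V Y X := by
  have hd := (H.contDiffAt_omegaL hy).differentiableAt (by simp)
  have h := fderiv_eq_of_eqOn (f := fun y => omegaL g J y X Y)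
    (h := fun y => -omegaL g J y Y X) H.isOpen (fun y hy => H.omegaL_skew hy X Y) hy
  have h' := DFunLike.congr_fun h V
  rw [fderiv_fun_neg, _root_.neg_apply, fderiv_apply₂ hd, fderiv_apply₂ hd] at h'
  exact h'

lemma fderiv_J_J {y : E} (hy : y ∈ U) (V X : E) :
    fderiv ℝ J y V (J y X) = -J y (fderiv ℝ J y V X) := by
  have hd := ((H.contDiffAt_J hy).differentiableAt (by simp)).hasFDerivAt
  have h := fderiv_eq_of_eqOn (f := fun y => J y (J y X))
    (h := fun _ => -X) H.isOpen (fun y hy => (H.herm y hy).J_J X) hy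
  have h' := DFunLike.congr_fun h V
  rw [(hd.clm_apply (hd.clm_apply (hasFDerivAt_const X y))).fderiv] at h'
  simp at h'
  exact eq_neg_of_add_eq_zero_right h'

/-- The Christoffel tensor `Γ` and the covariant derivative `A X Y = (∇_X J) Y` at a point, with
the identity `g((∇_X J) Y, Z) = ψ(X, Y, Z)`. -/
lemma exists_connection {y : E} (hy : y ∈ U) : ∃ Γ A : E →L[ℝ] E →L[ℝ] E,
    (∀ X Y, Γ X Y = Γ Y X) ∧
    (∀ X Y, fderiv ℝ J y X Y = A X Y - Γ X (J y Y) + J y (Γ X Y)) ∧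
    (∀ X Y, A X Y = -A Y X) ∧ (∀ X Y, A X (J y Y) = -J y (A X Y)) ∧
    (∀ X Y Z, g y (A X Y) Z = -g y (A X Z) Y) ∧
    (∀ X Y Z, psiL g J y X Y Z = g y (A X Y) Z) ∧ ∀ X, X ≠ 0 → ∃ Y, A X Y ≠ 0 := by
  obtain ⟨Γ, sym, met, nearly, strict⟩ := H.conn y hy
  have hh := H.herm y hy
  let A : E →L[ℝ] E →L[ℝ] E := fderiv ℝ J y + (ContinuousLinearMap.compL ℝ E E E).flip (J y) ∘L Γ
    - (ContinuousLinearMap.compL ℝ E E E (J y)) ∘L Γ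
  have hA : ∀ X Y, A X Y = fderiv ℝ J y X Y + Γ X (J y Y) - J y (Γ X Y) := fun X Y => by simp [A]
  have skewA : ∀ X Y, A X Y = -A Y X := by
    intro X Y
    have h1 : A (X + Y) (X + Y) = 0 := by rw [hA]; exact nearly _
    have h2 : A X X = 0 := by rw [hA]; exact nearly _
    have h3 : A Y Y = 0 := by rw [hA]; exact nearly _
    simp only [map_add, _root_.add_apply, h2, h3, zero_add, add_zero] at h1
    exact eq_neg_of_add_eq_zero_left (by rw [add_comm]; exact h1)
  have hw : ∀ X Y Z, g y (A X Y) Z = fderiv ℝ (omegaL g J) y X Y Z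
      - omegaL g J y (Γ X Y) Z - omegaL g J y Y (Γ X Z) := by
    intro X Y Z
    rw [H.fderiv_omegaL hy, met, hA, omegaL_apply, omegaL_apply]
    simp only [map_add, map_sub, _root_.add_apply, _root_.sub_apply]
    ring
  have skew' : ∀ X Y Z, g y (A X Y) Z = -g y (A X Z) Y := by
    intro X Y Z
    rw [hw, hw, H.fderiv_omegaL_skew hy X Y Z, H.omegaL_skew hy (Γ X Y) Z,
      H.omegaL_skew hy Y (Γ X Z)]
    ring
  refine ⟨Γ, A, sym, fun X Y => by rw [hA]; abel, skewA, fun X Y => ?_, skew', fun X Y Z => ?_,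
    fun X hX => ?_⟩
  · rw [hA, hA, H.fderiv_J_J hy, hh.J_J]
    simp only [map_neg, map_add, map_sub, hh.J_J]
    abel
  -- `∇ω = g(A·, ·)` is alternating, so `dω`, its sum over cyclic permutations, is thrice itself
  · have c1 : g y (A Y Z) X = g y (A X Y) Z := by
      rw [skewA Y Z, map_neg, _root_.neg_apply, skew' Z Y X, neg_neg, skewA Z X, map_neg,
        _root_.neg_apply, ← skew' X Y Z]
    have c2 : g y (A Z X) Y = g y (A X Y) Z := by
      rw [skewA Z X, map_neg, _root_.neg_apply, ← skew' X Y Z]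
    rw [psiL_apply, dTwo]
    have e1 := hw X Y Z
    have e2 := hw Y Z X
    have e3 := hw Z X Y
    rw [c1] at e2
    rw [c2] at e3
    have s1 := H.omegaL_skew hy Y (Γ X Z)
    have s2 := H.omegaL_skew hy Z (Γ Y X)
    have s3 := H.omegaL_skew hy X (Γ Z Y)
    rw [sym X Z] at e1 s1
    rw [sym Y X] at e2 s2
    rw [sym Z Y] at e3 s3
    linarith
  · obtain ⟨Y, hY⟩ := strict X hX
    exact ⟨Y, by rwa [hA]⟩

/-- `ψ(X, Y, Z) = g((∇_X J) Y, Z)` is alternating by the nearly Kähler condition, and `J`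
anticommutes with `∇_X J`. -/
lemma isPureForm {y : E} (hy : y ∈ U) : IsPureForm (J y) (psiL g J y) := by
  obtain ⟨Γ, A, -, -, skewA, AJ, skew', hψ, -⟩ := H.exists_connection hy
  have alt₁ : ∀ u v w, psiL g J y u v w = -psiL g J y v u w := fun u v w => by
    rw [hψ, hψ, skewA]; simp
  have alt₂ : ∀ u v w, psiL g J y u v w = -psiL g J y u w v := fun u v w => by
    rw [hψ, hψ, skew']
  have sh : ∀ u v w, psiL g J y u (J y v) w = psiL g J y u v (J y w) := fun u v w => by
    rw [hψ, hψ, AJ, map_neg, _root_.neg_apply, (H.herm y hy).skew, neg_neg]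
  exact ⟨alt₁, alt₂, fun u v w => by
    rw [sh u v w, alt₁ u v, alt₂ v u, neg_neg, sh v w u, alt₁ (J y u), alt₂ v (J y u), neg_neg]⟩

/-- `dψ = 0`, because `3ψ = dω`. -/
lemma dThree_psiL {y : E} (hy : y ∈ U) (W X Y Z : E) : dThree (psiL g J) y W X Y Z = 0 := by
  have hD := (H.contDiffAt_fderiv_omegaL hy).differentiableAt (by simp)
  have hf : ∀ V, fderiv ℝ (psiL g J) y V
      = cycMean (fderiv ℝ (fderiv ℝ (omegaL g J)) y V) := fun V => by
    rw [show psiL g J = cycMean ∘ fderiv ℝ (omegaL g J) from rfl,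
      (cycMean.hasFDerivAt.comp y hD.hasFDerivAt).fderiv]
    rfl
  have h2 := (H.contDiffAt_omegaL hy).of_le (m := 2) ENat.LEInfty.out
  have sym := fderiv_fderiv_symm h2
  have sk : ∀ V X Y Z, fderiv ℝ (fderiv ℝ (omegaL g J)) y V X Y Z =
      -fderiv ℝ (fderiv ℝ (omegaL g J)) y V X Z Y := by
    intro V X Y Z
    have h := fderiv_eq_of_eqOn (f := fun y => fderiv ℝ (omegaL g J) y X Y Z)
      (h := fun y => -fderiv ℝ (omegaL g J) y X Z Y) H.isOpen
      (fun y hy => H.fderiv_omegaL_skew hy X Y Z) hy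
    have h' := DFunLike.congr_fun h V
    rw [fderiv_fun_neg, _root_.neg_apply, fderiv_apply₃ hD, fderiv_apply₃ hD] at h'
    exact h'
  simp only [dThree, hf, cycMean_apply]
  rw [sym X W, sym Y W, sym Z W, sym Y X, sym Z X, sym Z Y]
  linarith [sk W X Y Z, sk W Y Z X, sk W Z X Y, sk X W Y Z, sk X Y Z W, sk X Z W Y,
    sk Y W X Z, sk Y X Z W, sk Y Z W X, sk Z W X Y, sk Z X Y W, sk Z Y W X]

lemma fderiv_psiL_alt₁ {y : E} (hy : y ∈ U) (V X Y Z : E) :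
    fderiv ℝ (psiL g J) y V X Y Z = -fderiv ℝ (psiL g J) y V Y X Z := by
  have dψ := (H.contDiffAt_psiL hy).differentiableAt (by simp)
  have h := fderiv_eq_of_eqOn (f := fun y => psiL g J y X Y Z)
    (h := fun y => -psiL g J y Y X Z) H.isOpen
    (fun y hy => (H.isPureForm hy).alt₁ X Y Z) hy
  have h' := DFunLike.congr_fun h V
  rwa [fderiv_fun_neg, _root_.neg_apply, fderiv_apply₃ dψ, fderiv_apply₃ dψ] at h'

lemma fderiv_psiL_alt₂ {y : E} (hy : y ∈ U) (V X Y Z : E) :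
    fderiv ℝ (psiL g J) y V X Y Z = -fderiv ℝ (psiL g J) y V X Z Y := by
  have dψ := (H.contDiffAt_psiL hy).differentiableAt (by simp)
  have h := fderiv_eq_of_eqOn (f := fun y => psiL g J y X Y Z)
    (h := fun y => -psiL g J y X Z Y) H.isOpen
    (fun y hy => (H.isPureForm hy).alt₂ X Y Z) hy
  have h' := DFunLike.congr_fun h V
  rwa [fderiv_fun_neg, _root_.neg_apply, fderiv_apply₃ dψ, fderiv_apply₃ dψ] at h'

lemma fderiv_sigmaL {y : E} (hy : y ∈ U) (V X Y Z : E) :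
    fderiv ℝ (sigmaL g J) y V X Y Z =
      fderiv ℝ (psiL g J) y V (J y X) Y Z + psiL g J y (fderiv ℝ J y V X) Y Z := by
  have dψ := ((H.contDiffAt_psiL hy).differentiableAt (by simp)).hasFDerivAt
  have dJ := ((H.contDiffAt_J hy).differentiableAt (by simp)).hasFDerivAt
  rw [show sigmaL g J = fun y => (psiL g J y).comp (J y) from rfl, (dψ.clm_comp dJ).fderiv]
  simp [add_comm]

/-- The derivative of the identity `ψ(JX, Y, Z) = ψ(X, JY, Z)`. -/
lemma fderiv_psiL_shift {y : E} (hy : y ∈ U) (V X Y Z : E) :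
    fderiv ℝ (psiL g J) y V (J y X) Y Z + psiL g J y (fderiv ℝ J y V X) Y Z =
      fderiv ℝ (psiL g J) y V X (J y Y) Z + psiL g J y X (fderiv ℝ J y V Y) Z := by
  have dψ := (H.contDiffAt_psiL hy).differentiableAt (by simp)
  have dσ := (H.contDiffAt_sigmaL hy).differentiableAt (by simp)
  have dJ' := (H.contDiffAt_J hy).differentiableAt (by simp)
  rw [← H.fderiv_sigmaL hy, ← fderiv_apply₃ dσ]
  have e : fderiv ℝ (fun y => psiL g J y X (J y Y) Z) y V =
      fderiv ℝ (psiL g J) y V X (J y Y) Z + psiL g J y X (fderiv ℝ J y V Y) Z := by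
    rw [(((dψ.hasFDerivAt.clm_apply (hasFDerivAt_const X y)).clm_apply
      (dJ'.hasFDerivAt.clm_apply (hasFDerivAt_const Y y))).clm_apply
      (hasFDerivAt_const Z y)).fderiv]
    simp [add_comm]
  rw [← e]
  exact DFunLike.congr_fun (fderiv_eq_of_eqOn H.isOpen
    (fun y hy => (H.isPureForm hy).shift X Y Z) hy) V

lemma fderiv_sigmaL_alt₁ {y : E} (hy : y ∈ U) (V X Y Z : E) :
    fderiv ℝ (sigmaL g J) y V X Y Z = -fderiv ℝ (sigmaL g J) y V Y X Z := by
  rw [H.fderiv_sigmaL hy, H.fderiv_sigmaL hy, H.fderiv_psiL_shift hy, H.fderiv_psiL_alt₁ hy,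
    (H.isPureForm hy).alt₁]
  ring

lemma fderiv_sigmaL_alt₂ {y : E} (hy : y ∈ U) (V X Y Z : E) :
    fderiv ℝ (sigmaL g J) y V X Y Z = -fderiv ℝ (sigmaL g J) y V X Z Y := by
  rw [H.fderiv_sigmaL hy, H.fderiv_sigmaL hy, H.fderiv_psiL_alt₂ hy, (H.isPureForm hy).alt₂]
  ring

/-- The values of `dσ` on the quadruples `(X, JX, Y, Z)`. Differentiating `ψ(X, JX, ·) = 0` and
`ψ(JX, Y, Z) = ψ(X, JY, Z)` and using `dψ = 0` eliminates all second derivatives. -/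
lemma dThree_sigmaL_self {y : E} (hy : y ∈ U) {Γ A : E →L[ℝ] E →L[ℝ] E}
    (sym : ∀ X Y, Γ X Y = Γ Y X)
    (dJ : ∀ X Y, fderiv ℝ J y X Y = A X Y - Γ X (J y Y) + J y (Γ X Y))
    (skewA : ∀ X Y, A X Y = -A Y X) (AJ : ∀ X Y, A X (J y Y) = -J y (A X Y))
    (hψ : ∀ X Y Z, psiL g J y X Y Z = g y (A X Y) Z) :
    ∀ X Y Z, dThree (sigmaL g J) y X (J y X) Y Z = 4 * g y (J y (A X Z)) (A X Y) := by
  have hh := H.herm y hy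
  have hp := H.isPureForm hy
  have a1 := hp.alt₁
  have a2 := hp.alt₂
  have D1 := H.fderiv_psiL_alt₁ hy
  have D2 := H.fderiv_psiL_alt₂ hy
  have S := H.fderiv_psiL_shift hy
  have hσ := H.fderiv_sigmaL hy
  -- `N` is the covariant derivative of `ψ`
  obtain ⟨N, hN⟩ : ∃ N : E → E → E → E → ℝ, ∀ V X Y Z, N V X Y Z =
      fderiv ℝ (psiL g J) y V X Y Z - psiL g J y (Γ V X) Y Z - psiL g J y X (Γ V Y) Z
        - psiL g J y X Y (Γ V Z) := ⟨_, fun _ _ _ _ => rfl⟩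
  have N1 : ∀ V X Y Z, N V X Y Z = -N V Y X Z := by
    intro V X Y Z
    rw [hN, hN, D1, a1 (Γ V X) Y Z, a1 X (Γ V Y) Z, a1 X Y (Γ V Z)]; ring
  have N2 : ∀ V X Y Z, N V X Y Z = -N V X Z Y := by
    intro V X Y Z
    rw [hN, hN, D2, a2 (Γ V X) Y Z, a2 X (Γ V Y) Z, a2 X Y (Γ V Z)]; ring
  have Nneg : ∀ V X Y Z, N V (-X) Y Z = -N V X Y Z := by
    intro V X Y Z
    simp only [hN, map_neg, _root_.neg_apply]; ring
  have NS : ∀ V X Y Z, N V (J y X) Y Z + psiL g J y (A V X) Y Z =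
      N V X (J y Y) Z + psiL g J y X (A V Y) Z := by
    intro V X Y Z
    have h := S V X Y Z
    rw [dJ, dJ] at h
    simp only [map_add, map_sub, _root_.add_apply, _root_.sub_apply] at h
    rw [hN, hN]
    have e1 := hp.shift (Γ V X) Y Z
    have e2 := hp.shift X (Γ V Y) Z
    have e3 := hp.shift X Y (Γ V Z)
    linarith
  have Nd : ∀ W X Y Z, N W X Y Z - N X W Y Z + N Y W X Z - N Z W X Y = 0 := by
    intro W X Y Z
    have h := H.dThree_psiL hy W X Y Z
    rw [dThree] at h
    simp only [hN]
    rw [sym X W, sym Y W, sym Z W, sym Y X, sym Z X, sym Z Y]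
    have e1 := a1 X (Γ W Y) Z
    have e2 := a2 X Y (Γ W Z)
    have e3 := a1 X (Γ W Z) Y
    have e4 := a1 W (Γ X Y) Z
    have e5 := a2 W Y (Γ X Z)
    have e6 := a1 W (Γ X Z) Y
    have e7 := a2 W X (Γ Y Z)
    have e8 := a2 W (Γ X Y) Z
    have e9 := a2 W (Γ X Z) Y
    have e10 := a2 W (Γ Y Z) X
    linarith
  have hN' : ∀ W X Y Z, dThree (sigmaL g J) y W X Y Z =
      (N W (J y X) Y Z + psiL g J y (A W X) Y Z) - (N X (J y W) Y Z + psiL g J y (A X W) Y Z)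
      + (N Y (J y W) X Z + psiL g J y (A Y W) X Z)
      - (N Z (J y W) X Y + psiL g J y (A Z W) X Y) := by
    intro W X Y Z
    simp only [dThree, hσ, dJ, hN, map_add, map_sub, _root_.add_apply, _root_.sub_apply]
    rw [sym X W, sym Y W, sym Z W, sym Y X, sym Z X, sym Z Y]
    have t := hp.shift
    have e1 := t X (Γ W Y) Z
    have e2 := t X Y (Γ W Z)
    have e3 := t W (Γ X Y) Z
    have e4 := t W Y (Γ X Z)
    have e5 := t W (Γ X Y) Z
    have e6 := t W X (Γ Y Z)
    have f1 := a1 (J y X) (Γ W Y) Z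
    have f2 := a2 (J y X) Y (Γ W Z)
    have f3 := t (Γ W Y) X Z
    have f4 := t (Γ W Z) X Y
    have f5 := a2 (J y W) (Γ X Z) Y
    have f6 := a2 (J y W) (Γ X Y) Z
    have f7 := a2 (J y W) (Γ Y Z) X
    have f8 := a1 (Γ W Y) (J y X) Z
    have f9 := a1 (Γ W Z) (J y X) Y
    linarith
  -- the values on `(X, JX, Y, Z)`
  intro X Y Z
  have AX : ∀ X, A X X = 0 := fun X => by
    have h := skewA X X
    rw [eq_neg_iff_add_eq_zero, ← two_smul ℝ] at h
    simpa using h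
  have AJX : A (J y X) X = 0 := by rw [skewA, AJ, AX]; simp
  have AXJ : A X (J y X) = 0 := by rw [AJ, AX]; simp
  have p0 : ∀ X K, psiL g J y X X K = 0 := fun X K => by linarith [a1 X X K]
  have n0 : ∀ V X K, N V X X K = 0 := fun V X K => by linarith [N1 V X X K]
  -- consequences of `dψ = 0` on `(X, JX, Y, Z)`
  have k1 : ∀ V Z, N V X (J y X) Z = -psiL g J y X (A V X) Z := by
    intro V Z
    have h := NS V X X Z
    have h2 := a1 (A V X) X Z
    have h3 := N1 V X (J y X) Z
    linarith
  have k2 : ∀ Y Z, N X (J y X) Y Z = N (J y X) X Y Z := by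
    intro Y Z
    have h := Nd X (J y X) Y Z
    rw [k1, k1] at h
    have h1 : psiL g J y X (A Y X) Z = psiL g J y X (A Z X) Y := by
      rw [a2, a2 X (A Z X) Y, hψ, hψ, skewA Y X, skewA Z X]
      simp only [map_neg]
      rw [hh.symm]
    linarith
  have k3 := NS X (J y X) Y Z
  rw [hh.J_J, Nneg, AXJ] at k3
  have k4 := NS (J y X) X Y Z
  rw [AJX] at k4
  have k5 := k2 (J y Y) Z
  simp only [map_zero, _root_.zero_apply] at k3 k4
  have sw : ∀ Y Z, psiL g J y (J y X) (A X Y) Z = g y (J y (A X Z)) (A X Y) := by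
    intro Y Z
    rw [hp.shift, a2, hψ, hh.skew]
  have k6 := sw Y Z
  have k7 : psiL g J y X (A (J y X) Y) Z = -g y (J y (A X Z)) (A X Y) := by
    rw [skewA, AJ, neg_neg, skewA Y X, map_neg, map_neg, _root_.neg_apply, ← hp.shift, sw]
  have k8 : N Y (J y X) (J y X) Z = 0 := n0 _ _ _
  have k9 : N Z (J y X) (J y X) Y = 0 := n0 _ _ _
  have k10 : psiL g J y (A Y X) (J y X) Z = g y (J y (A X Z)) (A X Y) := by
    rw [a1, skewA, map_neg, _root_.neg_apply, neg_neg, sw]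
  have k11 : psiL g J y (A Z X) (J y X) Y = -g y (J y (A X Z)) (A X Y) := by
    rw [a1, skewA, map_neg, _root_.neg_apply, neg_neg, sw, hh.skew, hh.symm]
  rw [hN', hh.J_J, Nneg, AXJ, AJX, k8, k9, k10, k11]
  simp only [map_zero, _root_.zero_apply]
  linarith

/-- The structure equation `dσ = 4 a (ω ∧ ω / 2)`, where `a` is the squared norm of `ψ`. By
`IsHermitianPair.fourForm_eq_zero` only quadruples `(X, JX, Y, Z)` have to be checked. -/
lemma dThree_sigmaL [FiniteDimensional ℝ E] (hd : Module.finrank ℝ E = 6) {y : E} (hy : y ∈ U)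
    {a : ℝ} (ha : ∀ X Y Z U V, (∀ K, g y U K = psiL g J y X Y K) →
      (∀ K, g y V K = psiL g J y X Z K) → g y U V = a * (g y X X * g y Y Z - g y X Y * g y X Z
        - g y (J y X) Y * g y (J y X) Z)) (b c d e : E) :
    dThree (sigmaL g J) y b c d e = 4 * a * pfaff (omegaL g J y) b c d e := by
  obtain ⟨Γ, A, sym, dJ, skewA, AJ, skew', hψ, -⟩ := H.exists_connection hy
  have hh := H.herm y hy
  have main := H.dThree_sigmaL_self hy sym dJ skewA AJ hψ
  have S1 := H.fderiv_sigmaL_alt₁ hy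
  have S2 := H.fderiv_sigmaL_alt₂ hy
  have := hh.fourForm_eq_zero hd
    (Θ := fun b c d e => dThree (sigmaL g J) y b c d e - 4 * a * pfaff (omegaL g J y) b c d e)
    ?_ ?_ ?_ ?_ ?_ ?_ b c d e
  · exact sub_eq_zero.1 this
  · intro b b' c d e
    simp only [dThree, pfaff, map_add, _root_.add_apply]; ring
  · intro r b c d e
    simp only [dThree, pfaff, map_smul, _root_.smul_apply, smul_eq_mul]; ring
  · intro b c d e
    simp only [dThree, pfaff]
    linear_combination S1 d b c e - S1 e b c d
      - 4 * a * (H.omegaL_skew hy b c * omegaL g J y d e)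
  · intro b c d e
    simp only [dThree, pfaff]
    linear_combination S1 b c d e - S2 e b c d
      - 4 * a * (H.omegaL_skew hy c d * omegaL g J y b e)
  · intro b c d e
    simp only [dThree, pfaff]
    linear_combination S2 b c d e - S2 c b d e
      - 4 * a * (H.omegaL_skew hy d e * omegaL g J y b c)
  · intro X Y Z
    have h := ha X (J y Z) Y (A X (J y Z)) (A X Y) (fun K => (hψ _ _ _).symm)
      (fun K => (hψ _ _ _).symm)
    rw [AJ, map_neg, _root_.neg_apply] at h
    simp only [main, pfaff, omegaL_apply, hh.J_J, map_neg, _root_.neg_apply, hh.isom] at h ⊢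
    have e1 := hh.skew Z Y
    have e2 := hh.skew X Z
    have e3 := hh.symm Z (J y Y)
    linear_combination (-4) * h + 4 * a * (-g y X X * (e1 - e3) + e2 * g y X Y)

end LocalNK

end LocalNearlyKahler

section LocalNearlyKahler

variable {E : Type*} [NormedAddCommGroup E] [NormedSpace ℝ E]
  {g : E → E →L[ℝ] E →L[ℝ] ℝ} {J : E → E →L[ℝ] E}

lemma _root_.HasFDerivAt.apply_const {F G : Type*} [NormedAddCommGroup F] [NormedSpace ℝ F]
    [NormedAddCommGroup G] [NormedSpace ℝ G] {w : E → F →L[ℝ] G} {w' : E →L[ℝ] F →L[ℝ] G} {y : E}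
    (h : HasFDerivAt w w' y) (X : F) : HasFDerivAt (fun y => w y X) (w'.flip X) y := by
  simpa using h.clm_apply (hasFDerivAt_const X y)

namespace LocalNK

variable {U : Set E} (H : LocalNK g J U)
include H

lemma isPureForm_sigma_alt₁ {y : E} (hy : y ∈ U) (u v w : E) :
    sigmaL g J y u v w = -sigmaL g J y v u w := by
  have h := H.isPureForm hy
  rw [sigmaL_apply, sigmaL_apply, h.shift, h.alt₁]

lemma isPureForm_sigma_alt₂ {y : E} (hy : y ∈ U) (u v w : E) :
    sigmaL g J y u v w = -sigmaL g J y u w v := by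
  rw [sigmaL_apply, sigmaL_apply, (H.isPureForm hy).alt₂]

set_option maxHeartbeats 1000000 in
/-- The squared norm of `ψ` is constant: this follows from `d(dσ) = 0`, where
`dσ = 4 a (ω ∧ ω / 2)`, because `ω ∧ dω = 0`. -/
lemma fderiv_norm_eq_zero [FiniteDimensional ℝ E] (hd : Module.finrank ℝ E = 6) {a : E → ℝ}
    (ha : ∀ y ∈ U, ∀ b c d e,
      dThree (sigmaL g J) y b c d e = 4 * a y * pfaff (omegaL g J y) b c d e)
    {y : E} (hy : y ∈ U) (hay : DifferentiableAt ℝ a y) : fderiv ℝ a y = 0 := by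
  have hh := H.herm y hy
  have hp := H.isPureForm hy
  have hσ2 := (H.contDiffAt_sigmaL hy).of_le (m := 2) ENat.LEInfty.out
  have sym := fderiv_fderiv_symm hσ2
  have dD := ((H.contDiffAt_sigmaL hy).fderiv_right (m := 1) (by norm_cast)).differentiableAt
    one_ne_zero
  have dw := (H.contDiffAt_omegaL hy).differentiableAt (by simp)
  have D4 : ∀ W X Y Z, HasFDerivAt (fun y => fderiv ℝ (sigmaL g J) y W X Y Z)
      (((((fderiv ℝ (fderiv ℝ (sigmaL g J)) y).flip W).flip X).flip Y).flip Z) y :=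
    fun W X Y Z =>
      (((dD.hasFDerivAt.apply_const W).apply_const X).apply_const Y).apply_const Z
  have E1 : ∀ V b c d e, fderiv ℝ (fun y => dThree (sigmaL g J) y b c d e) y V =
      fderiv ℝ (fderiv ℝ (sigmaL g J)) y V b c d e - fderiv ℝ (fderiv ℝ (sigmaL g J)) y V c b d e
      + fderiv ℝ (fderiv ℝ (sigmaL g J)) y V d b c e
      - fderiv ℝ (fderiv ℝ (sigmaL g J)) y V e b c d := by
    intro V b c d e
    have h := ((((D4 b c d e).fun_sub (D4 c b d e)).fun_add (D4 d b c e)).fun_sub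
      (D4 e b c d)).fderiv
    simp only [dThree]
    rw [h]
    rfl
  have Dw : ∀ X Y, HasFDerivAt (fun y => omegaL g J y X Y)
      (((fderiv ℝ (omegaL g J) y).flip X).flip Y) y := by
    intro X Y
    exact (dw.hasFDerivAt.apply_const X).apply_const Y
  have E2 : ∀ V b c d e, fderiv ℝ (fun y => dThree (sigmaL g J) y b c d e) y V =
      4 * (fderiv ℝ a y V * pfaff (omegaL g J y) b c d e + a y *
        (fderiv ℝ (omegaL g J) y V b c * omegaL g J y d e
          + omegaL g J y b c * fderiv ℝ (omegaL g J) y V d e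
          - fderiv ℝ (omegaL g J) y V b d * omegaL g J y c e
          - omegaL g J y b d * fderiv ℝ (omegaL g J) y V c e
          + fderiv ℝ (omegaL g J) y V b e * omegaL g J y c d
          + omegaL g J y b e * fderiv ℝ (omegaL g J) y V c d)) := by
    intro V b c d e
    rw [fderiv_eq_of_eqOn H.isOpen (fun y hy => ha y hy b c d e) hy]
    simp only [pfaff]
    rw [((hay.hasFDerivAt.const_mul 4).fun_mul
      ((((Dw b c).fun_mul (Dw d e)).fun_sub ((Dw b d).fun_mul (Dw c e))).fun_add
        ((Dw b e).fun_mul (Dw c d)))).fderiv]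
    simp
    ring
  ext Z
  -- the derivative of `a` along `Z` is read off from `d(dσ)(Z, X, JX, Y, JY) = 0`
  obtain ⟨X, Y, hX, hY, hXY, hJXY, hZX, hJZX, hZY, hJZY⟩ := hh.exists_hermitian_normals hd Z
  have w1 : ∀ u v, omegaL g J y u (J y v) = g y u v := fun u v => hh.isom u v
  have p0 : ∀ u v, dTwo (omegaL g J) y u v (J y v) = 0 := by
    intro u v
    have h1 := psiL_apply (g := g) (J := J) y u v (J y v)
    have h2 := hp.shift v v u
    have h3 := hp.alt₁ (J y v) v u
    have h4 := hp.alt₂ u v (J y v)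
    have h5 := hp.alt₁ u (J y v) v
    have h6 := hp.alt₂ (J y v) u v
    linarith
  have z0 : ∀ u v, omegaL g J y u (J y v) = 0 → omegaL g J y (J y v) u = 0 := fun u v h => by
    rw [H.omegaL_skew hy, h, neg_zero]
  have hwZX : omegaL g J y Z X = 0 := hJZX
  have hwZY : omegaL g J y Z Y = 0 := hJZY
  have hwXY : omegaL g J y X Y = 0 := hJXY
  have hwZX' : omegaL g J y Z (J y X) = 0 := by rw [w1, hZX]
  have hwZY' : omegaL g J y Z (J y Y) = 0 := by rw [w1, hZY]
  have hwXY' : omegaL g J y X (J y Y) = 0 := by rw [w1, hXY]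
  have hwJXY : omegaL g J y (J y X) Y = 0 := by
    rw [H.omegaL_skew hy, w1, hh.symm, hXY, neg_zero]
  have hwJXJY : omegaL g J y (J y X) (J y Y) = 0 := by
    rw [w1, hJXY]
  have hwX : omegaL g J y X (J y X) = 1 := by rw [w1, hX]
  have hwY : omegaL g J y Y (J y Y) = 1 := by rw [w1, hY]
  have q1 := p0 Z X
  have q2 := p0 Z Y
  -- the alternating sum of the ten second derivatives vanishes
  have F1 := E1 Z X (J y X) Y (J y Y)
  have F2 := E1 X Z (J y X) Y (J y Y)
  have F3 := E1 (J y X) Z X Y (J y Y)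
  have F4 := E1 Y Z X (J y X) (J y Y)
  have F5 := E1 (J y Y) Z X (J y X) Y
  rw [E2] at F1 F2 F3 F4 F5
  simp only [pfaff, hwZX, hwZY, hwXY, hwZX', hwZY', hwXY', hwJXY, hwJXJY, hwX, hwY]
    at F1 F2 F3 F4 F5
  rw [sym X Z] at F2
  rw [sym (J y X) Z, sym (J y X) X] at F3
  rw [sym Y Z, sym Y X, sym Y (J y X)] at F4
  rw [sym (J y Y) Z, sym (J y Y) X, sym (J y Y) (J y X), sym (J y Y) Y] at F5
  simp only [dTwo] at q1 q2
  have sk := H.fderiv_omegaL_skew hy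
  have k1 := sk X Z (J y X)
  have k2 := sk Y Z (J y Y)
  simp only [_root_.zero_apply]
  linear_combination (1/4) * (F1 - F2 + F3 - F4 + F5) - a y * (q1 + q2) + a y * (k1 + k2)

/-- Near every point, `ψ / c` is the real part of a complex volume form of norm one for a constant
`c > 0`, and `dσ = 4 c² (ω ∧ ω / 2)`. -/
lemma exists_norm_eventually [FiniteDimensional ℝ E] (hd : Module.finrank ℝ E = 6)
    {y₀ : E} (hy₀ : y₀ ∈ U) : ∃ c : ℝ, 0 < c ∧ ∀ᶠ y in 𝓝 y₀,
      (∀ u v w, psiL g J y u v w ^ 2 + sigmaL g J y u v w ^ 2 =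
        c ^ 2 * hermGram (g y) (J y) u v w) ∧
      ∀ u v w x, dThree (sigmaL g J) y u v w x = 4 * c ^ 2 * pfaff (omegaL g J y) u v w x := by
  choose! a ha using fun y (hy : y ∈ U) => (H.isPureForm hy).exists_norm (H.herm y hy) hd
  have frame : ∀ y ∈ U, ∃ u v w, hermGram (g y) (J y) u v w = 1 :=
    fun y hy => (H.herm y hy).exists_hermGram_eq_one hd
  -- if `a` vanished, so would `∇_X J`, against strictness
  have hpos : ∀ y ∈ U, 0 < a y := by
    intro y hy
    obtain ⟨u, v, w, huvw⟩ := frame y hy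
    have h0 : 0 ≤ a y := by
      have := (ha y hy).1 u v w
      rw [huvw, mul_one] at this
      rw [← this]; positivity
    refine lt_of_le_of_ne h0 fun h0' => ?_
    obtain ⟨Γ, A, -, -, -, -, -, hψ, hA⟩ := H.exists_connection hy
    have hu0 : u ≠ 0 := by
      rintro rfl
      simp [hermGram] at huvw
    obtain ⟨Y, hY⟩ := hA u hu0
    have := (ha y hy).2 u Y Y (A u Y) (A u Y) (fun K => (hψ _ _ _).symm)
      (fun K => (hψ _ _ _).symm)
    rw [← h0', zero_mul] at this
    exact ((H.herm y hy).pos _ hY).ne' this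
  have hstr : ∀ y ∈ U, ∀ b c d e,
      dThree (sigmaL g J) y b c d e = 4 * a y * pfaff (omegaL g J y) b c d e :=
    fun y hy => H.dThree_sigmaL hd hy (ha y hy).2
  -- near `y`, `a` is the quotient of `ψ² + σ²` by the Gram determinant of a fixed triple
  have hdiff : ∀ y ∈ U, DifferentiableAt ℝ a y := by
    intro y hy
    obtain ⟨u, v, w, huvw⟩ := frame y hy
    have dg := (H.contDiffAt_g hy).differentiableAt (by simp)
    have dJ := (H.contDiffAt_J hy).differentiableAt (by simp)
    have dψ := (H.contDiffAt_psiL hy).differentiableAt (by simp)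
    have dgram : DifferentiableAt ℝ (fun y => hermGram (g y) (J y) u v w) y := by
      unfold hermGram
      fun_prop
    have dnum : DifferentiableAt ℝ
        (fun y => psiL g J y u v w ^ 2 + psiL g J y (J y u) v w ^ 2) y := by
      fun_prop
    refine (dnum.mul (dgram.inv (by rw [huvw]; exact one_ne_zero))).congr_of_eventuallyEq ?_
    have hne : ∀ᶠ z in 𝓝 y, hermGram (g z) (J z) u v w ≠ 0 :=
      dgram.continuousAt.eventually_ne (by rw [huvw]; exact one_ne_zero)
    filter_upwards [hne, H.isOpen.mem_nhds hy] with z hz hzU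
    simp only [Pi.mul_apply, Pi.inv_apply]
    rw [(ha z hzU).1 u v w, mul_inv_cancel_right₀ hz]
  obtain ⟨r, hr, hball⟩ := Metric.isOpen_iff.1 H.isOpen y₀ hy₀
  have hconst : ∀ y ∈ Metric.ball y₀ r, a y = a y₀ := fun y hy =>
    (convex_ball y₀ r).is_const_of_fderivWithin_eq_zero (𝕜 := ℝ)
      (fun z hz => (hdiff z (hball hz)).differentiableWithinAt)
      (fun z hz => by
        rw [fderivWithin_of_isOpen Metric.isOpen_ball hz,
          H.fderiv_norm_eq_zero hd hstr (hball hz) (hdiff z (hball hz))])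
      hy (Metric.mem_ball_self hr)
  refine ⟨√(a y₀), Real.sqrt_pos.2 (hpos y₀ hy₀), ?_⟩
  filter_upwards [Metric.ball_mem_nhds y₀ hr] with y hy
  rw [Real.sq_sqrt (hpos y₀ hy₀).le, ← hconst y hy]
  exact ⟨(ha y (hball hy)).1, hstr y (hball hy)⟩

end LocalNK

end LocalNearlyKahler

/-! ### Charts and their transition maps -/

section Charts

variable {n : ℕ} {X : Type*} [TopologicalSpace X] [ChartedSpace (Eucl n) X]

/-- The differential of the chart around `c`. Tangent spaces are identified with the model space,
as in their definition. -/
def dchart (c x : X) : Eucl n →L[ℝ] Eucl n :=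
  (mfderiv 𝓘(ℝ, Eucl n) 𝓘(ℝ, Eucl n) (chart (n := n) c) x :
    TangentSpace 𝓘(ℝ, Eucl n) x →L[ℝ] TangentSpace 𝓘(ℝ, Eucl n) (chart (n := n) c x))

/-- The differential of the inverse of the chart around `c`. -/
def dsymm (c : X) (y : Eucl n) : Eucl n →L[ℝ] Eucl n :=
  (mfderiv 𝓘(ℝ, Eucl n) 𝓘(ℝ, Eucl n) (chart c).symm y :
    TangentSpace 𝓘(ℝ, Eucl n) y →L[ℝ] TangentSpace 𝓘(ℝ, Eucl n) ((chart c).symm y))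

/-- The transition map from the chart around `c` to the chart around `c'`. -/
def trans (c c' : X) (y : Eucl n) : Eucl n := chart c' ((chart c).symm y)

lemma isOpen_target (c : X) : IsOpen (chart (n := n) c).target :=
  isOpen_extChartAt_target c

lemma isOpen_source (c : X) : IsOpen (chart (n := n) c).source :=
  isOpen_extChartAt_source c

lemma continuousOn_symm (c : X) : ContinuousOn (chart (n := n) c).symm (chart c).target :=
  continuousOn_extChartAt_symm c

lemma continuousAt_symm {c : X} {y : Eucl n} (hy : y ∈ (chart c).target) :
    ContinuousAt (chart (n := n) c).symm y :=
  (continuousOn_symm c).continuousAt ((isOpen_target c).mem_nhds hy)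

variable [IsManifold 𝓘(ℝ, Eucl n) ∞ X]

lemma contMDiffAt_chart {c x : X} (hx : x ∈ (chart (n := n) c).source) :
    ContMDiffAt 𝓘(ℝ, Eucl n) 𝓘(ℝ, Eucl n) ∞ (chart (n := n) c) x :=
  contMDiffAt_extChartAt' (by simpa using hx)

lemma contMDiffAt_symm {c : X} {y : Eucl n} (hy : y ∈ (chart c).target) :
    ContMDiffAt 𝓘(ℝ, Eucl n) 𝓘(ℝ, Eucl n) ∞ (chart (n := n) c).symm y :=
  (contMDiffOn_extChartAt_symm c).contMDiffAt ((isOpen_target c).mem_nhds hy)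

lemma dchart_dsymm {c : X} {y : Eucl n} (hy : y ∈ (chart c).target) (v : Eucl n) :
    dchart c ((chart c).symm y) (dsymm c y v) = v := by
  have : IsManifold 𝓘(ℝ, Eucl n) 1 X := .of_le (n := ∞) (by norm_cast)
  have h := mfderiv_extChartAt_comp_mfderivWithin_extChartAt_symm (I := 𝓘(ℝ, Eucl n)) hy
  rw [ModelWithCorners.range_eq_univ, mfderivWithin_univ] at h
  with_unfolding_all exact DFunLike.congr_fun h v

lemma dsymm_dchart {c x : X} (hx : x ∈ (chart (n := n) c).source) (v : Eucl n) :
    dsymm c (chart c x) (dchart c x v) = v := by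
  have : IsManifold 𝓘(ℝ, Eucl n) 1 X := .of_le (n := ∞) (by norm_cast)
  have h := mfderivWithin_extChartAt_symm_comp_mfderiv_extChartAt' (I := 𝓘(ℝ, Eucl n)) hx
  rw [ModelWithCorners.range_eq_univ, mfderivWithin_univ] at h
  with_unfolding_all exact DFunLike.congr_fun h v

lemma dsymm_dchart_symm {c : X} {y : Eucl n} (hy : y ∈ (chart c).target) (v : Eucl n) :
    dsymm c y (dchart c ((chart c).symm y) v) = v := by
  have h := dsymm_dchart ((chart c).map_target hy) v
  rwa [(chart c).right_inv hy] at h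

lemma contDiffAt_trans {c c' : X} {y : Eucl n} (hy : y ∈ (chart c).target)
    (hy' : (chart c).symm y ∈ (chart (n := n) c').source) : ContDiffAt ℝ ∞ (trans c c') y :=
  ((contMDiffAt_chart hy').comp y (contMDiffAt_symm hy)).contDiffAt

lemma fderiv_trans {c c' : X} {y : Eucl n} (hy : y ∈ (chart c).target)
    (hy' : (chart c).symm y ∈ (chart (n := n) c').source) (v : Eucl n) :
    fderiv ℝ (trans c c') y v = dchart c' ((chart c).symm y) (dsymm c y v) := by
  have h := mfderiv_comp y ((contMDiffAt_chart hy').mdifferentiableAt (by simp))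
    ((contMDiffAt_symm hy).mdifferentiableAt (by simp))
  rw [mfderiv_eq_fderiv] at h
  with_unfolding_all exact DFunLike.congr_fun h v

omit [IsManifold 𝓘(ℝ, Eucl n) ∞ X] in
lemma trans_mem {c c' : X} {y : Eucl n}
    (hy' : (chart c).symm y ∈ (chart (n := n) c').source) : trans c c' y ∈ (chart c').target :=
  (chart c').map_source hy'

omit [IsManifold 𝓘(ℝ, Eucl n) ∞ X] in
lemma symm_trans {c c' : X} {y : Eucl n}
    (hy' : (chart c).symm y ∈ (chart (n := n) c').source) :
    (chart c').symm (trans c c' y) = (chart c).symm y :=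
  (chart c').left_inv hy'

lemma dsymm_trans {c c' : X} {y : Eucl n} (hy : y ∈ (chart c).target)
    (hy' : (chart c).symm y ∈ (chart (n := n) c').source) (v : Eucl n) :
    dsymm c' (trans c c' y) (fderiv ℝ (trans c c') y v) = dsymm c y v := by
  rw [fderiv_trans hy hy']
  exact dsymm_dchart hy' _

lemma fderiv_trans_dchart {c c' x : X} (hx : x ∈ (chart (n := n) c).source)
    (hx' : x ∈ (chart (n := n) c').source) (v : Eucl n) :
    fderiv ℝ (trans c c') (chart c x) (dchart c x v) = dchart c' x v := by
  have h := fderiv_trans (c := c) (c' := c') ((chart c).map_source hx)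
    (by rwa [(chart c).left_inv hx]) (dchart c x v)
  rw [h, dsymm_dchart hx, (chart c).left_inv hx]

omit [IsManifold 𝓘(ℝ, Eucl n) ∞ X] in
/-- The points of the chart domain of `c` which also lie in that of `c'` form an open set. -/
lemma eventually_overlap {c c' : X} {y : Eucl n} (hy : y ∈ (chart c).target)
    (hy' : (chart c).symm y ∈ (chart (n := n) c').source) :
    ∀ᶠ z in 𝓝 y, z ∈ (chart c).target ∧ (chart c).symm z ∈ (chart (n := n) c').source :=
  ((isOpen_target c).mem_nhds hy |> fun h => (eventually_mem_set.2 h)).and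
    ((continuousAt_symm hy).eventually ((isOpen_source c').mem_nhds hy'))

lemma contMDiffOn_dsymm (c : X) (v : Eucl n) :
    ContMDiffOn 𝓘(ℝ, Eucl n) 𝓘(ℝ, Eucl n).tangent ∞
      (fun y => (⟨(chart c).symm y, dsymm c y v⟩ : TangentBundle 𝓘(ℝ, Eucl n) X))
      (chart (n := n) c).target := by
  have h := (contMDiffOn_extChartAt_symm (I := 𝓘(ℝ, Eucl n))
    (n := ∞) c).contMDiffOn_tangentMapWithin (m := ∞) (by simp) (isOpen_target c).uniqueMDiffOn
  have h2 : ContMDiffOn 𝓘(ℝ, Eucl n) 𝓘(ℝ, Eucl n).tangent ∞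
      (fun y => (⟨y, v⟩ : TangentBundle 𝓘(ℝ, Eucl n) (Eucl n))) (chart (n := n) c).target := by
    intro y _
    rw [contMDiffWithinAt_totalSpace]
    exact ⟨contMDiffWithinAt_id, by simpa using! contMDiffWithinAt_const⟩
  refine (h.comp h2 fun y hy => hy).congr fun y hy => ?_
  simp only [Function.comp_apply, tangentMapWithin]
  rw [mfderivWithin_of_isOpen (isOpen_target c) hy]
  rfl

end Charts

/-! ### The nearly Kähler structure in a chart -/

section Coordinates

variable {n : ℕ}

/-- The standard basis of `ℝⁿ`. -/
def stdB (n : ℕ) : Module.Basis (Fin n) ℝ (Eucl n) := (EuclideanSpace.basisFun (Fin n) ℝ).toBasis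

lemma stdB_apply (i : Fin n) : stdB n i = EuclideanSpace.single i (1 : ℝ) := by simp [stdB]

lemma eucl_sum (v : Eucl n) : v = ∑ i, v i • EuclideanSpace.single i (1 : ℝ) := by
  have h := (EuclideanSpace.basisFun (Fin n) ℝ).sum_repr v
  simpa using h.symm

lemma clm_eucl_ext {F : Type*} [NormedAddCommGroup F] [NormedSpace ℝ F] {S T : Eucl n →L[ℝ] F}
    (h : ∀ i, S (EuclideanSpace.single i 1) = T (EuclideanSpace.single i 1)) : S = T := by
  ext v
  rw [eucl_sum v]
  simp [map_sum, h]

/-- The bilinear map with coefficients `c k i j`. -/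
def bilinOf (c : Fin n → Fin n → Fin n → ℝ) : Eucl n →L[ℝ] Eucl n →L[ℝ] Eucl n :=
  LinearMap.toContinuousLinearMap ((stdB n).constr ℝ fun i =>
    LinearMap.toContinuousLinearMap ((stdB n).constr ℝ fun j =>
      ∑ k, c k i j • EuclideanSpace.single k (1 : ℝ)))

lemma bilinOf_single (c : Fin n → Fin n → Fin n → ℝ) (i j : Fin n) :
    bilinOf c (EuclideanSpace.single i 1) (EuclideanSpace.single j 1) =
      ∑ k, c k i j • EuclideanSpace.single k (1 : ℝ) := by
  rw [← stdB_apply i, ← stdB_apply j]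
  simp [bilinOf]

lemma sum_single_apply (c : Fin n → ℝ) (k : Fin n) :
    (∑ l, c l • EuclideanSpace.single l (1 : ℝ)) k = c k := by
  simp [Finset.sum_apply, Pi.single_apply]

lemma eucl_sum_apply {ι : Type*} (s : Finset ι) (f : ι → Eucl n) (k : Fin n) :
    (∑ i ∈ s, f i) k = ∑ i ∈ s, f i k := by
  simp

/-- The Christoffel symbols define a symmetric metric connection. -/
lemma christoffel_connection {G : Eucl n → Eucl n →L[ℝ] Eucl n →L[ℝ] ℝ} {y : Eucl n}
    (hG : DifferentiableAt ℝ G y) (sym : ∀ z u v, G z u v = G z v u)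
    (pos : ∀ u, u ≠ 0 → 0 < G y u u) {h : Eucl n → Matrix (Fin n) (Fin n) ℝ}
    (hh : ∀ z i j, h z i j = G z (EuclideanSpace.single i 1) (EuclideanSpace.single j 1)) :
    let Γ := bilinOf fun k i j => christoffel h k i j y
    (∀ X Y, Γ X Y = Γ Y X) ∧
    ∀ X Y Z, fderiv ℝ G y X Y Z = G y (Γ X Y) Z + G y Y (Γ X Z) := by
  intro Γ
  have hsym : ∀ z i j, h z i j = h z j i := fun z i j => by rw [hh, hh, sym]
  have csym : ∀ k i j, christoffel h k i j y = christoffel h k j i y := by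
    intro k i j
    have e : (fun z => h z i j) = fun z => h z j i := by ext z; exact hsym z i j
    simp only [christoffel, e]
    congr 1
    exact Finset.sum_congr rfl fun l _ => by ring
  refine ⟨fun X Y => ?_, fun X Y Z => ?_⟩
  · have : Γ = Γ.flip := clm_eucl_ext fun i => clm_eucl_ext fun j => by
      rw [ContinuousLinearMap.flip_apply, bilinOf_single, bilinOf_single]
      simp only [csym _ i j]
    exact DFunLike.congr_fun (DFunLike.congr_fun this X) Y
  · -- the Gram matrix is invertible
    have hdet : IsUnit (h y).det := by
      rw [isUnit_iff_ne_zero]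
      intro h0
      obtain ⟨v, hv, hv0⟩ := Matrix.exists_mulVec_eq_zero_iff.2 h0
      let w : Eucl n := ∑ i, v i • EuclideanSpace.single i (1 : ℝ)
      have hw : w ≠ 0 := by
        intro hw
        apply hv
        ext i
        have := congrArg (fun u : Eucl n => u i) hw
        simpa [w, sum_single_apply] using this
      have : G y w w = v ⬝ᵥ (h y).mulVec v := by
        simp only [w, map_sum, map_smul, _root_.sum_apply, _root_.smul_apply, smul_eq_mul,
          dotProduct, Matrix.mulVec, hh, Finset.mul_sum]
        rw [Finset.sum_comm]
        refine Finset.sum_congr rfl fun i _ => Finset.sum_congr rfl fun j _ => by ring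
      rw [hv0, dotProduct_zero] at this
      exact (pos w hw).ne' this
    have pd : ∀ i j l, fderiv ℝ G y (EuclideanSpace.single i 1) (EuclideanSpace.single j 1)
        (EuclideanSpace.single l 1) = pderiv i (fun z => h z j l) y := by
      intro i j l
      simp only [pderiv, hh]
      rw [((hG.hasFDerivAt.apply_const _).apply_const _).fderiv]
      rfl
    have low : ∀ i j m, G y (Γ (EuclideanSpace.single i 1) (EuclideanSpace.single j 1))
        (EuclideanSpace.single m 1) = 1 / 2 * (pderiv i (fun z => h z j m) y
          + pderiv j (fun z => h z i m) y - pderiv m (fun z => h z i j) y) := by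
      intro i j m
      rw [bilinOf_single]
      simp only [map_sum, map_smul, _root_.sum_apply, _root_.smul_apply, smul_eq_mul, ← hh]
      have e : ∀ k, christoffel h k i j y * h y k m = 1 / 2 * ∑ l, (h y m k * (h y)⁻¹ k l) *
        (pderiv i (fun z => h z j l) y + pderiv j (fun z => h z i l) y
          - pderiv l (fun z => h z i j) y) := by
        intro k
        rw [christoffel, mul_assoc, Finset.sum_mul, hsym y k m]
        congr 1
        exact Finset.sum_congr rfl fun l _ => by ring
      simp only [e]
      rw [← Finset.mul_sum, Finset.sum_comm]
      simp only [← Finset.sum_mul, ← Matrix.mul_apply, Matrix.mul_nonsing_inv _ hdet,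
        Matrix.one_apply, ite_mul, one_mul, zero_mul, Finset.sum_ite_eq, Finset.mem_univ, if_true]
    let T : Eucl n →L[ℝ] Eucl n →L[ℝ] Eucl n →L[ℝ] ℝ :=
      (ContinuousLinearMap.compL ℝ (Eucl n) (Eucl n) (Eucl n →L[ℝ] ℝ) (G y)) ∘L Γ
    have key : fderiv ℝ G y = T +
        (ContinuousLinearMap.flipₗᵢ ℝ (Eucl n) (Eucl n) ℝ :
          (Eucl n →L[ℝ] Eucl n →L[ℝ] ℝ) →L[ℝ] (Eucl n →L[ℝ] Eucl n →L[ℝ] ℝ)) ∘L T := by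
      refine clm_eucl_ext fun i => clm_eucl_ext fun j => clm_eucl_ext fun l => ?_
      change _ = G y (Γ _ _) _ + G y (Γ _ _) _
      rw [pd, low, low]
      have e1 : (fun z => h z l j) = fun z => h z j l := by ext z; exact hsym z l j
      simp only [e1]
      ring
    rw [key, sym y Y]
    rfl

end Coordinates

section Ambient

variable {M : Type*} [TopologicalSpace M] [ChartedSpace (Eucl 6) M]
  [IsManifold 𝓘(ℝ, Eucl 6) ∞ M] (S : AlmostHermitian M)

namespace AlmostHermitian

/-- The metric at `x`, as a bilinear form on the model space. -/
def gAt (x : M) : Eucl 6 →L[ℝ] Eucl 6 →L[ℝ] ℝ := S.metric.inner x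

/-- The almost complex structure at `x`, as an endomorphism of the model space. -/
def JAt (x : M) : Eucl 6 →L[ℝ] Eucl 6 := S.J x

/-- The metric in the chart around `c`. -/
def gC (c : M) (y : Eucl 6) : Eucl 6 →L[ℝ] Eucl 6 →L[ℝ] ℝ :=
  (S.gAt ((chart c).symm y)).bilinearComp (dsymm c y) (dsymm c y)

/-- The almost complex structure in the chart around `c`. -/
def JC (c : M) (y : Eucl 6) : Eucl 6 →L[ℝ] Eucl 6 :=
  (dchart c ((chart c).symm y)).comp ((S.JAt ((chart c).symm y)).comp (dsymm c y))

lemma gC_apply (c : M) (y u v : Eucl 6) :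
    S.gC c y u v = S.gAt ((chart c).symm y) (dsymm c y u) (dsymm c y v) := rfl

lemma JC_apply (c : M) (y u : Eucl 6) :
    S.JC c y u = dchart c ((chart c).symm y) (S.JAt ((chart c).symm y) (dsymm c y u)) := rfl

lemma isHermitianPair_at (x : M) : IsHermitianPair (S.gAt x) (S.JAt x) :=
  ⟨fun u v => S.metric.symm x u v, fun u hu => S.metric.pos x u hu, fun u => S.J_J x u,
    fun u v => S.metric_J_J x u v⟩

lemma dsymm_JC {c : M} {y : Eucl 6} (hy : y ∈ (chart c).target) (u : Eucl 6) :
    dsymm c y (S.JC c y u) = S.JAt ((chart c).symm y) (dsymm c y u) := by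
  rw [JC_apply, dsymm_dchart_symm hy]

lemma isHermitianPair_chart {c : M} {y : Eucl 6} (hy : y ∈ (chart c).target) :
    IsHermitianPair (S.gC c y) (S.JC c y) := by
  have h := S.isHermitianPair_at ((chart c).symm y)
  refine ⟨fun u v => h.symm _ _, fun u hu => h.pos _ fun h0 => hu ?_, fun u => ?_, fun u v => ?_⟩
  · have h0' : dsymm c y u = 0 := h0
    rw [← dchart_dsymm hy u, h0', map_zero]
  · rw [JC_apply, dsymm_JC S hy, h.J_J, map_neg, dchart_dsymm hy]
  · rw [gC_apply, dsymm_JC S hy, dsymm_JC S hy, h.isom]; rfl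

lemma contDiffOn_gC (c : M) : ContDiffOn ℝ ∞ (S.gC c) (chart c).target := by
  rw [contDiffOn_clm_apply]
  intro u
  rw [contDiffOn_clm_apply]
  intro v
  rw [← contMDiffOn_iff_contDiffOn]
  have h : ContMDiffOn 𝓘(ℝ, Eucl 6) (𝓘(ℝ, Eucl 6).prod 𝓘(ℝ, ℝ)) ∞
      (fun y => TotalSpace.mk' ℝ (E := Bundle.Trivial M ℝ) ((chart c).symm y)
        (S.metric.inner ((chart c).symm y) (dsymm c y u) (dsymm c y v))) (chart c).target := by
    apply ContMDiffOn.clm_bundle_apply₂ (F₁ := Eucl 6) (F₂ := Eucl 6)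
    · exact S.metric.contMDiff.comp_contMDiffOn (contMDiffOn_extChartAt_symm c)
    · exact contMDiffOn_dsymm c u
    · exact contMDiffOn_dsymm c v
  intro y hy
  have := h y hy
  simp only [contMDiffWithinAt_totalSpace] at this
  exact this.2

lemma endoMatrix_eq (c : M) (y : Eucl 6) (k j : Fin 6) :
    endoMatrix S.J c y k j = S.JC c y (EuclideanSpace.single j 1) k := by
  with_unfolding_all rfl

lemma contDiffOn_JC (c : M) : ContDiffOn ℝ ∞ (S.JC c) (chart c).target := by
  rw [contDiffOn_clm_apply]
  intro u
  rw [contDiffOn_euclidean]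
  intro k
  have : ∀ y, S.JC c y u k = ∑ j, u j * endoMatrix S.J c y k j := by
    intro y
    conv_lhs => rw [eucl_sum u]
    simp [map_sum, endoMatrix_eq]
  simp only [this]
  exact ContDiffOn.sum fun j _ => contDiffOn_const.mul (S.smooth_J c k j)

/-- In every chart, a strict nearly Kähler structure is one in the sense of `LocalNK`. -/
lemma IsStrictNearlyKahler.localNK {S : AlmostHermitian M} (hS : S.IsStrictNearlyKahler) (c : M) :
    LocalNK (S.gC c) (S.JC c) (chart c).target := by
  refine ⟨isOpen_target c, S.contDiffOn_gC c, S.contDiffOn_JC c,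
    fun y hy => S.isHermitianPair_chart hy, fun y hy => ?_⟩
  have dg := ((S.contDiffOn_gC c).contDiffAt ((isOpen_target c).mem_nhds hy)).differentiableAt
    (by simp)
  have dJ := ((S.contDiffOn_JC c).contDiffAt ((isOpen_target c).mem_nhds hy)).differentiableAt
    (by simp)
  have hs : ∀ z u v, S.gC c z u v = S.gC c z v u := fun z u v =>
    (S.isHermitianPair_at _).symm _ _
  obtain ⟨sym, met⟩ := christoffel_connection dg hs (S.isHermitianPair_chart hy).pos
    (h := S.metricMatrix c) (fun z i j => rfl)
  set Γ := bilinOf fun k i j => christoffel (S.metricMatrix c) k i j y with hΓ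
  let A : Eucl 6 →L[ℝ] Eucl 6 →L[ℝ] Eucl 6 := fderiv ℝ (S.JC c) y
    + (ContinuousLinearMap.compL ℝ (Eucl 6) (Eucl 6) (Eucl 6)).flip (S.JC c y) ∘L Γ
    - (ContinuousLinearMap.compL ℝ (Eucl 6) (Eucl 6) (Eucl 6) (S.JC c y)) ∘L Γ
  have hA : ∀ X Y, fderiv ℝ (S.JC c) y X Y + Γ X (S.JC c y Y) - S.JC c y (Γ X Y) = A X Y :=
    fun X Y => by simp [A]
  have hAe : ∀ i j k, A (EuclideanSpace.single i 1) (EuclideanSpace.single j 1) k =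
      S.nablaJ c i k j y := by
    intro i j k
    rw [← hA, nablaJ, covDerivEndo, PiLp.sub_apply, PiLp.add_apply]
    congr 1
    · congr 1
      · simp only [pderiv, endoMatrix_eq]
        have h1 := ((EuclideanSpace.proj (𝕜 := ℝ) k).hasFDerivAt.comp y
          (dJ.hasFDerivAt.apply_const (EuclideanSpace.single j 1)))
        have h2 := h1.fderiv
        have h3 : (⇑(EuclideanSpace.proj (𝕜 := ℝ) k) ∘
            fun y => S.JC c y (EuclideanSpace.single j 1)) =
            fun z => S.JC c z (EuclideanSpace.single j 1) k := rfl
        rw [h3] at h2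
        rw [h2]
        rfl
      · conv_lhs => rw [eucl_sum (S.JC c y (EuclideanSpace.single j 1))]
        simp only [map_sum, map_smul, hΓ, bilinOf_single, endoMatrix_eq]
        rw [eucl_sum_apply]
        refine Finset.sum_congr rfl fun l _ => ?_
        rw [PiLp.smul_apply, sum_single_apply, smul_eq_mul, mul_comm]
    · rw [hΓ, bilinOf_single]
      simp only [map_sum, map_smul, endoMatrix_eq]
      rw [eucl_sum_apply]
      rfl
  have hAk : ∀ X Y k, A X Y k = ∑ i, ∑ j, X i * Y j * S.nablaJ c i k j y := by
    intro X Y k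
    conv_lhs => rw [eucl_sum X, eucl_sum Y]
    simp only [map_sum, map_smul, _root_.sum_apply, _root_.smul_apply, eucl_sum_apply,
      PiLp.smul_apply, hAe, smul_eq_mul, Finset.mul_sum]
    rw [Finset.sum_comm]
    refine Finset.sum_congr rfl fun i _ => Finset.sum_congr rfl fun j _ => by ring
  refine ⟨Γ, sym, met, fun X => ?_, fun X hX => ?_⟩
  · rw [hA]
    ext k
    rw [hAk]
    exact hS.nearly c y hy (fun i => X i) k
  · obtain ⟨k, j, hkj⟩ := hS.strict c y hy (fun i => X i) fun h0 => hX (by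
      ext i; exact congrFun h0 i)
    refine ⟨EuclideanSpace.single j 1, fun h0 => hkj ?_⟩
    rw [hA] at h0
    have := congrArg (fun u : Eucl 6 => u k) h0
    simp only [hAk] at this
    rw [PiLp.zero_apply] at this
    rw [← this]
    refine Finset.sum_congr rfl fun i _ => ?_
    simp

end AlmostHermitian

end Ambient

section Trilinear

variable {E F : Type*} [NormedAddCommGroup E] [NormedSpace ℝ E] [NormedAddCommGroup F]
  [NormedSpace ℝ F]

/-- The trilinear form `(u, v, w) ↦ T (A u) (A v) (A w)`. -/
def trilinearComp (T : F →L[ℝ] F →L[ℝ] F →L[ℝ] ℝ) (A : E →L[ℝ] F) :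
    E →L[ℝ] E →L[ℝ] E →L[ℝ] ℝ :=
  ((ContinuousLinearMap.compL ℝ E (F →L[ℝ] ℝ) (E →L[ℝ] ℝ)
    ((ContinuousLinearMap.compL ℝ E F ℝ).flip A)).comp
      ((ContinuousLinearMap.compL ℝ E F (F →L[ℝ] ℝ)).flip A)).comp (T.comp A)

lemma trilinearComp_apply (T : F →L[ℝ] F →L[ℝ] F →L[ℝ] ℝ) (A : E →L[ℝ] F) (u v w : E) :
    trilinearComp T A u v w = T (A u) (A v) (A w) := rfl

end Trilinear

section Ambient

variable {M : Type*} [TopologicalSpace M] [ChartedSpace (Eucl 6) M]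
  [IsManifold 𝓘(ℝ, Eucl 6) ∞ M] (S : AlmostHermitian M)

namespace AlmostHermitian

/-- The fundamental form in the chart around `c`. -/
abbrev omC (c : M) (y : Eucl 6) : Eucl 6 →L[ℝ] Eucl 6 →L[ℝ] ℝ := omegaL (S.gC c) (S.JC c) y

/-- The form `ψ = dω / 3` in the chart around `c`. -/
abbrev psiC (c : M) (y : Eucl 6) : Eucl 6 →L[ℝ] Eucl 6 →L[ℝ] Eucl 6 →L[ℝ] ℝ :=
  psiL (S.gC c) (S.JC c) y

/-- The form `ψ(J·, ·, ·)` in the chart around `c`. -/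
abbrev sigC (c : M) (y : Eucl 6) : Eucl 6 →L[ℝ] Eucl 6 →L[ℝ] Eucl 6 →L[ℝ] ℝ :=
  sigmaL (S.gC c) (S.JC c) y

/-- The 3-form `ψ = dω / 3` on the tangent space at `x`, computed in the chart around `x`. -/
def psiAt (x : M) (u v w : Eucl 6) : ℝ :=
  S.psiC x (chart x x) (dchart x x u) (dchart x x v) (dchart x x w)

/-- The fundamental form `ω` on the tangent space at `x`. -/
def omAt (x : M) (u v : Eucl 6) : ℝ := S.gAt x (S.JAt x u) v

lemma omC_apply {c : M} {y : Eucl 6} (hy : y ∈ (chart c).target) (u v : Eucl 6) :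
    S.omC c y u v = S.omAt ((chart c).symm y) (dsymm c y u) (dsymm c y v) := by
  rw [omC, omegaL_apply, gC_apply, S.dsymm_JC hy]
  rfl

lemma omC_trans {c c' : M} {y : Eucl 6} (hy : y ∈ (chart c).target)
    (hy' : (chart c).symm y ∈ (chart (n := 6) c').source) (u v : Eucl 6) :
    S.omC c' (trans c c' y) (fderiv ℝ (trans c c') y u) (fderiv ℝ (trans c c') y v) =
      S.omC c y u v := by
  rw [S.omC_apply hy, S.omC_apply (trans_mem hy'), dsymm_trans hy hy', dsymm_trans hy hy',
    symm_trans hy']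

variable {S} (hS : S.IsStrictNearlyKahler)
include hS

/-- `ψ` does not depend on the chart, because the exterior derivative is natural. -/
lemma psiC_trans {c c' : M} {y : Eucl 6} (hy : y ∈ (chart c).target)
    (hy' : (chart c).symm y ∈ (chart (n := 6) c').source) (u v w : Eucl 6) :
    S.psiC c' (trans c c' y) (fderiv ℝ (trans c c') y u) (fderiv ℝ (trans c c') y v)
      (fderiv ℝ (trans c c') y w) = S.psiC c y u v w := by
  have H' := hS.localNK c'
  have H := hS.localNK c
  have hd' := (H'.contDiffAt_omegaL (trans_mem hy')).differentiableAt (by simp)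
  have hd := (H.contDiffAt_omegaL hy).differentiableAt (by simp)
  have h := dTwo_pullback (F := trans c c') hd'
    ((contDiffAt_trans hy hy').of_le ENat.LEInfty.out) (H'.omegaL_skew (trans_mem hy')) u v w
  have e : ∀ a b, (fun z => S.omC c' (trans c c' z) (fderiv ℝ (trans c c') z a)
      (fderiv ℝ (trans c c') z b)) =ᶠ[𝓝 y] fun z => S.omC c z a b := by
    intro a b
    filter_upwards [eventually_overlap hy hy'] with z hz
    exact S.omC_trans hz.1 hz.2 a b
  rw [psiC, psiC, psiL_apply, psiL_apply, ← h, (e v w).fderiv_eq, (e w u).fderiv_eq,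
    (e u v).fderiv_eq, LocalNK.fderiv_apply₂ hd, LocalNK.fderiv_apply₂ hd,
    LocalNK.fderiv_apply₂ hd]
  rfl

lemma psiAt_eq {c x : M} (hx : x ∈ (chart (n := 6) c).source) (u v w : Eucl 6) :
    S.psiAt x u v w = S.psiC c (chart c x) (dchart c x u) (dchart c x v) (dchart c x w) := by
  have hxx := mem_extChartAt_source (I := 𝓘(ℝ, Eucl 6)) x
  rw [psiAt, ← psiC_trans hS (c := x) (c' := c) ((chart x).map_source hxx)
    (by rwa [(chart x).left_inv hxx]), fderiv_trans_dchart hxx hx, fderiv_trans_dchart hxx hx,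
    fderiv_trans_dchart hxx hx, trans, (chart x).left_inv hxx]

lemma psiC_eq {c : M} {y : Eucl 6} (hy : y ∈ (chart c).target) (u v w : Eucl 6) :
    S.psiC c y u v w =
      S.psiAt ((chart c).symm y) (dsymm c y u) (dsymm c y v) (dsymm c y w) := by
  rw [psiAt_eq hS ((chart c).map_target hy), (chart c).right_inv hy, dchart_dsymm hy,
    dchart_dsymm hy, dchart_dsymm hy]

lemma sigC_eq {c : M} {y : Eucl 6} (hy : y ∈ (chart c).target) (u v w : Eucl 6) :
    S.sigC c y u v w = S.psiAt ((chart c).symm y) (S.JAt ((chart c).symm y) (dsymm c y u))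
      (dsymm c y v) (dsymm c y w) := by
  rw [sigC, sigmaL_apply, ← psiC, psiC_eq hS hy, S.dsymm_JC hy]

omit hS in
lemma hermGram_chart {c : M} {y : Eucl 6} (hy : y ∈ (chart c).target) (u v w : Eucl 6) :
    hermGram (S.gC c y) (S.JC c y) u v w =
      hermGram (S.gAt ((chart c).symm y)) (S.JAt ((chart c).symm y))
        (dsymm c y u) (dsymm c y v) (dsymm c y w) := by
  simp only [hermGram, gC_apply, S.dsymm_JC hy]

/-- The defining property of the norm of `ψ` at `x`. -/
def IsNormAt (S : AlmostHermitian M) (x : M) (k : ℝ) : Prop :=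
  0 < k ∧ ∀ u v w, S.psiAt x u v w ^ 2 + S.psiAt x (S.JAt x u) v w ^ 2 =
    k ^ 2 * hermGram (S.gAt x) (S.JAt x) u v w

open Classical in
/-- The norm of the complex volume form with real part `ψ` at `x`. -/
def nrm (S : AlmostHermitian M) (x : M) : ℝ := if h : ∃ k, IsNormAt S x k then h.choose else 0

omit hS in
lemma IsNormAt.unique {x : M} {k k' : ℝ} (h : IsNormAt S x k) (h' : IsNormAt S x k') : k = k' := by
  obtain ⟨u, v, w, e⟩ := (S.isHermitianPair_at x).exists_hermGram_eq_one (by simp)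
  have h1 := h.2 u v w
  rw [h'.2 u v w, e] at h1
  have := (sq_eq_sq₀ h.1.le h'.1.le).1 (by linarith)
  exact this

omit hS in
lemma IsNormAt.eq_nrm {x : M} {k : ℝ} (h : IsNormAt S x k) : nrm S x = k := by
  have hex : ∃ k, IsNormAt S x k := ⟨k, h⟩
  rw [nrm, dif_pos hex]
  exact hex.choose_spec.unique h

/-- The structure equations in a chart, near a point, with the norm `k` of `ψ` at that point. -/
lemma structure_eqs {c : M} {y₀ : Eucl 6} (hy₀ : y₀ ∈ (chart c).target) :
    0 < nrm S ((chart c).symm y₀) ∧ ∀ᶠ y in 𝓝 y₀, y ∈ (chart c).target ∧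
      nrm S ((chart c).symm y) = nrm S ((chart c).symm y₀) ∧
      (∀ u v w, S.psiC c y u v w ^ 2 + S.sigC c y u v w ^ 2 =
        nrm S ((chart c).symm y₀) ^ 2 * hermGram (S.gC c y) (S.JC c y) u v w) ∧
      ∀ u v w x, dThree (S.sigC c) y u v w x =
        4 * nrm S ((chart c).symm y₀) ^ 2 * pfaff (S.omC c y) u v w x := by
  obtain ⟨k, hk, hev⟩ := (hS.localNK c).exists_norm_eventually (by simp) hy₀
  have hn : ∀ y ∈ (chart c).target, (∀ u v w, S.psiC c y u v w ^ 2 + S.sigC c y u v w ^ 2 =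
      k ^ 2 * hermGram (S.gC c y) (S.JC c y) u v w) → nrm S ((chart c).symm y) = k := by
    intro y hy h
    refine IsNormAt.eq_nrm ⟨hk, fun u v w => ?_⟩
    have := h (dchart c ((chart c).symm y) u) (dchart c ((chart c).symm y) v)
      (dchart c ((chart c).symm y) w)
    rwa [psiC_eq hS hy, sigC_eq hS hy, hermGram_chart hy, dsymm_dchart_symm hy,
      dsymm_dchart_symm hy, dsymm_dchart_symm hy] at this
  rw [hn y₀ hy₀ hev.self_of_nhds.1]
  refine ⟨hk, ?_⟩
  filter_upwards [hev, (isOpen_target c).mem_nhds hy₀] with y h hy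
  exact ⟨hy, hn y hy h.1, h⟩

lemma nrm_pos (x : M) : 0 < nrm S x := by
  have hm := mem_extChartAt_source (I := 𝓘(ℝ, Eucl 6)) x
  have h := (structure_eqs hS ((chart x).map_source hm)).1
  rwa [(chart x).left_inv hm] at h

/-- The form `ψ` at `x`, as a continuous trilinear map. -/
def psiForm (S : AlmostHermitian M) (x : M) : Eucl 6 →L[ℝ] Eucl 6 →L[ℝ] Eucl 6 →L[ℝ] ℝ :=
  trilinearComp (S.psiC x (chart x x)) (dchart x x)

omit hS in
lemma psiForm_apply (x : M) (u v w : Eucl 6) : psiForm S x u v w = S.psiAt x u v w :=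
  trilinearComp_apply _ _ _ _ _

lemma isPureForm_at (x : M) : IsPureForm (S.JAt x) (psiForm S x) := by
  have hx := mem_extChartAt_source (I := 𝓘(ℝ, Eucl 6)) x
  have h := (hS.localNK x).isPureForm ((chart x).map_source hx)
  have hJ : ∀ u, dchart x x (S.JAt x u) = S.JC x (chart x x) (dchart x x u) := fun u => by
    rw [JC_apply, dsymm_dchart hx, (chart x).left_inv hx]
  refine ⟨fun u v w => ?_, fun u v w => ?_, fun u v w => ?_⟩
  · rw [psiForm_apply, psiForm_apply, psiAt, psiAt, psiC, h.alt₁]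
  · rw [psiForm_apply, psiForm_apply, psiAt, psiAt, psiC, h.alt₂]
  · rw [psiForm_apply, psiForm_apply, psiAt, psiAt, hJ, hJ, psiC, h.shift]

end AlmostHermitian

end Ambient

/-! ### Divergence theorem for vector densities -/

section Euclidean

variable {n : ℕ} {U C : Set (Eucl n)} {f : Eucl n → ℝ}

lemma integrableOn_of_continuousOn_of_zero (hU : IsOpen U) (hC : IsCompact C) (hCU : C ⊆ U)
    (hf : ContinuousOn f U) (h0 : ∀ y ∈ U, y ∉ C → f y = 0) : IntegrableOn f U := by
  have h1 : IntegrableOn f C := (hf.mono hCU).integrableOn_compact hC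
  exact (h1.of_forall_sdiff_eq_zero hU.measurableSet fun y hy => h0 y hy.1 hy.2)

lemma fderiv_eq_zero_of_zero (hU : IsOpen U) (hC : IsClosed C)
    (h0 : ∀ y ∈ U, y ∉ C → f y = 0) {y : Eucl n} (hy : y ∈ U) (hyC : y ∉ C) :
    fderiv ℝ f y = 0 := by
  have : f =ᶠ[𝓝 y] fun _ => 0 := by
    filter_upwards [hU.mem_nhds hy, hC.isOpen_compl.mem_nhds hyC] with z hz hz' using h0 z hz hz'
  rw [this.fderiv_eq]
  simp

/-- A continuous nonpositive function on an open set with integral zero vanishes identically. -/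
lemma eq_zero_of_setIntegral_eq_zero (hU : IsOpen U) (hf : ContinuousOn f U)
    (hI : IntegrableOn f U) (h0 : ∀ y ∈ U, f y ≤ 0) (h : ∫ y in U, f y = 0) {y : Eucl n}
    (hy : y ∈ U) : f y = 0 := by
  have hae : f =ᵐ[volume.restrict U] fun _ => 0 := by
    have h1 := (integral_eq_zero_iff_of_nonneg_ae (μ := volume.restrict U) (f := fun y => -f y)
      ((ae_restrict_iff' hU.measurableSet).2 (ae_of_all _ fun y hy => neg_nonneg.2 (h0 y hy)))
      hI.neg).1 (by rw [integral_neg, h, neg_zero])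
    filter_upwards [h1] with y hy
    simpa using hy
  exact Measure.eqOn_open_of_ae_eq hae hU hf continuousOn_const hy

/-- The integral of a partial derivative of a compactly supported function vanishes. -/
lemma setIntegral_fderiv_eq_zero (hU : IsOpen U) (hC : IsCompact C) (hCU : C ⊆ U)
    (hf : ContDiffOn ℝ 1 f U) (h0 : ∀ y ∈ U, y ∉ C → f y = 0) (v : Eucl n) :
    ∫ y in U, fderiv ℝ f y v = 0 := by
  set F : Eucl n → ℝ := U.indicator f with hF
  have hFU : ∀ y ∈ U, F =ᶠ[𝓝 y] f := fun y hy => by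
    filter_upwards [hU.mem_nhds hy] with z hz using indicator_of_mem hz f
  have hFC : ∀ y ∉ C, F =ᶠ[𝓝 y] fun _ => 0 := fun y hy => by
    filter_upwards [hC.isClosed.isOpen_compl.mem_nhds hy] with z hz
    by_cases hzU : z ∈ U
    · rw [hF, indicator_of_mem hzU, h0 z hzU hz]
    · exact indicator_of_notMem hzU f
  have hFd : ContDiff ℝ 1 F := by
    rw [contDiff_iff_contDiffAt]
    intro y
    by_cases hy : y ∈ C
    · exact (hf.contDiffAt (hU.mem_nhds (hCU hy))).congr_of_eventuallyEq (hFU y (hCU hy))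
    · exact contDiffAt_const.congr_of_eventuallyEq (hFC y hy)
  have hFs : HasCompactSupport F := by
    refine HasCompactSupport.intro hC fun y hy => (hFC y hy).self_of_nhds
  have hcont : Continuous fun y => fderiv ℝ F y v :=
    (hFd.continuous_fderiv (by simp)).clm_apply continuous_const
  have hI : Integrable fun y => fderiv ℝ F y v := by
    refine hcont.integrable_of_hasCompactSupport ?_
    exact (hFs.fderiv (𝕜 := ℝ)).mono' fun y hy => subset_tsupport _ (by
      intro h; apply hy; simp [h])
  have hz : ∫ y, fderiv ℝ F y v = 0 := by
    have h := integral_mul_fderiv_eq_neg_fderiv_mul_of_integrable (μ := volume)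
      (f := fun _ : Eucl n => (1 : ℝ)) (g := F) (v := v) (by simp) (by simpa using hI)
      (by simpa using hFd.continuous.integrable_of_hasCompactSupport hFs) (fun x _ => by simp)
      (fun x _ => hFd.differentiable (by simp) x)
    simpa using h
  have h1 : ∫ y in U, fderiv ℝ f y v = ∫ y in U, fderiv ℝ F y v := by
    refine setIntegral_congr_fun hU.measurableSet fun y hy => ?_
    simp only [(hFU y hy).fderiv_eq]
  rw [h1, setIntegral_eq_integral_of_forall_compl_eq_zero, hz]
  intro y hy
  rw [(hFC y fun h => hy (hCU h)).fderiv_eq]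
  simp

end Euclidean

section Overlap

variable {n : ℕ} {X : Type*} [TopologicalSpace X] [ChartedSpace (Eucl n) X]
  [IsManifold 𝓘(ℝ, Eucl n) ∞ X]

/-- Integrals of densities supported in two charts agree. -/
lemma setIntegral_overlap {c c' : X} {f f' : Eucl n → ℝ}
    (h : ∀ y ∈ (chart c).target, (chart c).symm y ∈ (chart (n := n) c').source →
      f y = |(fderiv ℝ (trans c c') y).det| * f' (trans c c' y))
    (h0 : ∀ y ∈ (chart c).target, (chart c).symm y ∉ (chart (n := n) c').source → f y = 0)
    (h0' : ∀ y ∈ (chart c').target, (chart c').symm y ∉ (chart (n := n) c).source → f' y = 0) :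
    ∫ y in (chart c).target, f y = ∫ y in (chart c').target, f' y := by
  let O : X → X → Set (Eucl n) := fun a b =>
    (chart a).target ∩ (chart a).symm ⁻¹' (chart (n := n) b).source
  have hO : ∀ a b, IsOpen (O a b) := fun a b =>
    (continuousOn_symm a).isOpen_inter_preimage (isOpen_target a) (isOpen_source b)
  have him : trans c c' '' O c c' = O c' c := by
    ext z
    constructor
    · rintro ⟨y, ⟨hy, hy'⟩, rfl⟩
      refine ⟨trans_mem hy', ?_⟩
      rw [mem_preimage, symm_trans hy']
      exact (chart c).map_target hy
    · rintro ⟨hz, hz'⟩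
      have h1 := symm_trans (c := c') (c' := c) hz'
      refine ⟨trans c' c z, ⟨trans_mem hz', ?_⟩, ?_⟩
      · rw [mem_preimage, h1]
        exact (chart c').map_target hz
      · rw [trans, h1, (chart c').right_inv hz]
  have hinj : InjOn (trans (n := n) c c') (O c c') := by
    rintro y ⟨hy, hy'⟩ z ⟨hz, hz'⟩ hyz
    have h1 : (chart c).symm y = (chart c).symm z := by
      rw [← symm_trans hy', ← symm_trans hz', hyz]
    exact (chart c).symm.injOn hy hz h1
  have hcv := integral_image_eq_integral_abs_det_fderiv_smul volume (hO c c').measurableSet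
    (fun y hy => ((contDiffAt_trans hy.1 hy.2).differentiableAt
      (by simp)).hasFDerivAt.hasFDerivWithinAt) hinj f'
  rw [him] at hcv
  have e1 : ∫ y in (chart c).target, f y = ∫ y in O c c', f y :=
    (setIntegral_eq_of_subset_of_forall_sdiff_eq_zero (μ := volume) (isOpen_target c).measurableSet
      (inter_subset_left (t := (chart c).symm ⁻¹' (chart (n := n) c').source))
      fun y hy => h0 y hy.1 fun h' => hy.2 ⟨hy.1, h'⟩)
  have e2 : ∫ y in (chart c').target, f' y = ∫ y in O c' c, f' y :=
    (setIntegral_eq_of_subset_of_forall_sdiff_eq_zero (μ := volume) (isOpen_target c').measurableSet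
      (inter_subset_left (t := (chart c').symm ⁻¹' (chart (n := n) c).source))
      fun y hy => h0' y hy.1 fun h' => hy.2 ⟨hy.1, h'⟩)
  rw [e1, e2, hcv]
  exact setIntegral_congr_fun (hO c c').measurableSet fun y hy => h y hy.1 hy.2

/-- A vector density of class `C¹` with support in `K`: its components in the charts transform
like those of a vector field times a volume density. -/
structure IsVectorDensity (W : X → Eucl n → Fin n → ℝ) (K : Set X) : Prop where
  contDiffOn : ∀ c i, ContDiffOn ℝ 1 (fun y => W c y i) (chart c).target
  eq_zero : ∀ c, ∀ y ∈ (chart c).target, (chart c).symm y ∉ K → ∀ i, W c y i = 0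
  transform : ∀ c c', ∀ y ∈ (chart c).target, (chart c).symm y ∈ (chart (n := n) c').source →
    ∀ k, ∑ i, W c y i * fderiv ℝ (trans c c') y (EuclideanSpace.single i 1) k =
      |(fderiv ℝ (trans c c') y).det| * W c' (trans c c' y) k

/-- The derivative of a function in the direction of a vector density is a density. -/
lemma IsVectorDensity.deriv_transform {W : X → Eucl n → Fin n → ℝ} {K : Set X}
    (hW : IsVectorDensity W K) {f : X → ℝ} (hf : ContMDiff 𝓘(ℝ, Eucl n) 𝓘(ℝ, ℝ) ∞ f) {c c' : X}
    {y : Eucl n} (hy : y ∈ (chart c).target) (hy' : (chart c).symm y ∈ (chart (n := n) c').source) :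
    ∑ i, pderiv i (fun z => f ((chart c).symm z)) y * W c y i =
      |(fderiv ℝ (trans c c') y).det| *
        ∑ i, pderiv i (fun z => f ((chart c').symm z)) (trans c c' y) * W c' (trans c c' y) i := by
  have hd : DifferentiableAt ℝ (fun z => f ((chart c').symm z)) (trans c c' y) :=
    ((hf.contMDiffAt.comp _ (contMDiffAt_symm (trans_mem hy'))).contDiffAt).differentiableAt
      (by simp)
  have hτ := (contDiffAt_trans hy hy').differentiableAt (by simp)
  have e : (fun z => f ((chart c).symm z)) =ᶠ[𝓝 y]
      (fun z => f ((chart c').symm z)) ∘ trans c c' := by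
    filter_upwards [eventually_overlap hy hy'] with z hz
    simp only [Function.comp_apply, symm_trans hz.2]
  have h1 : ∀ i, pderiv i (fun z => f ((chart c).symm z)) y =
      ∑ k, fderiv ℝ (trans c c') y (EuclideanSpace.single i 1) k *
        pderiv k (fun z => f ((chart c').symm z)) (trans c c' y) := by
    intro i
    rw [pderiv, e.fderiv_eq, fderiv_comp y hd hτ, ContinuousLinearMap.comp_apply]
    conv_lhs => rw [eucl_sum (fderiv ℝ (trans c c') y (EuclideanSpace.single i 1))]
    simp [pderiv]
  simp only [h1, Finset.sum_mul]
  rw [Finset.sum_comm, Finset.mul_sum]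
  refine Finset.sum_congr rfl fun k _ => ?_
  rw [mul_left_comm, ← hW.transform c c' y hy hy' k, Finset.mul_sum]
  exact Finset.sum_congr rfl fun i _ => by ring

end Overlap

section Partition

variable {L : Type*} [TopologicalSpace L] [ChartedSpace (Eucl 3) L]
  [IsManifold 𝓘(ℝ, Eucl 3) ∞ L] [T2Space L] [SigmaCompactSpace L]

lemma tsupport_chartPartition (c : L) :
    tsupport (chartPartition L c) ⊆ (chart (n := 3) c).source := by
  have h :=
    (SmoothPartitionOfUnity.exists_isSubordinate_chartAt_source 𝓘(ℝ, Eucl 3) L).choose_spec c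
  rw [extChartAt_source]
  exact h

/-- The function `c` of the partition of unity, in the chart around `c'`. -/
def rho (c c' : L) (y : Eucl 3) : ℝ := chartPartition L c ((chart c').symm y)

lemma contDiffOn_rho (c c' : L) : ContDiffOn ℝ ∞ (rho c c') (chart c').target := fun y hy =>
  ((((chartPartition L c).contMDiff.contMDiffAt).comp y
    (contMDiffAt_symm hy)).contDiffAt).contDiffWithinAt

lemma rho_nonneg (c c' : L) (y : Eucl 3) : 0 ≤ rho c c' y := (chartPartition L).nonneg _ _

/-- The part of a compact set over which the function `c` of the partition of unity is supported,
in the coordinates of the chart around `c`. -/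
def chartCompact (c : L) (K : Set L) : Set (Eucl 3) :=
  chart c '' (tsupport (chartPartition L c) ∩ K)

lemma isCompact_chartCompact (c : L) {K : Set L} (hK : IsCompact K) :
    IsCompact (chartCompact c K) :=
  (hK.inter_left (isClosed_tsupport _)).image_of_continuousOn
    ((continuousOn_extChartAt c).mono fun _ hx => tsupport_chartPartition c hx.1)

lemma chartCompact_subset (c : L) (K : Set L) : chartCompact c K ⊆ (chart c).target := by
  rintro _ ⟨x, hx, rfl⟩
  exact (chart c).map_source (tsupport_chartPartition c hx.1)

lemma mem_chartCompact {c : L} {K : Set L} {y : Eucl 3} (hy : y ∈ (chart c).target) :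
    y ∈ chartCompact c K ↔
      (chart c).symm y ∈ tsupport (chartPartition L c) ∧ (chart c).symm y ∈ K := by
  constructor
  · rintro ⟨x, hx, rfl⟩
    rwa [(chart c).left_inv (tsupport_chartPartition c hx.1)]
  · intro h
    exact ⟨_, h, (chart c).right_inv hy⟩

/-- The finite set of those `c` for which the function `c` of the partition of unity meets `K`. -/
lemma finite_meets {K : Set L} (hK : IsCompact K) :
    {c : L | (tsupport (chartPartition L c) ∩ K).Nonempty}.Finite :=
  (chartPartition L).locallyFinite.closure.finite_nonempty_inter_compact hK

lemma rho_eq_zero {c : L} {K : Set L} (h : ¬(tsupport (chartPartition L c) ∩ K).Nonempty) {c' : L}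
    {y : Eucl 3} (hy : (chart c').symm y ∈ K) : rho c c' y = 0 := by
  by_contra h0
  exact h ⟨_, subset_tsupport _ h0, hy⟩

lemma sum_rho {K : Set L} (hK : IsCompact K) {c' : L} {y : Eucl 3} (hy : (chart c').symm y ∈ K) :
    ∑ c ∈ (finite_meets hK).toFinset, rho c c' y = 1 := by
  refine (chartPartition L).sum_finsupport' _ (mem_univ ((chart c').symm y)) fun c hc => ?_
  rw [SmoothPartitionOfUnity.mem_finsupport] at hc
  simp only [Finite.mem_toFinset, mem_ofPred_eq]
  exact ⟨_, subset_tsupport _ hc, hy⟩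

/-- The divergence theorem: the divergence of a compactly supported vector density has integral
zero. -/
theorem IsVectorDensity.sum_integral_div {W : L → Eucl 3 → Fin 3 → ℝ} {K : Set L}
    (hK : IsCompact K) (hW : IsVectorDensity W K) :
    ∑ c ∈ (finite_meets hK).toFinset,
      ∫ y in (chart c).target, rho c c y * ∑ i, pderiv i (fun z => W c z i) y = 0 := by
  set T := (finite_meets hK).toFinset with hT
  have hWd : ∀ c i, ∀ y ∈ (chart (n := 3) c).target, DifferentiableAt ℝ (fun z => W c z i) y :=
    fun c i y hy => ((hW.contDiffOn c i).contDiffAt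
      ((isOpen_target c).mem_nhds hy)).differentiableAt (by simp)
  have hρd : ∀ c c' : L, ∀ y ∈ (chart (n := 3) c').target, DifferentiableAt ℝ (rho c c') y :=
    fun c c' y hy => ((contDiffOn_rho c c').contDiffAt
      ((isOpen_target c').mem_nhds hy)).differentiableAt (by simp)
  have hρc : ∀ (c c' : L) i,
      ContinuousOn (fun y => pderiv i (rho c c') y) (chart (n := 3) c').target :=
    fun c c' i => ((contDiffOn_rho c c').continuousOn_fderiv_of_isOpen (isOpen_target c')
      (by norm_cast)).clm_apply continuousOn_const
  have hWc : ∀ c i,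
      ContinuousOn (fun y => pderiv i (fun z => W c z i) y) (chart (n := 3) c).target :=
    fun c i => ((hW.contDiffOn c i).continuousOn_fderiv_of_isOpen (isOpen_target c)
      le_rfl).clm_apply continuousOn_const
  -- zero sets of the integrands
  have zρ : ∀ c c' : L, ∀ y ∈ (chart (n := 3) c').target,
      (chart c').symm y ∉ tsupport (chartPartition L c) → ∀ i, pderiv i (rho c c') y = 0 := by
    intro c c' y hy hyc i
    have : rho c c' =ᶠ[𝓝 y] fun _ => 0 := by
      filter_upwards [(continuousAt_symm hy).eventually
        ((isClosed_tsupport _).isOpen_compl.mem_nhds hyc)] with z hz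
      exact image_eq_zero_of_notMem_tsupport (f := chartPartition L c) hz
    rw [pderiv, this.fderiv_eq]
    simp
  have zW : ∀ c, ∀ y ∈ (chart (n := 3) c).target, (chart c).symm y ∉ K → ∀ i,
      pderiv i (fun z => W c z i) y = 0 := by
    intro c y hy hyK i
    have : (fun z => W c z i) =ᶠ[𝓝 y] fun _ => 0 := by
      filter_upwards [(continuousAt_symm hy).eventually (hK.isClosed.isOpen_compl.mem_nhds hyK),
        (isOpen_target c).mem_nhds hy] with z hz hz'
      exact hW.eq_zero c z hz' hz i
    rw [pderiv, this.fderiv_eq]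
    simp
  let d : L → L → Eucl 3 → ℝ := fun c c' y => ∑ i, pderiv i (rho c c') y * W c' y i
  have hdc : ∀ c c', ContinuousOn (d c c') (chart (n := 3) c').target := fun c c' =>
    continuousOn_finsetSum _ fun i _ => (hρc c c' i).mul (hW.contDiffOn c' i).continuousOn
  -- integration by parts in each chart
  have parts : ∀ c, ∫ y in (chart c).target, rho c c y * ∑ i, pderiv i (fun z => W c z i) y =
      -∫ y in (chart c).target, d c c y := by
    intro c
    have hz : ∀ i, ∀ y ∈ (chart c).target, y ∉ chartCompact c K → rho c c y * W c y i = 0 := by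
      intro i y hy hyC
      rw [mem_chartCompact hy, not_and_or] at hyC
      rcases hyC with h | h
      · rw [rho, image_eq_zero_of_notMem_tsupport h, zero_mul]
      · rw [hW.eq_zero c y hy h, mul_zero]
    have h1 : ∀ i, ∫ y in (chart c).target,
        fderiv ℝ (fun z => rho c c z * W c z i) y (EuclideanSpace.single i 1) = 0 := fun i =>
      setIntegral_fderiv_eq_zero (isOpen_target c) (isCompact_chartCompact c hK)
        (chartCompact_subset c K) (((contDiffOn_rho c c).of_le (by norm_cast)).mul
        (hW.contDiffOn c i)) (hz i) _
    have h2 : ∀ i, ∀ y ∈ (chart c).target,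
        fderiv ℝ (fun z => rho c c z * W c z i) y (EuclideanSpace.single i 1) =
          rho c c y * pderiv i (fun z => W c z i) y + pderiv i (rho c c) y * W c y i := by
      intro i y hy
      rw [fderiv_fun_mul (hρd c c y hy) (hWd c i y hy)]
      simp only [_root_.add_apply, _root_.smul_apply, smul_eq_mul, pderiv]
      ring
    have i1 : IntegrableOn (fun y => rho c c y * ∑ i, pderiv i (fun z => W c z i) y)
        (chart c).target := by
      refine integrableOn_of_continuousOn_of_zero (isOpen_target c) (isCompact_chartCompact c hK)
        (chartCompact_subset c K) ((contDiffOn_rho c c).continuousOn.mul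
          (continuousOn_finsetSum _ fun i _ => hWc c i)) fun y hy hyC => ?_
      rw [mem_chartCompact hy, not_and_or] at hyC
      rcases hyC with h | h
      · rw [rho, image_eq_zero_of_notMem_tsupport h, zero_mul]
      · simp [zW c y hy h]
    have i2 : IntegrableOn (d c c) (chart c).target := by
      refine integrableOn_of_continuousOn_of_zero (isOpen_target c) (isCompact_chartCompact c hK)
        (chartCompact_subset c K) (hdc c c) fun y hy hyC => ?_
      rw [mem_chartCompact hy, not_and_or] at hyC
      rcases hyC with h | h
      · simp [d, zρ c c y hy h]
      · simp [d, hW.eq_zero c y hy h]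
    rw [eq_neg_iff_add_eq_zero, ← integral_add i1 i2]
    have h3 : ∀ y ∈ (chart c).target, rho c c y * ∑ i, pderiv i (fun z => W c z i) y + d c c y =
        ∑ i, fderiv ℝ (fun z => rho c c z * W c z i) y (EuclideanSpace.single i 1) := by
      intro y hy
      simp only [h2 _ y hy, Finset.sum_add_distrib, Finset.mul_sum, d]
    rw [setIntegral_congr_fun (isOpen_target c).measurableSet h3, integral_finsetSum]
    · exact Finset.sum_eq_zero fun i _ => h1 i
    · intro i _
      refine integrableOn_of_continuousOn_of_zero (isOpen_target c) (isCompact_chartCompact c hK)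
        (chartCompact_subset c K) ?_ ?_
      · exact ((((contDiffOn_rho c c).of_le (by norm_cast)).mul
          (hW.contDiffOn c i)).continuousOn_fderiv_of_isOpen (isOpen_target c) le_rfl).clm_apply
          continuousOn_const
      · intro y hy hyC
        have h0 := fderiv_eq_zero_of_zero (isOpen_target c) (isCompact_chartCompact c hK).isClosed
          (hz i) hy hyC
        rw [h0]
        simp
  -- a second partition of unity, and a change of variables
  have swap : ∀ c c', ∫ y in (chart c).target, rho c' c y * d c c y =
      ∫ y in (chart c').target, rho c' c' y * d c c' y := by
    intro c c'
    refine setIntegral_overlap (fun y hy hy' => ?_) (fun y hy hy' => ?_) fun y hy hy' => ?_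
    · have h := hW.deriv_transform (chartPartition L c).contMDiff hy hy'
      have h2 : rho c' c' (trans c c' y) = rho c' c y := by rw [rho, rho, symm_trans hy']
      rw [h2]
      change _ * (∑ i, pderiv i (fun z => chartPartition L c ((chart c).symm z)) y * W c y i) = _
      rw [h]
      simp only [d, rho]
      ring_nf
      rfl
    · have : rho c' c y = 0 := by
        by_contra h0
        exact hy' (tsupport_chartPartition c' (subset_tsupport _ h0))
      rw [this, zero_mul]
    · have : d c c' y = 0 := by
        simp only [d]
        refine Finset.sum_eq_zero fun i _ => ?_
        rw [zρ c c' y hy fun h => hy' (tsupport_chartPartition c h), zero_mul]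
      rw [this, mul_zero]
  have ins : ∀ c, ∫ y in (chart c).target, d c c y =
      ∑ c' ∈ T, ∫ y in (chart c).target, rho c' c y * d c c y := by
    intro c
    rw [← integral_finsetSum]
    · refine setIntegral_congr_fun (isOpen_target c).measurableSet fun y hy => ?_
      simp only [← Finset.sum_mul]
      by_cases hyK : (chart c).symm y ∈ K
      · rw [hT, sum_rho hK hyK, one_mul]
      · simp [d, hW.eq_zero c y hy hyK]
    · intro c' _
      refine integrableOn_of_continuousOn_of_zero (isOpen_target c) (isCompact_chartCompact c hK)
        (chartCompact_subset c K) ((contDiffOn_rho c' c).continuousOn.mul (hdc c c))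
        fun y hy hyC => ?_
      rw [mem_chartCompact hy, not_and_or] at hyC
      rcases hyC with h | h
      · simp [d, zρ c c y hy h]
      · simp [d, hW.eq_zero c y hy h]
  have fin : ∀ c', ∑ c ∈ T, ∫ y in (chart c').target, rho c' c' y * d c c' y = 0 := by
    intro c'
    rw [← integral_finsetSum]
    · rw [← integral_zero (Eucl 3) ℝ (μ := volume.restrict (chart c').target)]
      refine setIntegral_congr_fun (isOpen_target c').measurableSet fun y hy => ?_
      simp only [← Finset.mul_sum]
      have : ∑ c ∈ T, d c c' y = 0 := by
        simp only [d]
        rw [Finset.sum_comm]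
        refine Finset.sum_eq_zero fun i _ => ?_
        rw [← Finset.sum_mul]
        by_cases hWy : W c' y i = 0
        · rw [hWy, mul_zero]
        · -- near a point where `W` does not vanish the partition functions add up to one
          have hev : (fun z => ∑ c ∈ T, rho c c' z) =ᶠ[𝓝 y] fun _ => 1 := by
            filter_upwards [(hWd c' i y hy).continuousAt.eventually_ne hWy,
              (isOpen_target c').mem_nhds hy] with z hz hz'
            refine sum_rho hK ?_
            by_contra hzK
            exact hz (hW.eq_zero c' z hz' hzK i)
          have : ∑ c ∈ T, pderiv i (rho c c') y = 0 := by
            have h := hev.fderiv_eq (𝕜 := ℝ)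
            rw [fderiv_fun_sum fun c _ => hρd c c' y hy] at h
            have h' := DFunLike.congr_fun h (EuclideanSpace.single i 1)
            simpa [_root_.sum_apply, pderiv] using h'
          rw [this, zero_mul]
      rw [this, mul_zero]
    · intro c _
      refine integrableOn_of_continuousOn_of_zero (isOpen_target c') (isCompact_chartCompact c' hK)
        (chartCompact_subset c' K) ((contDiffOn_rho c' c').continuousOn.mul (hdc c c'))
        fun y hy hyC => ?_
      rw [mem_chartCompact hy, not_and_or] at hyC
      rcases hyC with h | h
      · rw [rho, image_eq_zero_of_notMem_tsupport h, zero_mul]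
      · simp [d, hW.eq_zero c' y hy h]
  calc ∑ c ∈ T, ∫ y in (chart c).target, rho c c y * ∑ i, pderiv i (fun z => W c z i) y
      = -∑ c ∈ T, ∑ c' ∈ T, ∫ y in (chart c').target, rho c' c' y * d c c' y := by
        rw [← Finset.sum_neg_distrib]
        refine Finset.sum_congr rfl fun c _ => ?_
        rw [parts, ins]
        exact congrArg Neg.neg (Finset.sum_congr rfl fun c' _ => swap c c')
    _ = 0 := by
        rw [Finset.sum_comm, Finset.sum_eq_zero fun c' _ => fin c', neg_zero]

end Partition

/-! ### Invariance of the divergence -/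

section Piola

/-- The `k`-th component of the cross product, as a bilinear form. -/
def crossL (k : Fin 3) : Eucl 3 →L[ℝ] Eucl 3 →L[ℝ] ℝ :=
  (EuclideanSpace.proj (𝕜 := ℝ) (k + 1)).smulRight (EuclideanSpace.proj (𝕜 := ℝ) (k + 2)) -
    (EuclideanSpace.proj (𝕜 := ℝ) (k + 2)).smulRight (EuclideanSpace.proj (𝕜 := ℝ) (k + 1))

lemma crossL_apply (k : Fin 3) (u v : Eucl 3) :
    crossL k u v = u (k + 1) * v (k + 2) - u (k + 2) * v (k + 1) := by
  simp [crossL]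

/-- The matrix of a linear map between Euclidean spaces. -/
def matOf {n : ℕ} (A : Eucl n →L[ℝ] Eucl n) : Matrix (Fin n) (Fin n) ℝ :=
  Matrix.of fun k i => A (EuclideanSpace.single i 1) k

lemma det_matOf {n : ℕ} (A : Eucl n →L[ℝ] Eucl n) : (matOf A).det = A.det := by
  rw [ContinuousLinearMap.det, ← LinearMap.det_toMatrix (stdB n)]
  congr 1

lemma clm_apply_eq_sum {n : ℕ} (f : Eucl n →L[ℝ] ℝ) (v : Eucl n) :
    f v = ∑ k, v k * f (EuclideanSpace.single k 1) := by
  conv_lhs => rw [eucl_sum v]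
  simp

/-- The divergence of a vector density is a density: the divergence is the exterior derivative of
the 2-form obtained by contracting the vector field with the volume form. -/
lemma div_transform {F : Eucl 3 → Eucl 3} {y : Eucl 3} {W W' : Eucl 3 → Fin 3 → ℝ}
    (hF : ContDiffAt ℝ 2 F y) (hW : ∀ i, DifferentiableAt ℝ (fun z => W z i) y)
    (hW' : ∀ i, DifferentiableAt ℝ (fun z => W' z i) (F y)) (hdet : (fderiv ℝ F y).det ≠ 0)
    (h : ∀ᶠ z in 𝓝 y, ∀ k, ∑ i, W z i * fderiv ℝ F z (EuclideanSpace.single i 1) k =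
      |(fderiv ℝ F z).det| * W' (F z) k) :
    ∑ i, pderiv i (fun z => W z i) y =
      |(fderiv ℝ F y).det| * ∑ i, pderiv i (fun z => W' z i) (F y) := by
  let σ : Eucl 3 → Eucl 3 →L[ℝ] Eucl 3 →L[ℝ] ℝ := fun x => ∑ k, W' x k • crossL k
  have hσ : ∀ x u v, σ x u v = ∑ k, W' x k * crossL k u v := fun x u v => by
    simp [σ, _root_.sum_apply]
  have hσd : HasFDerivAt σ (∑ k, (fderiv ℝ (fun z => W' z k) (F y)).smulRight (crossL k)) (F y) :=
    HasFDerivAt.fun_sum fun k _ => (hW' k).hasFDerivAt.smul_const (crossL k)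
  have hσ' : ∀ a b c, fderiv ℝ σ (F y) a b c =
      ∑ k, fderiv ℝ (fun z => W' z k) (F y) a * crossL k b c := fun a b c => by
    rw [hσd.fderiv]
    simp [_root_.sum_apply]
  have alt : ∀ u v, σ (F y) u v = -σ (F y) v u := by
    intro u v
    rw [hσ, hσ, ← Finset.sum_neg_distrib]
    exact Finset.sum_congr rfl fun k _ => by rw [crossL_apply, crossL_apply]; ring
  have hcd : ContinuousAt (fun z => (fderiv ℝ F z).det) y :=
    ContinuousLinearMap.continuous_det.continuousAt.comp
      (hF.fderiv_right (m := 1) (by norm_num)).continuousAt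
  set s : ℝ := ((SignType.sign (fderiv ℝ F y).det : SignType) : ℝ) with hs
  have hsd : s * (fderiv ℝ F y).det = |(fderiv ℝ F y).det| := by
    rw [hs]; exact sign_mul_self _
  have hss : s * s = 1 := by
    rcases lt_or_gt_of_ne hdet with h0 | h0 <;> simp [hs, h0]
  have hsev : ∀ᶠ z in 𝓝 y, (fderiv ℝ F z).det ≠ 0 ∧
      s * |(fderiv ℝ F z).det| = (fderiv ℝ F z).det := by
    rcases lt_or_gt_of_ne hdet with h0 | h0
    · filter_upwards [hcd.eventually_lt_const h0] with z hz
      exact ⟨hz.ne, by simp [hs, h0, abs_of_neg hz]⟩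
    · filter_upwards [hcd.eventually_const_lt h0] with z hz
      exact ⟨hz.ne', by simp [hs, h0, abs_of_pos hz]⟩
  have key : ∀ j : Fin 3, (fun z => σ (F z) (fderiv ℝ F z (EuclideanSpace.single (j + 1) 1))
      (fderiv ℝ F z (EuclideanSpace.single (j + 2) 1))) =ᶠ[𝓝 y] fun z => s * W z j := by
    intro j
    filter_upwards [h, hsev] with z hz ⟨hz0, hzs⟩
    have e : |(fderiv ℝ F z).det| * σ (F z) (fderiv ℝ F z (EuclideanSpace.single (j + 1) 1))
        (fderiv ℝ F z (EuclideanSpace.single (j + 2) 1)) = (fderiv ℝ F z).det * W z j := by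
      rw [hσ, Finset.mul_sum]
      simp only [← mul_assoc, ← hz]
      rw [← det_matOf, Matrix.det_fin_three]
      fin_cases j <;> simp [Fin.sum_univ_three, crossL_apply, matOf] <;> ring
    have h0 : |(fderiv ℝ F z).det| ≠ 0 := abs_ne_zero.2 hz0
    apply mul_left_cancel₀ h0
    linear_combination e - W z j * hzs
  have hp := dTwo_pullback (F := F) hσd.differentiableAt hF alt (EuclideanSpace.single 0 1)
    (EuclideanSpace.single 1 1) (EuclideanSpace.single 2 1)
  have k0 := (key 0).fderiv_eq (𝕜 := ℝ)
  have k1 := (key 1).fderiv_eq (𝕜 := ℝ)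
  have k2 := (key 2).fderiv_eq (𝕜 := ℝ)
  simp only [Fin.isValue, zero_add, Fin.reduceAdd] at k0 k1 k2
  rw [k0, k1, k2, fderiv_const_mul (hW 0), fderiv_const_mul (hW 1), fderiv_const_mul (hW 2),
    dTwo, hσ', hσ', hσ'] at hp
  have hlin : ∀ k i, fderiv ℝ (fun z => W' z k) (F y)
      (fderiv ℝ F y (EuclideanSpace.single i 1)) =
      ∑ m, matOf (fderiv ℝ F y) m i * pderiv m (fun z => W' z k) (F y) := fun k i =>
    clm_apply_eq_sum _ _
  have hfin : s * ∑ i, pderiv i (fun z => W z i) y =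
      (fderiv ℝ F y).det * ∑ i, pderiv i (fun z => W' z i) (F y) := by
    rw [Fin.sum_univ_three, mul_add, mul_add]
    refine Eq.trans hp ?_
    rw [← det_matOf, Matrix.det_fin_three]
    simp only [hlin, crossL_apply, Fin.sum_univ_three, Fin.isValue, zero_add, Fin.reduceAdd]
    simp only [matOf, Matrix.of_apply]
    ring
  calc _ = s * (s * ∑ i, pderiv i (fun z => W z i) y) := by rw [← mul_assoc, hss, one_mul]
    _ = _ := by rw [hfin, ← mul_assoc, hsd]

end Piola

/-! ### Harmonic 1-forms on a compact 3-manifold are closed and coclosed -/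

section MatrixCalculus

open scoped Matrix MatrixOrder

variable {n : ℕ} {E : Type*} [NormedAddCommGroup E] [NormedSpace ℝ E] {s : Set E}
  {H : E → Matrix (Fin n) (Fin n) ℝ}

lemma contDiffOn_det (h : ∀ i j, ContDiffOn ℝ ∞ (fun y => H y i j) s) :
    ContDiffOn ℝ ∞ (fun y => (H y).det) s := by
  simp only [Matrix.det_apply]
  exact ContDiffOn.sum fun σ _ => (contDiffOn_prod fun i _ => h _ _).const_smul _

lemma contDiffOn_inv (h : ∀ i j, ContDiffOn ℝ ∞ (fun y => H y i j) s)
    (h0 : ∀ y ∈ s, (H y).det ≠ 0) (i j : Fin n) : ContDiffOn ℝ ∞ (fun y => (H y)⁻¹ i j) s := by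
  have : ∀ y, (H y)⁻¹ i j = (H y).det⁻¹ * ((H y).updateRow j (Pi.single i 1)).det := by
    intro y
    rw [Matrix.inv_def, Ring.inverse_eq_inv', Matrix.smul_apply, smul_eq_mul,
      Matrix.adjugate_apply]
  simp only [this]
  refine ((contDiffOn_det h).inv h0).mul (contDiffOn_det fun k l => ?_)
  by_cases hk : k = j
  · subst hk
    simpa using contDiffOn_const
  · simpa [Matrix.updateRow_ne hk] using h k l

/-- The square of the norm of a 2-tensor is nonnegative, and positive unless the tensor vanishes. -/
lemma tensor_norm_nonneg {P D : Matrix (Fin n) (Fin n) ℝ} (hP : P.PosDef) :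
    0 ≤ (P * D * P * Dᵀ).trace ∧ ((P * D * P * Dᵀ).trace = 0 → D = 0) := by
  obtain ⟨B, hB, rfl⟩ : ∃ B : Matrix (Fin n) (Fin n) ℝ, IsUnit B ∧ P = Bᵀ * B := by
    obtain ⟨B, hB⟩ := CStarAlgebra.nonneg_iff_eq_star_mul_self.1 hP.posSemidef.nonneg
    rw [Matrix.star_eq_conjTranspose, Matrix.conjTranspose_eq_transpose_of_trivial] at hB
    refine ⟨B, ?_, hB⟩
    have := hP.isUnit
    rw [hB, Matrix.isUnit_iff_isUnit_det, Matrix.det_mul] at this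
    rw [Matrix.isUnit_iff_isUnit_det]
    exact isUnit_of_mul_isUnit_right this
  have e : (Bᵀ * B * D * (Bᵀ * B) * Dᵀ).trace = ((B * D * Bᵀ) * (B * D * Bᵀ)ᵀ).trace := by
    simp only [Matrix.transpose_mul, Matrix.transpose_transpose, Matrix.mul_assoc]
    rw [Matrix.trace_mul_comm Bᵀ]
    simp only [Matrix.mul_assoc]
  have e2 : ((B * D * Bᵀ) * (B * D * Bᵀ)ᵀ).trace = ∑ i, ∑ j, (B * D * Bᵀ) i j ^ 2 := by
    simp only [Matrix.trace, Matrix.diag, Matrix.mul_apply (M := B * D * Bᵀ),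
      Matrix.transpose_apply, sq]
  rw [e, e2]
  refine ⟨Finset.sum_nonneg fun i _ => Finset.sum_nonneg fun j _ => sq_nonneg _, fun h0 => ?_⟩
  have hz : B * D * Bᵀ = 0 := by
    ext i j
    have h1 := (Finset.sum_eq_zero_iff_of_nonneg fun i _ =>
      Finset.sum_nonneg fun j _ => sq_nonneg _).1 h0 i (Finset.mem_univ _)
    have h2 := (Finset.sum_eq_zero_iff_of_nonneg fun j _ => sq_nonneg _).1 h1 j (Finset.mem_univ _)
    simpa using h2
  have hBt : IsUnit Bᵀ := by
    rw [Matrix.isUnit_iff_isUnit_det, Matrix.det_transpose, ← Matrix.isUnit_iff_isUnit_det]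
    exact hB
  have h3 : B * D = 0 := hBt.mul_left_injective (by simpa using hz)
  exact hB.mul_right_injective (by simpa using h3)

end MatrixCalculus

section Families

open scoped Matrix

variable {X : Type*} [TopologicalSpace X] [ChartedSpace (Eucl 3) X]

/-- The Jacobian matrix of the transition between two charts. -/
def jac (c c' : X) (y : Eucl 3) : Matrix (Fin 3) (Fin 3) ℝ := matOf (fderiv ℝ (trans c c') y)

lemma det_jac (c c' : X) (y : Eucl 3) : (jac c c' y).det = (fderiv ℝ (trans c c') y).det :=
  det_matOf _

/-- The coefficients of a Riemannian metric in all charts. -/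
structure IsMetricFamily (h : X → Eucl 3 → Matrix (Fin 3) (Fin 3) ℝ) : Prop where
  contDiffOn : ∀ c i j, ContDiffOn ℝ ∞ (fun y => h c y i j) (chart c).target
  posDef : ∀ c, ∀ y ∈ (chart c).target, (h c y).PosDef
  transform : ∀ c c', ∀ y ∈ (chart c).target, (chart c).symm y ∈ (chart (n := 3) c').source →
    h c y = (jac c c' y)ᵀ * h c' (trans c c' y) * jac c c' y

/-- The coefficients of a 1-form in all charts. -/
structure IsFormFamily (b : X → Eucl 3 → Fin 3 → ℝ) : Prop where
  contDiffOn : ∀ c i, ContDiffOn ℝ ∞ (fun y => b c y i) (chart c).target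
  transform : ∀ c c', ∀ y ∈ (chart c).target, (chart c).symm y ∈ (chart (n := 3) c').source →
    b c y = (jac c c' y)ᵀ.mulVec (b c' (trans c c' y))

namespace IsMetricFamily

variable {h : X → Eucl 3 → Matrix (Fin 3) (Fin 3) ℝ} (hh : IsMetricFamily h)
include hh

lemma det_pos {c : X} {y : Eucl 3} (hy : y ∈ (chart c).target) : 0 < (h c y).det :=
  (hh.posDef c y hy).det_pos

lemma density_pos {c : X} {y : Eucl 3} (hy : y ∈ (chart c).target) : 0 < density (h c) y :=
  Real.sqrt_pos.2 (hh.det_pos hy)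

lemma symm {c : X} {y : Eucl 3} (hy : y ∈ (chart c).target) : (h c y)ᵀ = h c y := by
  have := (hh.posDef c y hy).isHermitian
  rwa [Matrix.IsHermitian, Matrix.conjTranspose_eq_transpose_of_trivial] at this

lemma contDiffOn_density (c : X) : ContDiffOn ℝ ∞ (density (h c)) (chart c).target :=
  (contDiffOn_det (hh.contDiffOn c)).sqrt fun _ hy => (hh.det_pos hy).ne'

lemma contDiffOn_inv (c : X) (i j : Fin 3) :
    ContDiffOn ℝ ∞ (fun y => (h c y)⁻¹ i j) (chart c).target :=
  NearlyKahler.contDiffOn_inv (hh.contDiffOn c) (fun _ hy => (hh.det_pos hy).ne') i j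

variable {c c' : X} {y : Eucl 3} (hy : y ∈ (chart c).target)
  (hy' : (chart c).symm y ∈ (chart (n := 3) c').source)
include hy hy'

lemma det_eq : (h c y).det = (jac c c' y).det ^ 2 * (h c' (trans c c' y)).det := by
  rw [hh.transform c c' y hy hy', Matrix.det_mul, Matrix.det_mul, Matrix.det_transpose]
  ring

lemma jac_det_ne_zero : (jac c c' y).det ≠ 0 := by
  intro h0
  have := hh.det_pos hy
  rw [hh.det_eq hy hy', h0] at this
  simp at this

lemma density_transform :
    density (h c) y = |(jac c c' y).det| * density (h c') (trans c c' y) := by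
  rw [density, density, hh.det_eq hy hy', Real.sqrt_mul (sq_nonneg _), Real.sqrt_sq_eq_abs]

/-- Raising an index commutes with changes of charts. -/
lemma raise_transform (b' : Fin 3 → ℝ) :
    (jac c c' y).mulVec ((h c y)⁻¹.mulVec ((jac c c' y)ᵀ.mulVec b')) =
      (h c' (trans c c' y))⁻¹.mulVec b' := by
  have h1 : IsUnit (jac c c' y).det := (hh.jac_det_ne_zero hy hy').isUnit
  rw [hh.transform c c' y hy hy', Matrix.mul_inv_rev, Matrix.mul_inv_rev, Matrix.mulVec_mulVec,
    Matrix.mulVec_mulVec]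
  congr 1
  rw [← Matrix.transpose_nonsing_inv]
  simp only [Matrix.mul_assoc]
  rw [← Matrix.transpose_mul, Matrix.mul_nonsing_inv _ h1, Matrix.transpose_one, Matrix.mul_one,
    Matrix.mul_nonsing_inv_cancel_left _ _ h1]

end IsMetricFamily

variable [IsManifold 𝓘(ℝ, Eucl 3) ∞ X]

lemma extDeriv_transform {b : X → Eucl 3 → Fin 3 → ℝ} (hb : IsFormFamily b) {c c' : X}
    {y : Eucl 3} (hy : y ∈ (chart c).target)
    (hy' : (chart c).symm y ∈ (chart (n := 3) c').source) :
    Matrix.of (extDeriv₁ (b c) y) =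
      (jac c c' y)ᵀ * Matrix.of (extDeriv₁ (b c') (trans c c' y)) * jac c c' y := by
  let β : Eucl 3 → Eucl 3 →L[ℝ] ℝ := fun x => ∑ k, b c' x k • EuclideanSpace.proj (𝕜 := ℝ) k
  have hβ : ∀ x u, β x u = ∑ k, b c' x k * u k := fun x u => by simp [β, _root_.sum_apply]
  have hd : ∀ k, DifferentiableAt ℝ (fun z => b c' z k) (trans c c' y) := fun k =>
    ((hb.contDiffOn c' k).contDiffAt ((isOpen_target c').mem_nhds
      (trans_mem hy'))).differentiableAt (by simp)
  have hβd : HasFDerivAt β (∑ k, (fderiv ℝ (fun z => b c' z k) (trans c c' y)).smulRight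
      (EuclideanSpace.proj (𝕜 := ℝ) k)) (trans c c' y) :=
    HasFDerivAt.fun_sum fun k _ => (hd k).hasFDerivAt.smul_const _
  have hβ' : ∀ a u, fderiv ℝ β (trans c c' y) a u =
      ∑ k, fderiv ℝ (fun z => b c' z k) (trans c c' y) a * u k := fun a u => by
    rw [hβd.fderiv]
    simp [_root_.sum_apply]
  ext i j
  have hp := dOne_pullback hβd.differentiableAt ((contDiffAt_trans hy hy').of_le
    ENat.LEInfty.out) (EuclideanSpace.single i 1) (EuclideanSpace.single j 1)
  have key : ∀ i, (fun z => β (trans c c' z)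
      (fderiv ℝ (trans c c') z (EuclideanSpace.single i 1))) =ᶠ[𝓝 y] fun z => b c z i := by
    intro i
    filter_upwards [eventually_overlap hy hy'] with z hz
    rw [hβ, hb.transform c c' z hz.1 hz.2, Matrix.mulVec, dotProduct]
    exact Finset.sum_congr rfl fun k _ => by
      rw [mul_comm]; rfl
  rw [(key j).fderiv_eq, (key i).fderiv_eq, dOne, hβ', hβ'] at hp
  change extDeriv₁ (b c) y i j = _
  refine Eq.trans hp ?_
  simp only [clm_apply_eq_sum (fderiv ℝ (fun z => b c' z _) (trans c c' y)) (fderiv ℝ _ _ _)]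
  simp only [Matrix.mul_apply, Fin.sum_univ_three, Matrix.transpose_apply, jac, matOf,
    Matrix.of_apply, extDeriv₁, pderiv]
  ring

end Families

section Hodge

open scoped Matrix

lemma contDiffOn_pderiv {f : Eucl 3 → ℝ} {U : Set (Eucl 3)} (hU : IsOpen U)
    (hf : ContDiffOn ℝ ∞ f U) (i : Fin 3) : ContDiffOn ℝ ∞ (pderiv i f) U :=
  (hf.fderiv_of_isOpen hU (m := ∞) (by simp)).clm_apply contDiffOn_const

variable {X : Type*} [TopologicalSpace X] [ChartedSpace (Eucl 3) X]
  {h : X → Eucl 3 → Matrix (Fin 3) (Fin 3) ℝ} {b : X → Eucl 3 → Fin 3 → ℝ}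

/-- The vector density of a 1-form `b`, with components `√(det h) bⁱ`. -/
def raiseDensity (h : Eucl 3 → Matrix (Fin 3) (Fin 3) ℝ) (b : Eucl 3 → Fin 3 → ℝ) (y : Eucl 3)
    (i : Fin 3) : ℝ := density h y * ∑ j, (h y)⁻¹ i j * b y j

/-- The tensor density `√(det h) (db)ⁱˡ`. -/
def raiseExt (h : Eucl 3 → Matrix (Fin 3) (Fin 3) ℝ) (b : Eucl 3 → Fin 3 → ℝ) (y : Eucl 3)
    (i l : Fin 3) : ℝ :=
  density h y * ∑ a, ∑ e, (h y)⁻¹ i a * (h y)⁻¹ l e * extDeriv₁ b y a e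

/-- The vector density `√(det h) ((d^* b) bⁱ - (db)ⁱˡ bₗ)`, whose divergence is the difference of
`⟨Δb, b⟩ √(det h)` and `(|d^* b|² + |db|²) √(det h)`. -/
def hodgeField (h : Eucl 3 → Matrix (Fin 3) (Fin 3) ℝ) (b : Eucl 3 → Fin 3 → ℝ) (y : Eucl 3)
    (i : Fin 3) : ℝ := codiff₁ h b y * raiseDensity h b y i - ∑ l, b y l * raiseExt h b y i l

/-- A pointwise transformation rule, in matrix form, is the one required of vector densities. -/
lemma transform_of_mulVec {w w' : Fin 3 → ℝ}
    {c c' : X} {y : Eucl 3}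
    (hw : (jac c c' y).mulVec w = |(jac c c' y).det| • w') (k : Fin 3) :
    ∑ i, w i * fderiv ℝ (trans c c') y (EuclideanSpace.single i 1) k =
      |(fderiv ℝ (trans c c') y).det| * w' k := by
  have := congrFun hw k
  rw [det_jac] at this
  rw [← smul_eq_mul, ← Pi.smul_apply, ← this, Matrix.mulVec, dotProduct]
  exact Finset.sum_congr rfl fun i _ => mul_comm _ _

namespace IsMetricFamily

variable (hh : IsMetricFamily h) (hb : IsFormFamily b)
include hh

lemma inv_symm {c : X} {y : Eucl 3} (hy : y ∈ (chart c).target) : ((h c y)⁻¹)ᵀ = (h c y)⁻¹ := by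
  rw [Matrix.transpose_nonsing_inv, hh.symm hy]

include hb

lemma contDiffOn_raiseDensity (c : X) (i : Fin 3) :
    ContDiffOn ℝ ∞ (fun y => raiseDensity (h c) (b c) y i) (chart c).target :=
  (hh.contDiffOn_density c).mul (ContDiffOn.sum fun j _ =>
    (hh.contDiffOn_inv c i j).mul (hb.contDiffOn c j))

lemma contDiffOn_codiff (c : X) : ContDiffOn ℝ ∞ (codiff₁ (h c) (b c)) (chart c).target :=
  (((hh.contDiffOn_density c).inv fun _ hy => (hh.density_pos hy).ne').mul
    (ContDiffOn.sum fun i _ => contDiffOn_pderiv (isOpen_target c)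
      (hh.contDiffOn_raiseDensity hb c i) i)).neg

omit hh in
lemma contDiffOn_extDeriv (c : X) (i j : Fin 3) :
    ContDiffOn ℝ ∞ (fun y => extDeriv₁ (b c) y i j) (chart c).target :=
  (contDiffOn_pderiv (isOpen_target c) (hb.contDiffOn c j) i).sub
    (contDiffOn_pderiv (isOpen_target c) (hb.contDiffOn c i) j)

lemma contDiffOn_raiseExt (c : X) (i l : Fin 3) :
    ContDiffOn ℝ ∞ (fun y => raiseExt (h c) (b c) y i l) (chart c).target :=
  (hh.contDiffOn_density c).mul (ContDiffOn.sum fun a _ => ContDiffOn.sum fun e _ =>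
    ((hh.contDiffOn_inv c i a).mul (hh.contDiffOn_inv c l e)).mul (contDiffOn_extDeriv hb c a e))

lemma contDiffOn_hodgeField (c : X) (i : Fin 3) :
    ContDiffOn ℝ ∞ (fun y => hodgeField (h c) (b c) y i) (chart c).target :=
  ((hh.contDiffOn_codiff hb c).mul (hh.contDiffOn_raiseDensity hb c i)).sub
    (ContDiffOn.sum fun l _ => (hb.contDiffOn c l).mul (hh.contDiffOn_raiseExt hb c i l))

/-- The Bochner-type identity behind the Hodge theorem: `⟨Δb, b⟩` is a divergence plus
`|d^* b|² + |db|²`. -/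
lemma hodge_identity {c : X} {y : Eucl 3} (hy : y ∈ (chart c).target) :
    ∑ k, hodgeLaplacian (h c) (b c) y k * raiseDensity (h c) (b c) y k =
      ∑ i, pderiv i (fun z => hodgeField (h c) (b c) z i) y
        + density (h c) y * (codiff₁ (h c) (b c) y ^ 2 + 1 / 2 *
          ((h c y)⁻¹ * Matrix.of (extDeriv₁ (b c) y) * (h c y)⁻¹ *
            (Matrix.of (extDeriv₁ (b c) y))ᵀ).trace) := by
  have hv := hh.density_pos hy
  have dd : ∀ {f : Eucl 3 → ℝ}, ContDiffOn ℝ ∞ f (chart c).target → DifferentiableAt ℝ f y :=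
    fun hf => (hf.contDiffAt ((isOpen_target c).mem_nhds hy)).differentiableAt (by simp)
  have dδ := dd (hh.contDiffOn_codiff hb c)
  have dX := fun i => dd (hh.contDiffOn_raiseDensity hb c i)
  have dF := fun i l => dd (hh.contDiffOn_raiseExt hb c i l)
  have db := fun i => dd (hb.contDiffOn c i)
  have hW : ∀ i, pderiv i (fun z => hodgeField (h c) (b c) z i) y =
      pderiv i (codiff₁ (h c) (b c)) y * raiseDensity (h c) (b c) y i
      + codiff₁ (h c) (b c) y * pderiv i (fun z => raiseDensity (h c) (b c) z i) y
      - ∑ l, (pderiv i (fun z => b c z l) y * raiseExt (h c) (b c) y i l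
        + b c y l * pderiv i (fun z => raiseExt (h c) (b c) z i l) y) := by
    intro i
    have := ((dδ.hasFDerivAt.mul (dX i).hasFDerivAt).sub (HasFDerivAt.fun_sum (u := Finset.univ)
      fun l _ => (db l).hasFDerivAt.mul (dF i l).hasFDerivAt)).fderiv
    have h2 := DFunLike.congr_fun this (EuclideanSpace.single i 1)
    refine Eq.trans h2 ?_
    simp only [_root_.sub_apply, _root_.add_apply, _root_.sum_apply, _root_.smul_apply,
      smul_eq_mul, pderiv]
    rw [add_comm]
    congr 1
    · ring
    · exact Finset.sum_congr rfl fun l _ => by ring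
  have hdiv : ∑ i, pderiv i (fun z => raiseDensity (h c) (b c) z i) y =
      -(density (h c) y * codiff₁ (h c) (b c) y) := by
    have : codiff₁ (h c) (b c) y = -((density (h c) y)⁻¹ *
      ∑ i, pderiv i (fun z => raiseDensity (h c) (b c) z i) y) := rfl
    rw [this]
    field_simp
  have hco : ∀ k, codiff₂ (h c) (extDeriv₁ (b c)) y k = -((density (h c) y)⁻¹ * ∑ l, h c y k l *
      ∑ i, pderiv i (fun z => raiseExt (h c) (b c) z i l) y) := fun k => rfl
  have hlow : ∀ l, ∑ k, raiseDensity (h c) (b c) y k * h c y k l = density (h c) y * b c y l := by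
    intro l
    have h1 : (h c y *ᵥ ((h c y)⁻¹ *ᵥ b c y)) l = b c y l := by
      rw [Matrix.mulVec_mulVec, Matrix.mul_nonsing_inv _ (hh.det_pos hy).ne'.isUnit,
        Matrix.one_mulVec]
    rw [← h1, Matrix.mulVec, dotProduct, Finset.mul_sum]
    refine Finset.sum_congr rfl fun k _ => ?_
    have h2 : h c y k l = h c y l k := by
      conv_lhs => rw [← hh.symm hy, Matrix.transpose_apply]
    rw [h2, raiseDensity]
    change _ = density (h c) y * (h c y l k * ∑ j, (h c y)⁻¹ k j * b c y j)
    ring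
  have e1 : ∑ k, codiff₂ (h c) (extDeriv₁ (b c)) y k * raiseDensity (h c) (b c) y k =
      -∑ l, ∑ i, b c y l * pderiv i (fun z => raiseExt (h c) (b c) z i l) y := by
    have : ∀ k, codiff₂ (h c) (extDeriv₁ (b c)) y k * raiseDensity (h c) (b c) y k =
        -∑ l, (density (h c) y)⁻¹ * (raiseDensity (h c) (b c) y k * h c y k l) *
          ∑ i, pderiv i (fun z => raiseExt (h c) (b c) z i l) y := by
      intro k
      rw [hco, neg_mul, Finset.mul_sum, Finset.sum_mul]
      congr 1
      exact Finset.sum_congr rfl fun l _ => by ring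
    simp only [this, Finset.sum_neg_distrib]
    rw [Finset.sum_comm]
    congr 1
    refine Finset.sum_congr rfl fun l _ => ?_
    rw [← Finset.sum_mul, ← Finset.mul_sum, hlow, inv_mul_cancel_left₀ hv.ne', Finset.mul_sum]
  have e2 : ∑ i, ∑ l, pderiv i (fun z => b c z l) y * raiseExt (h c) (b c) y i l =
      density (h c) y * (1 / 2 * ((h c y)⁻¹ * Matrix.of (extDeriv₁ (b c) y) * (h c y)⁻¹ *
            (Matrix.of (extDeriv₁ (b c) y))ᵀ).trace) := by
    have hR : ∀ i l, raiseExt (h c) (b c) y i l = density (h c) y *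
        ((h c y)⁻¹ * Matrix.of (extDeriv₁ (b c) y) * (h c y)⁻¹) i l := by
      intro i l
      rw [raiseExt]
      congr 1
      have hs : ∀ a, (h c y)⁻¹ l a = (h c y)⁻¹ a l := fun a => by
        conv_lhs => rw [← hh.inv_symm hy, Matrix.transpose_apply]
      rw [Matrix.mul_apply, Finset.sum_comm]
      refine Finset.sum_congr rfl fun a _ => ?_
      rw [Matrix.mul_apply, Finset.sum_mul]
      refine Finset.sum_congr rfl fun e _ => ?_
      rw [hs, Matrix.of_apply]
      ring
    have hanti : ∀ i l, raiseExt (h c) (b c) y i l = -raiseExt (h c) (b c) y l i := by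
      intro i l
      rw [raiseExt, raiseExt, ← mul_neg, Finset.sum_comm, ← Finset.sum_neg_distrib]
      congr 1
      refine Finset.sum_congr rfl fun a _ => ?_
      rw [← Finset.sum_neg_distrib]
      refine Finset.sum_congr rfl fun e _ => ?_
      simp only [extDeriv₁]
      ring
    have h3 : ∑ i, ∑ l, pderiv i (fun z => b c z l) y * raiseExt (h c) (b c) y i l =
        1 / 2 * ∑ i, ∑ l, extDeriv₁ (b c) y i l * raiseExt (h c) (b c) y i l := by
      have h4 : ∑ i, ∑ l, pderiv l (fun z => b c z i) y * raiseExt (h c) (b c) y i l =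
          -∑ i, ∑ l, pderiv i (fun z => b c z l) y * raiseExt (h c) (b c) y i l := by
        rw [Finset.sum_comm, ← Finset.sum_neg_distrib]
        refine Finset.sum_congr rfl fun a _ => ?_
        rw [← Finset.sum_neg_distrib]
        exact Finset.sum_congr rfl fun e _ => by rw [hanti]; ring
      simp only [extDeriv₁, sub_mul, Finset.sum_sub_distrib, h4]
      ring
    rw [h3]
    simp only [hR, Matrix.trace, Matrix.diag, Matrix.mul_apply (N := (Matrix.of _)ᵀ),
      Matrix.transpose_apply, Matrix.of_apply]
    rw [mul_left_comm, Finset.mul_sum (a := density (h c) y)]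
    congr 1
    refine Finset.sum_congr rfl fun i _ => ?_
    rw [Finset.mul_sum]
    exact Finset.sum_congr rfl fun l _ => by ring
  simp only [hodgeLaplacian, add_mul, Finset.sum_add_distrib, hW, Finset.sum_sub_distrib,
    ← Finset.mul_sum, e1, e2]
  rw [hdiv, Finset.sum_comm (f := fun i l => b c y l * _)]
  simp only [Finset.mul_sum]
  ring

section Transform

variable [IsManifold 𝓘(ℝ, Eucl 3) ∞ X] {c c' : X} {y : Eucl 3}

omit [IsManifold 𝓘(ℝ, Eucl 3) ∞ X] in
lemma raiseDensity_transform (hy : y ∈ (chart c).target)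
    (hy' : (chart c).symm y ∈ (chart (n := 3) c').source) :
    (jac c c' y).mulVec (raiseDensity (h c) (b c) y) =
      |(jac c c' y).det| • raiseDensity (h c') (b c') (trans c c' y) := by
  have e : ∀ c y, raiseDensity (h c) (b c) y = density (h c) y • ((h c y)⁻¹ *ᵥ b c y) :=
    fun c y => rfl
  rw [e, e, Matrix.mulVec_smul, hb.transform c c' y hy hy', hh.raise_transform hy hy',
    hh.density_transform hy hy', smul_smul]

/-- The codifferential of a 1-form does not depend on the chart. -/
lemma codiff_transform (hy : y ∈ (chart c).target)
    (hy' : (chart c).symm y ∈ (chart (n := 3) c').source) :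
    codiff₁ (h c) (b c) y = codiff₁ (h c') (b c') (trans c c' y) := by
  have dX : ∀ c, ∀ y ∈ (chart c).target, ∀ i,
      DifferentiableAt ℝ (fun z => raiseDensity (h c) (b c) z i) y := fun c y hy i =>
    ((hh.contDiffOn_raiseDensity hb c i).contDiffAt
      ((isOpen_target c).mem_nhds hy)).differentiableAt (by simp)
  have h0 := hh.jac_det_ne_zero hy hy'
  have hp := div_transform (F := trans c c') (W := raiseDensity (h c) (b c))
    (W' := raiseDensity (h c') (b c')) ((contDiffAt_trans hy hy').of_le ENat.LEInfty.out)
    (dX c y hy) (dX c' _ (trans_mem hy')) (by rwa [← det_jac]) (by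
      filter_upwards [eventually_overlap hy hy'] with z hz
      exact transform_of_mulVec (hh.raiseDensity_transform hb hz.1 hz.2))
  have e : ∀ c y, codiff₁ (h c) (b c) y = -((density (h c) y)⁻¹ *
      ∑ i, pderiv i (fun z => raiseDensity (h c) (b c) z i) y) := fun c y => rfl
  rw [e, e, hp, hh.density_transform hy hy', ← det_jac]
  have h1 := abs_ne_zero.2 h0
  have h2 := (hh.density_pos (trans_mem hy')).ne'
  field_simp

lemma isVectorDensity_hodgeField :
    IsVectorDensity (fun c => hodgeField (h c) (b c)) univ := by
  refine ⟨fun c i => (hh.contDiffOn_hodgeField hb c i).of_le (by norm_cast),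
    fun c y _ hy => absurd (mem_univ _) hy, fun c c' y hy hy' => ?_⟩
  refine transform_of_mulVec (X := X) ?_
  have e : ∀ c, ∀ y ∈ (chart c).target, hodgeField (h c) (b c) y =
      codiff₁ (h c) (b c) y • raiseDensity (h c) (b c) y - density (h c) y •
        ((h c y)⁻¹ *ᵥ (Matrix.of (extDeriv₁ (b c) y) *ᵥ ((h c y)⁻¹ *ᵥ b c y))) := by
    intro c y hy
    have hs : ∀ l a, (h c y)⁻¹ l a = (h c y)⁻¹ a l := fun l a => by
      conv_lhs => rw [← hh.inv_symm hy, Matrix.transpose_apply]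
    ext i
    simp only [hodgeField, Pi.sub_apply, Pi.smul_apply, smul_eq_mul, raiseExt, Matrix.mulVec,
      dotProduct, Matrix.of_apply]
    congr 1
    simp only [Finset.mul_sum]
    rw [Finset.sum_comm]
    refine Finset.sum_congr rfl fun a _ => ?_
    rw [Finset.sum_comm]
    refine Finset.sum_congr rfl fun e _ => Finset.sum_congr rfl fun l _ => ?_
    rw [hs l e]
    ring
  have hX := hh.raise_transform hy hy' (b c' (trans c c' y))
  rw [← hb.transform c c' y hy hy'] at hX
  rw [e c y hy, e c' _ (trans_mem hy'), Matrix.mulVec_sub, Matrix.mulVec_smul,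
    hh.raiseDensity_transform hb hy hy', hh.codiff_transform hb hy hy', Matrix.mulVec_smul,
    extDeriv_transform hb hy hy', ← Matrix.mulVec_mulVec (M := _ * _), hX,
    ← Matrix.mulVec_mulVec, hh.raise_transform hy hy', hh.density_transform hy hy', smul_sub,
    smul_smul, smul_smul, smul_smul, mul_comm (codiff₁ _ _ _)]

end Transform

end IsMetricFamily

/-- On a compact manifold a harmonic 1-form is closed and coclosed. The integral of
`|d^* b|² + |db|²` vanishes only when weighted with the partition of unity, so in each chart the
conclusion is drawn where the corresponding function of the partition is not zero. -/
theorem closed_coclosed_of_harmonic {L : Type*} [TopologicalSpace L] [ChartedSpace (Eucl 3) L]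
    [IsManifold 𝓘(ℝ, Eucl 3) ∞ L] [T2Space L] [SigmaCompactSpace L] [CompactSpace L]
    {h : L → Eucl 3 → Matrix (Fin 3) (Fin 3) ℝ} {b : L → Eucl 3 → Fin 3 → ℝ}
    (hh : IsMetricFamily h) (hb : IsFormFamily b)
    (hΔ : ∀ c, ∀ y ∈ (chart c).target, ∀ k, hodgeLaplacian (h c) (b c) y k = 0) {c : L}
    {y : Eucl 3} (hy : y ∈ (chart c).target) (hρ : rho c c y ≠ 0) :
    codiff₁ (h c) (b c) y = 0 ∧ ∀ i j, extDeriv₁ (b c) y i j = 0 := by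
  let e : L → Eucl 3 → ℝ := fun c y => density (h c) y * (codiff₁ (h c) (b c) y ^ 2 + 1 / 2 *
    ((h c y)⁻¹ * Matrix.of (extDeriv₁ (b c) y) * (h c y)⁻¹ *
      (Matrix.of (extDeriv₁ (b c) y))ᵀ).trace)
  have htr : ∀ c, ∀ y ∈ (chart c).target, 0 ≤ ((h c y)⁻¹ * Matrix.of (extDeriv₁ (b c) y) *
      (h c y)⁻¹ * (Matrix.of (extDeriv₁ (b c) y))ᵀ).trace := fun c y hy =>
    (tensor_norm_nonneg (hh.posDef c y hy).inv).1
  have he : ∀ c, ∀ y ∈ (chart c).target, 0 ≤ e c y := fun c y hy =>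
    mul_nonneg (hh.density_pos hy).le
      (add_nonneg (sq_nonneg _) (mul_nonneg (by norm_num) (htr c y hy)))
  have hdiv : ∀ c, ∀ y ∈ (chart c).target,
      ∑ i, pderiv i (fun z => hodgeField (h c) (b c) z i) y = -e c y := by
    intro c y hy
    have := hh.hodge_identity hb hy
    simp only [hΔ c y hy, zero_mul, Finset.sum_const_zero] at this
    rw [eq_neg_iff_add_eq_zero]
    exact this.symm
  have hint := (hh.isVectorDensity_hodgeField hb).sum_integral_div isCompact_univ
  have hcont : ∀ c, ContinuousOn (fun y => rho c c y *
      ∑ i, pderiv i (fun z => hodgeField (h c) (b c) z i) y) (chart c).target := fun c =>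
    (contDiffOn_rho c c).continuousOn.mul (continuousOn_finsetSum _ fun i _ =>
      (contDiffOn_pderiv (isOpen_target c) (hh.contDiffOn_hodgeField hb c i) i).continuousOn)
  have hnonpos : ∀ c, ∀ y ∈ (chart c).target, rho c c y *
      ∑ i, pderiv i (fun z => hodgeField (h c) (b c) z i) y ≤ 0 := by
    intro c y hy
    rw [hdiv c y hy]
    exact mul_nonpos_of_nonneg_of_nonpos (rho_nonneg _ _ _) (neg_nonpos.2 (he c y hy))
  have hc : c ∈ (finite_meets (isCompact_univ (X := L))).toFinset := by
    simp only [Finite.mem_toFinset, mem_ofPred_eq, inter_univ]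
    exact ⟨_, subset_tsupport _ hρ⟩
  have h0 := (Finset.sum_eq_zero_iff_of_nonpos fun c _ =>
    setIntegral_nonpos (isOpen_target c).measurableSet (hnonpos c)).1 hint c hc
  have hI : IntegrableOn (fun y => rho c c y *
      ∑ i, pderiv i (fun z => hodgeField (h c) (b c) z i) y) (chart c).target := by
    refine integrableOn_of_continuousOn_of_zero (isOpen_target c)
      (isCompact_chartCompact c isCompact_univ) (chartCompact_subset c univ) (hcont c)
      fun y hy hyC => ?_
    rw [mem_chartCompact hy, not_and_or] at hyC
    rcases hyC with h | h
    · rw [rho, image_eq_zero_of_notMem_tsupport h, zero_mul]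
    · exact absurd (mem_univ _) h
  have hzero := eq_zero_of_setIntegral_eq_zero (isOpen_target c) (hcont c) hI (hnonpos c) h0 hy
  have hey : e c y = 0 := by
    have h1 : rho c c y * ∑ i, pderiv i (fun z => hodgeField (h c) (b c) z i) y = 0 := hzero
    rw [hdiv c y hy] at h1
    simpa [hρ] using h1
  have h2 := (mul_eq_zero.1 hey).resolve_left (hh.density_pos hy).ne'
  have h3 := htr c y hy
  constructor
  · nlinarith [sq_nonneg (codiff₁ (h c) (b c) y)]
  · have h4 := (tensor_norm_nonneg (hh.posDef c y hy).inv).2 (le_antisymm (by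
      nlinarith [sq_nonneg (codiff₁ (h c) (b c) y)]) h3)
    intro i j
    exact congrFun (congrFun h4 i) j

end Hodge

/-! ### Pulling back the nearly Kähler forms to a parameter space -/

section Pullback

variable {M : Type*} [TopologicalSpace M] [ChartedSpace (Eucl 6) M]
  [IsManifold 𝓘(ℝ, Eucl 6) ∞ M] (S : AlmostHermitian M)
  {P : Type*} [NormedAddCommGroup P] [NormedSpace ℝ P] (f : P → M)

omit [IsManifold 𝓘(ℝ, Eucl 6) ∞ M] in
/-- The differential of a map from a normed space to `M`. -/
def dmap (z : P) : P →L[ℝ] Eucl 6 :=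
  (mfderiv 𝓘(ℝ, P) 𝓘(ℝ, Eucl 6) f z :
    TangentSpace 𝓘(ℝ, P) z →L[ℝ] TangentSpace 𝓘(ℝ, Eucl 6) (f z))

/-- The map `f` in the chart around `m`. -/
def rep (m : M) (z : P) : Eucl 6 := chart m (f z)

namespace AlmostHermitian

/-- The coefficients of the pulled back metric `f^* g`. -/
def pullG (a b z : P) : ℝ := S.gAt (f z) (dmap f z a) (dmap f z b)

/-- The coefficients of the pulled back form `f^* ω`. -/
def pullOm (a b z : P) : ℝ := S.omAt (f z) (dmap f z a) (dmap f z b)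

/-- The coefficients of the pulled back form `f^* ψ`. -/
def pullPsi (a b d z : P) : ℝ := S.psiAt (f z) (dmap f z a) (dmap f z b) (dmap f z d)

/-- The coefficients of the pullback of `ψ(J·, ·, ·)`. -/
def pullSig (a b d z : P) : ℝ :=
  S.psiAt (f z) (S.JAt (f z) (dmap f z a)) (dmap f z b) (dmap f z d)

end AlmostHermitian

variable {f} {D : Set P} (hD : IsOpen D)
  (hf : ContMDiffOn 𝓘(ℝ, P) 𝓘(ℝ, Eucl 6) ∞ f D) {z : P} (hz : z ∈ D) {m : M}
  (hm : f z ∈ (chart (n := 6) m).source)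

include hD hf hz

omit [IsManifold 𝓘(ℝ, Eucl 6) ∞ M] in
lemma mdifferentiableAt_of : MDifferentiableAt 𝓘(ℝ, P) 𝓘(ℝ, Eucl 6) f z :=
  (hf.contMDiffAt (hD.mem_nhds hz)).mdifferentiableAt (by simp)

omit [IsManifold 𝓘(ℝ, Eucl 6) ∞ M] in
lemma eventually_mem_source (hm : f z ∈ (chart (n := 6) m).source) :
    ∀ᶠ y in 𝓝 z, y ∈ D ∧ f y ∈ (chart (n := 6) m).source :=
  (hD.mem_nhds hz |> fun h => eventually_mem_set.2 h).and
    ((hf.contMDiffAt (hD.mem_nhds hz)).continuousAt.eventually ((isOpen_source m).mem_nhds hm))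

include hm

lemma contDiffAt_rep : ContDiffAt ℝ ∞ (rep f m) z :=
  ((contMDiffAt_chart hm).comp z (hf.contMDiffAt (hD.mem_nhds hz))).contDiffAt

lemma fderiv_rep (a : P) : fderiv ℝ (rep f m) z a = dchart m (f z) (dmap f z a) := by
  have h := mfderiv_comp z ((contMDiffAt_chart hm).mdifferentiableAt (by simp))
    (mdifferentiableAt_of hD hf hz)
  rw [mfderiv_eq_fderiv] at h
  with_unfolding_all exact DFunLike.congr_fun h a

namespace AlmostHermitian

variable {S}

lemma pullG_eq (a b : P) : S.pullG f a b z =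
    S.gC m (rep f m z) (fderiv ℝ (rep f m) z a) (fderiv ℝ (rep f m) z b) := by
  rw [fderiv_rep hD hf hz hm, fderiv_rep hD hf hz hm, gC_apply, rep, dsymm_dchart hm,
    dsymm_dchart hm, (chart m).left_inv hm, pullG]

lemma pullOm_eq (a b : P) : S.pullOm f a b z =
    S.omC m (rep f m z) (fderiv ℝ (rep f m) z a) (fderiv ℝ (rep f m) z b) := by
  rw [fderiv_rep hD hf hz hm, fderiv_rep hD hf hz hm, rep, S.omC_apply ((chart m).map_source hm),
    dsymm_dchart hm, dsymm_dchart hm, (chart m).left_inv hm, pullOm]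

variable (hS : S.IsStrictNearlyKahler)
include hS

lemma pullPsi_eq (a b d : P) : S.pullPsi f a b d z =
    S.psiC m (rep f m z) (fderiv ℝ (rep f m) z a) (fderiv ℝ (rep f m) z b)
      (fderiv ℝ (rep f m) z d) := by
  rw [fderiv_rep hD hf hz hm, fderiv_rep hD hf hz hm, fderiv_rep hD hf hz hm, rep,
    psiC_eq hS ((chart m).map_source hm), dsymm_dchart hm, dsymm_dchart hm, dsymm_dchart hm,
    (chart m).left_inv hm, pullPsi]

lemma pullSig_eq (a b d : P) : S.pullSig f a b d z =
    S.sigC m (rep f m z) (fderiv ℝ (rep f m) z a) (fderiv ℝ (rep f m) z b)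
      (fderiv ℝ (rep f m) z d) := by
  rw [fderiv_rep hD hf hz hm, fderiv_rep hD hf hz hm, fderiv_rep hD hf hz hm, rep,
    sigC_eq hS ((chart m).map_source hm), dsymm_dchart hm, dsymm_dchart hm, dsymm_dchart hm,
    (chart m).left_inv hm, pullSig]

omit hS hm

lemma contDiffAt_pullG (a b : P) : ContDiffAt ℝ ∞ (S.pullG f a b) z := by
  have hm := mem_extChartAt_source (I := 𝓘(ℝ, Eucl 6)) (f z)
  have hF := contDiffAt_rep hD hf hz hm
  have hF' := hF.fderiv_right (m := ∞) (by simp)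
  have hg := ((S.contDiffOn_gC (f z)).contDiffAt ((isOpen_target (f z)).mem_nhds
    ((chart (f z)).map_source hm))).comp z hF
  refine ((hg.clm_apply (hF'.clm_apply (contDiffAt_const (c := a)))).clm_apply
    (hF'.clm_apply (contDiffAt_const (c := b)))).congr_of_eventuallyEq ?_
  filter_upwards [eventually_mem_source hD hf hz hm] with y hy
  exact pullG_eq hD hf hy.1 hy.2 a b

include hS

lemma contDiffAt_pullOm (a b : P) : ContDiffAt ℝ ∞ (S.pullOm f a b) z := by
  have hm := mem_extChartAt_source (I := 𝓘(ℝ, Eucl 6)) (f z)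
  have hF := contDiffAt_rep hD hf hz hm
  have hF' := hF.fderiv_right (m := ∞) (by simp)
  have hg := ((hS.localNK (f z)).contDiffAt_omegaL ((chart (f z)).map_source hm)).comp z hF
  refine ((hg.clm_apply (hF'.clm_apply (contDiffAt_const (c := a)))).clm_apply
    (hF'.clm_apply (contDiffAt_const (c := b)))).congr_of_eventuallyEq ?_
  filter_upwards [eventually_mem_source hD hf hz hm] with y hy
  exact pullOm_eq hD hf hy.1 hy.2 a b

lemma contDiffAt_pullPsi (a b d : P) : ContDiffAt ℝ ∞ (S.pullPsi f a b d) z := by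
  have hm := mem_extChartAt_source (I := 𝓘(ℝ, Eucl 6)) (f z)
  have hF := contDiffAt_rep hD hf hz hm
  have hF' := hF.fderiv_right (m := ∞) (by simp)
  have hg := ((hS.localNK (f z)).contDiffAt_psiL ((chart (f z)).map_source hm)).comp z hF
  refine (((hg.clm_apply (hF'.clm_apply (contDiffAt_const (c := a)))).clm_apply
    (hF'.clm_apply (contDiffAt_const (c := b)))).clm_apply
    (hF'.clm_apply (contDiffAt_const (c := d)))).congr_of_eventuallyEq ?_
  filter_upwards [eventually_mem_source hD hf hz hm] with y hy
  exact pullPsi_eq hD hf hy.1 hy.2 hS a b d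

lemma contDiffAt_pullSig (a b d : P) : ContDiffAt ℝ ∞ (S.pullSig f a b d) z := by
  have hm := mem_extChartAt_source (I := 𝓘(ℝ, Eucl 6)) (f z)
  have hF := contDiffAt_rep hD hf hz hm
  have hF' := hF.fderiv_right (m := ∞) (by simp)
  have hg := ((hS.localNK (f z)).contDiffAt_sigmaL ((chart (f z)).map_source hm)).comp z hF
  refine (((hg.clm_apply (hF'.clm_apply (contDiffAt_const (c := a)))).clm_apply
    (hF'.clm_apply (contDiffAt_const (c := b)))).clm_apply
    (hF'.clm_apply (contDiffAt_const (c := d)))).congr_of_eventuallyEq ?_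
  filter_upwards [eventually_mem_source hD hf hz hm] with y hy
  exact pullSig_eq hD hf hy.1 hy.2 hS a b d

/-- The structure equation `dω = 3 ψ`, pulled back. -/
lemma deriv_pullOm (a b d : P) :
    fderiv ℝ (S.pullOm f b d) z a + fderiv ℝ (S.pullOm f d a) z b + fderiv ℝ (S.pullOm f a b) z d =
      3 * S.pullPsi f a b d z := by
  have hm := mem_extChartAt_source (I := 𝓘(ℝ, Eucl 6)) (f z)
  have hy := (chart (f z)).map_source hm
  have H := hS.localNK (f z)
  have e : ∀ b d, S.pullOm f b d =ᶠ[𝓝 z] fun y => S.omC (f z) (rep f (f z) y)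
      (fderiv ℝ (rep f (f z)) y b) (fderiv ℝ (rep f (f z)) y d) := fun b d => by
    filter_upwards [eventually_mem_source hD hf hz hm] with y hy
    exact pullOm_eq hD hf hy.1 hy.2 b d
  have h := dTwo_pullback (F := rep f (f z)) (z := z)
    ((H.contDiffAt_omegaL hy).differentiableAt (by simp))
    ((contDiffAt_rep hD hf hz hm).of_le ENat.LEInfty.out) (H.omegaL_skew hy) a b d
  rw [(e b d).fderiv_eq, (e d a).fderiv_eq, (e a b).fderiv_eq, h, pullPsi_eq hD hf hz hm hS, psiC,
    psiL_apply]
  ring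

/-- The structure equation `d(ψ(J·, ·, ·)) = 4 k² (ω ∧ ω / 2)`, pulled back. -/
lemma deriv_pullSig (a b c d : P) :
    fderiv ℝ (S.pullSig f b c d) z a - fderiv ℝ (S.pullSig f a c d) z b
      + fderiv ℝ (S.pullSig f a b d) z c - fderiv ℝ (S.pullSig f a b c) z d =
      4 * nrm S (f z) ^ 2 * (S.pullOm f a b z * S.pullOm f c d z
        - S.pullOm f a c z * S.pullOm f b d z + S.pullOm f a d z * S.pullOm f b c z) := by
  have hm := mem_extChartAt_source (I := 𝓘(ℝ, Eucl 6)) (f z)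
  have hy := (chart (f z)).map_source hm
  have H := hS.localNK (f z)
  have e : ∀ b c d, S.pullSig f b c d =ᶠ[𝓝 z] fun y => S.sigC (f z) (rep f (f z) y)
      (fderiv ℝ (rep f (f z)) y b) (fderiv ℝ (rep f (f z)) y c)
      (fderiv ℝ (rep f (f z)) y d) := fun b c d => by
    filter_upwards [eventually_mem_source hD hf hz hm] with y hy
    exact pullSig_eq hD hf hy.1 hy.2 hS b c d
  have h := dThree_pullback (F := rep f (f z)) (z := z)
    ((H.contDiffAt_sigmaL hy).differentiableAt (by simp))
    ((contDiffAt_rep hD hf hz hm).of_le ENat.LEInfty.out) (H.isPureForm_sigma_alt₁ hy)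
    (H.isPureForm_sigma_alt₂ hy) a b c d
  have h2 := (structure_eqs hS hy).2.self_of_nhds.2.2.2
  rw [(chart (f z)).left_inv hm] at h2
  rw [(e b c d).fderiv_eq, (e a c d).fderiv_eq, (e a b d).fderiv_eq, (e a b c).fderiv_eq, h]
  refine (h2 _ _ _ _).trans ?_
  simp only [pullOm_eq hD hf hz hm]
  rfl

lemma eventually_nrm_eq : ∀ᶠ y in 𝓝 z, nrm S (f y) = nrm S (f z) := by
  have hm := mem_extChartAt_source (I := 𝓘(ℝ, Eucl 6)) (f z)
  have h := (structure_eqs hS ((chart (f z)).map_source hm)).2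
  have h2 := (contDiffAt_rep hD hf hz hm).continuousAt.eventually h
  filter_upwards [h2, eventually_mem_source hD hf hz hm] with y hy hy'
  have := hy.2.1
  rwa [rep, (chart (f z)).left_inv hy'.2, (chart (f z)).left_inv hm] at this

/-- The Hermitian Gram determinant formula, pulled back. -/
lemma pull_norm (a b d : P) :
    S.pullPsi f a b d z ^ 2 + S.pullSig f a b d z ^ 2 = nrm S (f z) ^ 2 *
      hermGram (S.gAt (f z)) (S.JAt (f z)) (dmap f z a) (dmap f z b) (dmap f z d) := by
  have hm := mem_extChartAt_source (I := 𝓘(ℝ, Eucl 6)) (f z)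
  have hy := (chart (f z)).map_source hm
  have h := (structure_eqs hS hy).2.self_of_nhds.2.2.1 (dchart (f z) (f z) (dmap f z a))
    (dchart (f z) (f z) (dmap f z b)) (dchart (f z) (f z) (dmap f z d))
  rw [hermGram_chart hy, dsymm_dchart hm, dsymm_dchart hm, dsymm_dchart hm,
    (chart (f z)).left_inv hm] at h
  rw [← h, pullPsi_eq hD hf hz hm hS, pullSig_eq hD hf hz hm hS, fderiv_rep hD hf hz hm,
    fderiv_rep hD hf hz hm, fderiv_rep hD hf hz hm]
  rfl

end AlmostHermitian

end Pullback

/-! ### Two-parameter families of maps in the charts of the source -/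

/-- The space of two parameters and a point in a chart of the 3-manifold. -/
abbrev Param : Type := ℝ × ℝ × Eucl 3

/-- The direction of the first parameter. -/
def eS : Param := (1, 0, 0)

/-- The direction of the second parameter. -/
def eT : Param := (0, 1, 0)

/-- The direction of the `i`-th coordinate of the chart. -/
def eX (i : Fin 3) : Param := (0, 0, EuclideanSpace.single i 1)

section Family

variable {M : Type*} [TopologicalSpace M] [ChartedSpace (Eucl 6) M]
  {L : Type*} [TopologicalSpace L] [ChartedSpace (Eucl 3) L]

/-- The map `(s, t, y) ↦ φ_{s,t}(y)`, with `y` in the chart around `c`. -/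
def lift (φ : ℝ → ℝ → L → M) (c : L) (z : Param) : M := φ z.1 z.2.1 ((chart c).symm z.2.2)

/-- The domain of the family in the chart around `c`. -/
def liftDom (ε : ℝ) (c : L) : Set Param := Ioo (-ε) ε ×ˢ Ioo (-ε) ε ×ˢ (chart c).target

/-- A smooth two-parameter family of maps, defined for small parameters. -/
def IsFamily (φ : ℝ → ℝ → L → M) (ε : ℝ) : Prop :=
  ContMDiffOn (𝓘(ℝ, ℝ).prod (𝓘(ℝ, ℝ).prod 𝓘(ℝ, Eucl 3))) 𝓘(ℝ, Eucl 6) ∞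
      (fun p : ℝ × ℝ × L => φ p.1 p.2.1 p.2.2) (Ioo (-ε) ε ×ˢ Ioo (-ε) ε ×ˢ univ)

lemma isOpen_liftDom (ε : ℝ) (c : L) : IsOpen (liftDom ε c) :=
  isOpen_Ioo.prod (isOpen_Ioo.prod (isOpen_target c))

lemma mem_liftDom {ε : ℝ} (hε : 0 < ε) {c : L} {y : Eucl 3} (hy : y ∈ (chart c).target) :
    ((0, 0, y) : Param) ∈ liftDom ε c := by
  have h0 : (0 : ℝ) ∈ Ioo (-ε) ε := ⟨by linarith, hε⟩
  exact ⟨h0, h0, hy⟩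

variable [IsManifold 𝓘(ℝ, Eucl 3) ∞ L]
  {φ : ℝ → ℝ → L → M} {ε : ℝ}

lemma IsFamily.contMDiffOn_lift (hφ : IsFamily φ ε) (c : L) :
    ContMDiffOn 𝓘(ℝ, Param) 𝓘(ℝ, Eucl 6) ∞ (lift φ c) (liftDom ε c) := by
  intro z hz
  have h1 : ContMDiffAt 𝓘(ℝ, Param) 𝓘(ℝ, ℝ) ∞ (fun z : Param => z.1) z :=
    contDiffAt_fst.contMDiffAt
  have h2 : ContMDiffAt 𝓘(ℝ, Param) 𝓘(ℝ, ℝ) ∞ (fun z : Param => z.2.1) z :=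
    (contDiffAt_fst.comp z contDiffAt_snd).contMDiffAt
  have h3' : ContMDiffAt 𝓘(ℝ, Param) 𝓘(ℝ, Eucl 3) ∞ (fun z : Param => z.2.2) z :=
    (contDiffAt_snd.comp z contDiffAt_snd).contMDiffAt
  have h3 : ContMDiffAt 𝓘(ℝ, Param) 𝓘(ℝ, Eucl 3) ∞
      (fun z : Param => (chart c).symm z.2.2) z :=
    ContMDiffAt.comp z (contMDiffAt_symm hz.2.2) h3'
  have h4 := h1.prodMk (h2.prodMk h3)
  have hopen : IsOpen (Ioo (-ε) ε ×ˢ Ioo (-ε) ε ×ˢ (univ : Set L)) :=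
    isOpen_Ioo.prod (isOpen_Ioo.prod isOpen_univ)
  have h5 := ContMDiffOn.contMDiffAt hφ (hopen.mem_nhds
    (show (z.1, z.2.1, (chart c).symm z.2.2) ∈ _ from ⟨hz.1, hz.2.1, mem_univ _⟩))
  exact (ContMDiffAt.comp z h5 h4).contMDiffWithinAt

/-- The differential of `f` in the direction `a` is the velocity of the curve `r ↦ f(z + r a)`. -/
lemma dmap_eq_curve {P : Type*} [NormedAddCommGroup P] [NormedSpace ℝ P] {f : P → M} {D : Set P}
    (hD : IsOpen D) (hf : ContMDiffOn 𝓘(ℝ, P) 𝓘(ℝ, Eucl 6) ∞ f D) {z : P} (hz : z ∈ D) (a : P) :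
    dmap f z a =
      (mfderiv 𝓘(ℝ, ℝ) 𝓘(ℝ, Eucl 6) (fun r : ℝ => f (z + r • a)) 0 (1 : ℝ) : Eucl 6) := by
  have hc : HasFDerivAt (fun r : ℝ => z + r • a) ((1 : ℝ →L[ℝ] ℝ).smulRight a) 0 := by
    exact ((hasFDerivAt_id (𝕜 := ℝ) (0 : ℝ)).smul_const a).const_add z
  have h0 : z + (0 : ℝ) • a = z := by simp
  have h1 : MDifferentiableAt 𝓘(ℝ, P) 𝓘(ℝ, Eucl 6) f (z + (0 : ℝ) • a) := by
    rw [h0]; exact mdifferentiableAt_of hD hf hz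
  have h := mfderiv_comp (0 : ℝ) h1 hc.differentiableAt.mdifferentiableAt
  rw [mfderiv_eq_fderiv, hc.fderiv] at h
  have h2 : dmap f (z + (0 : ℝ) • a) a =
      (mfderiv 𝓘(ℝ, ℝ) 𝓘(ℝ, Eucl 6) (f ∘ fun r : ℝ => z + r • a) 0 (1 : ℝ) : Eucl 6) := by
    have h3 := DFunLike.congr_fun h (1 : ℝ)
    refine Eq.trans ?_ h3.symm
    have : ((1 : ℝ →L[ℝ] ℝ).smulRight a) (1 : ℝ) = a := by simp
    with_unfolding_all exact congrArg (dmap f (z + (0 : ℝ) • a)) this.symm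
  rw [h0] at h2
  exact h2

/-- The differential of `φ_{s,t}` in the chart. -/
lemma IsFamily.diff_eq (hφ : IsFamily φ ε) {c : L} {s t : ℝ} {y : Eucl 3}
    (hz : ((s, t, y) : Param) ∈ liftDom ε c) (v : Eucl 3) :
    (diff (φ s t) ((chart c).symm y) (dsymm c y v) : Eucl 6) =
      dmap (lift φ c) (s, t, y) (0, 0, v) := by
  have hj : HasFDerivAt (fun y : Eucl 3 => ((s, t, y) : Param))
      ((0 : Eucl 3 →L[ℝ] ℝ).prod ((0 : Eucl 3 →L[ℝ] ℝ).prod (.id ℝ (Eucl 3)))) y :=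
    (hasFDerivAt_const s y).prodMk ((hasFDerivAt_const t y).prodMk (hasFDerivAt_id y))
  have h1 := mfderiv_comp y
    (mdifferentiableAt_of (isOpen_liftDom ε c) (hφ.contMDiffOn_lift c) hz)
    hj.differentiableAt.mdifferentiableAt
  rw [mfderiv_eq_fderiv, hj.fderiv] at h1
  have hs : MDifferentiableAt 𝓘(ℝ, Eucl 3) 𝓘(ℝ, Eucl 6) (φ s t) ((chart c).symm y) := by
    have hopen : IsOpen (Ioo (-ε) ε ×ˢ Ioo (-ε) ε ×ˢ (univ : Set L)) :=
      isOpen_Ioo.prod (isOpen_Ioo.prod isOpen_univ)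
    have h5 := ContMDiffOn.contMDiffAt hφ (hopen.mem_nhds
      (show (s, t, (chart c).symm y) ∈ _ from ⟨hz.1, hz.2.1, mem_univ _⟩))
    have h6 : ContMDiffAt 𝓘(ℝ, Eucl 3) (𝓘(ℝ, ℝ).prod (𝓘(ℝ, ℝ).prod 𝓘(ℝ, Eucl 3))) ∞
        (fun x : L => (s, t, x)) ((chart c).symm y) :=
      contMDiffAt_const.prodMk (contMDiffAt_const.prodMk contMDiffAt_id)
    exact (ContMDiffAt.comp ((chart c).symm y) h5 h6).mdifferentiableAt (by simp)
  have h2 := mfderiv_comp y hs ((contMDiffAt_symm hz.2.2).mdifferentiableAt (by simp))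
  have h3 : (φ s t) ∘ (chart c).symm = lift φ c ∘ fun y : Eucl 3 => ((s, t, y) : Param) := rfl
  rw [h3, h1] at h2
  have h4 := DFunLike.congr_fun h2 v
  with_unfolding_all exact h4.symm

/-- The differentials of the family in two charts. -/
lemma IsFamily.dmap_trans (hφ : IsFamily φ ε) {c c' : L} {s t : ℝ} {y : Eucl 3}
    (hz : ((s, t, y) : Param) ∈ liftDom ε c)
    (hy' : (chart c).symm y ∈ (chart (n := 3) c').source) (a b : ℝ) (v : Eucl 3) :
    dmap (lift φ c) (s, t, y) (a, b, v) =
      dmap (lift φ c') (s, t, trans c c' y) (a, b, fderiv ℝ (trans c c') y v) := by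
  have hτ := ((contDiffAt_trans hz.2.2 hy').differentiableAt (by simp)).hasFDerivAt
  have hj : HasFDerivAt (fun z : Param => ((z.1, z.2.1, trans c c' z.2.2) : Param))
      ((ContinuousLinearMap.fst ℝ ℝ (ℝ × Eucl 3)).prod
        (((ContinuousLinearMap.fst ℝ ℝ (Eucl 3)).comp
          (ContinuousLinearMap.snd ℝ ℝ (ℝ × Eucl 3))).prod
        ((fderiv ℝ (trans c c') y).comp ((ContinuousLinearMap.snd ℝ ℝ (Eucl 3)).comp
          (ContinuousLinearMap.snd ℝ ℝ (ℝ × Eucl 3)))))) (s, t, y) := by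
    refine hasFDerivAt_fst.prodMk ((hasFDerivAt_fst.comp _ hasFDerivAt_snd).prodMk ?_)
    exact HasFDerivAt.comp (s, t, y) hτ (hasFDerivAt_snd.comp _ hasFDerivAt_snd)
  have hz' : ((s, t, trans c c' y) : Param) ∈ liftDom ε c' := ⟨hz.1, hz.2.1, trans_mem hy'⟩
  have h1 := mfderiv_comp (s, t, y)
    (mdifferentiableAt_of (isOpen_liftDom ε c') (hφ.contMDiffOn_lift c') hz')
    hj.differentiableAt.mdifferentiableAt
  rw [mfderiv_eq_fderiv, hj.fderiv] at h1
  have he : lift φ c =ᶠ[𝓝 ((s, t, y) : Param)]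
      lift φ c' ∘ fun z : Param => ((z.1, z.2.1, trans c c' z.2.2) : Param) := by
    have hc : ContinuousAt (fun z : Param => z.2.2) (s, t, y) := by fun_prop
    filter_upwards [hc.eventually (eventually_overlap hz.2.2 hy')] with z hz
    simp only [lift, Function.comp_apply, symm_trans hz.2]
  have h2 := he.mfderiv_eq (I := 𝓘(ℝ, Param)) (I' := 𝓘(ℝ, Eucl 6))
  have h3 : dmap (lift φ c) (s, t, y) (a, b, v) =
      dmap (lift φ c' ∘ fun z : Param => ((z.1, z.2.1, trans c c' z.2.2) : Param)) (s, t, y)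
        (a, b, v) := by
    with_unfolding_all exact DFunLike.congr_fun h2 (a, b, v)
  rw [h3]
  with_unfolding_all exact DFunLike.congr_fun h1 (a, b, v)

end Family

/-! ### The second variation of the volume density -/

/-- The partial derivative in the `i`-th coordinate, for fixed values of the two parameters. -/
lemma fderiv_eX {f : Param → ℝ} {s t : ℝ} {y : Eucl 3}
    (hf : DifferentiableAt ℝ f (s, t, y)) (i : Fin 3) :
    fderiv ℝ f (s, t, y) (eX i) = pderiv i (fun y => f (s, t, y)) y := by
  have hj : HasFDerivAt (fun y : Eucl 3 => ((s, t, y) : Param))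
      ((0 : Eucl 3 →L[ℝ] ℝ).prod ((0 : Eucl 3 →L[ℝ] ℝ).prod (.id ℝ (Eucl 3)))) y :=
    (hasFDerivAt_const s y).prodMk ((hasFDerivAt_const t y).prodMk (hasFDerivAt_id y))
  have h := (hf.hasFDerivAt.comp y hj).fderiv
  have h2 := DFunLike.congr_fun h (EuclideanSpace.single i 1)
  exact h2.symm

section Family

variable {M : Type*} [TopologicalSpace M] [ChartedSpace (Eucl 6) M]
  [IsManifold 𝓘(ℝ, Eucl 6) ∞ M] (S : AlmostHermitian M)
  {L : Type*} [TopologicalSpace L] [ChartedSpace (Eucl 3) L]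

/-- The Gram determinant of a family. -/
def famQ (φ : ℝ → ℝ → L → M) (c : L) (z : Param) : ℝ :=
  (Matrix.of fun i j => S.pullG (lift φ c) (eX i) (eX j) z).det

/-- The volume density of a family. -/
def famVol (φ : ℝ → ℝ → L → M) (c : L) (z : Param) : ℝ := √(famQ S φ c z)

/-- The component of `ψ` on the 3-manifold. -/
def famP (φ : ℝ → ℝ → L → M) (c : L) : Param → ℝ := S.pullPsi (lift φ c) (eX 0) (eX 1) (eX 2)

/-- The component of `ψ(J·, ·, ·)` on the 3-manifold. -/
def famSig (φ : ℝ → ℝ → L → M) (c : L) : Param → ℝ := S.pullSig (lift φ c) (eX 0) (eX 1) (eX 2)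

/-- The components of `ω` on the 3-manifold, as a vector. -/
def famW (φ : ℝ → ℝ → L → M) (c : L) (i : Fin 3) : Param → ℝ :=
  S.pullOm (lift φ c) (eX (i + 1)) (eX (i + 2))

/-- The components of the 2-form obtained by contracting `ψ(J·, ·, ·)` with the second variation
field, as a vector. -/
def famT (φ : ℝ → ℝ → L → M) (c : L) (i : Fin 3) : Param → ℝ :=
  S.pullSig (lift φ c) eT (eX (i + 1)) (eX (i + 2))

/-- The factor `κ = ± 1 / k` relating `ψ(J·, ·, ·)` to the volume density of a Lagrangian
submanifold. The sign depends on the orientation of the chart, so no orientation is needed. -/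
def famKappa (φ : ℝ → ℝ → L → M) (c : L) (y : Eucl 3) : ℝ :=
  ((SignType.sign (famSig S φ c (0, 0, y)) : SignType) : ℝ) / S.nrm (lift φ c (0, 0, y))

/-- The part of the second variation of the volume density which is not a divergence. -/
def hessRest (φ : ℝ → ℝ → L → M) (c : L) (y : Eucl 3) : ℝ :=
  4 * famKappa S φ c y * S.nrm (lift φ c (0, 0, y)) ^ 2 *
    ∑ i, S.pullOm (lift φ c) eT (eX i) (0, 0, y) * fderiv ℝ (famW S φ c i) (0, 0, y) eS
  + fderiv ℝ (famP S φ c) (0, 0, y) eS * fderiv ℝ (famP S φ c) (0, 0, y) eT /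
      (S.nrm (lift φ c (0, 0, y)) ^ 2 * famVol S φ c (0, 0, y))
  + ∑ i, ∑ j, (fderiv ℝ (famW S φ c i) (0, 0, y) eS * fderiv ℝ (famW S φ c j) (0, 0, y) eT +
      fderiv ℝ (famW S φ c i) (0, 0, y) eT * fderiv ℝ (famW S φ c j) (0, 0, y) eS) *
      S.pullG (lift φ c) (eX i) (eX j) (0, 0, y) / (2 * famVol S φ c (0, 0, y))

lemma posDef_inducedMetric {f : L → M} [IsManifold 𝓘(ℝ, Eucl 3) ∞ L]
    (hf : ∀ x, Function.Injective (diff f x)) {c : L} {y : Eucl 3} (hy : y ∈ (chart c).target) :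
    (inducedMetric S f c y).PosDef := by
  refine Matrix.PosDef.of_dotProduct_mulVec_pos ?_ fun x hx => ?_
  · ext i j
    simp only [Matrix.conjTranspose_apply, star_trivial, inducedMetric, Matrix.of_apply]
    exact S.metric.symm _ _ _
  · set u : Eucl 3 := ∑ i, x i • EuclideanSpace.single i (1 : ℝ) with hu
    have hu0 : u ≠ 0 := by
      intro h0
      apply hx
      ext i
      have := congrArg (fun v : Eucl 3 => v i) h0
      simpa only [hu, sum_single_apply, PiLp.zero_apply, Pi.zero_apply] using this
    let A : Eucl 3 →L[ℝ] Eucl 6 := diff f ((chart c).symm y)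
    have hA : A (dsymm c y u) ≠ 0 := by
      intro h0
      have h1 : dsymm c y u = 0 := hf ((chart c).symm y) (h0.trans (map_zero A).symm)
      exact hu0 (by rw [← dchart_dsymm hy u, h1, map_zero])
    have hpos := (S.isHermitianPair_at (f ((chart c).symm y))).pos _ hA
    have e : S.gAt (f ((chart c).symm y)) (A (dsymm c y u)) (A (dsymm c y u)) =
        star x ⬝ᵥ (inducedMetric S f c y).mulVec x := by
      rw [hu]
      simp only [map_sum, map_smul, _root_.sum_apply, _root_.smul_apply, smul_eq_mul, dotProduct,
        Matrix.mulVec, Finset.mul_sum, star_trivial, Pi.star_apply]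
      rw [Finset.sum_comm]
      refine Finset.sum_congr rfl fun i _ => Finset.sum_congr rfl fun j _ => ?_
      change _ = x i * (S.gAt (f ((chart c).symm y)) (A (dsymm c y (EuclideanSpace.single i 1)))
        (A (dsymm c y (EuclideanSpace.single j 1))) * x j)
      ring
    rwa [e] at hpos

variable [IsManifold 𝓘(ℝ, Eucl 3) ∞ L] {φ : ℝ → ℝ → L → M} {ε : ℝ} (hφ : IsFamily φ ε)
include hφ

lemma inducedMetric_eq {c : L} {s t : ℝ} {y : Eucl 3} (hz : ((s, t, y) : Param) ∈ liftDom ε c)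
    (i j : Fin 3) :
    inducedMetric S (φ s t) c y i j = S.pullG (lift φ c) (eX i) (eX j) (s, t, y) := by
  have hi := hφ.diff_eq hz (EuclideanSpace.single i 1)
  have hj := hφ.diff_eq hz (EuclideanSpace.single j 1)
  rw [AlmostHermitian.pullG, eX, eX, ← hi, ← hj]
  rfl

lemma density_eq_famVol {c : L} {s t : ℝ} {y : Eucl 3} (hz : ((s, t, y) : Param) ∈ liftDom ε c) :
    density (inducedMetric S (φ s t) c) y = famVol S φ c (s, t, y) := by
  rw [density, famVol, famQ]
  congr 2
  ext i j
  exact inducedMetric_eq S hφ hz i j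

lemma contDiffAt_famG {c : L} {z : Param} (hz : z ∈ liftDom ε c) (a b : Param) :
    ContDiffAt ℝ ∞ (S.pullG (lift φ c) a b) z :=
  AlmostHermitian.contDiffAt_pullG (isOpen_liftDom ε c) (hφ.contMDiffOn_lift c) hz a b

lemma contDiffAt_famQ {c : L} {z : Param} (hz : z ∈ liftDom ε c) :
    ContDiffAt ℝ ∞ (famQ S φ c) z := by
  have h := fun i j => contDiffAt_famG S hφ hz (eX i) (eX j)
  unfold famQ
  simp only [Matrix.det_fin_three, Matrix.of_apply]
  exact (((((((h 0 0).mul (h 1 1)).mul (h 2 2)).sub (((h 0 0).mul (h 1 2)).mul (h 2 1))).sub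
    (((h 0 1).mul (h 1 0)).mul (h 2 2))).add (((h 0 1).mul (h 1 2)).mul (h 2 0))).add
    (((h 0 2).mul (h 1 0)).mul (h 2 1))).sub (((h 0 2).mul (h 1 1)).mul (h 2 0))

lemma contDiffAt_famVol {c : L} {z : Param} (hz : z ∈ liftDom ε c) (h0 : 0 < famQ S φ c z) :
    ContDiffAt ℝ ∞ (famVol S φ c) z := (contDiffAt_famQ S hφ hz).sqrt h0.ne'

section Base

variable (hε : 0 < ε) (hL : IsLagrangianImmersion S (φ 0 0)) {c : L} {y : Eucl 3}
  (hy : y ∈ (chart c).target)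
include hε hy

include hL

lemma famQ_pos : 0 < famQ S φ c (0, 0, y) := by
  have h := (posDef_inducedMetric S (f := φ 0 0) hL.immersive hy).det_pos
  have e : inducedMetric S (φ 0 0) c y =
      Matrix.of fun i j => S.pullG (lift φ c) (eX i) (eX j) (0, 0, y) := by
    ext i j
    exact inducedMetric_eq S hφ (mem_liftDom hε hy) i j
  rwa [e] at h

lemma pullOm_base (i j : Fin 3) : S.pullOm (lift φ c) (eX i) (eX j) (0, 0, y) = 0 := by
  have h := hL.isotropic ((chart c).symm y) (dsymm c y (EuclideanSpace.single i 1))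
    (dsymm c y (EuclideanSpace.single j 1))
  have hi := hφ.diff_eq (mem_liftDom hε hy) (EuclideanSpace.single i 1)
  have hj := hφ.diff_eq (mem_liftDom hε hy) (EuclideanSpace.single j 1)
  rw [AlmostHermitian.pullOm, eX, eX, ← hi, ← hj]
  exact h

omit hε hL hy

/-- The Hermitian Gram determinant of the three coordinate vectors, in terms of the real one. -/
lemma famNorm (hS : S.IsStrictNearlyKahler) {z : Param} (hz : z ∈ liftDom ε c) :
    S.nrm (lift φ c z) ^ 2 * famQ S φ c z = famP S φ c z ^ 2 + famSig S φ c z ^ 2 +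
      S.nrm (lift φ c z) ^ 2 * ∑ i, ∑ j, famW S φ c i z * famW S φ c j z *
        S.pullG (lift φ c) (eX i) (eX j) z := by
  have h := AlmostHermitian.pull_norm (isOpen_liftDom ε c) (hφ.contMDiffOn_lift c) hz hS
    (eX 0) (eX 1) (eX 2)
  have hs : ∀ a b, S.pullG (lift φ c) a b z = S.pullG (lift φ c) b a z := fun a b =>
    (S.isHermitianPair_at _).symm _ _
  rw [famP, famSig, h, famQ, Matrix.det_fin_three, hermGram]
  simp only [Fin.sum_univ_three, Matrix.of_apply, famW, Fin.isValue, zero_add, Fin.reduceAdd]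
  rw [hs (eX 1) (eX 0), hs (eX 2) (eX 0), hs (eX 2) (eX 1)]
  simp only [AlmostHermitian.pullG, AlmostHermitian.pullOm, AlmostHermitian.omAt]
  ring

/-- `dω = 3 ψ` on the 3-manifold. -/
lemma three_famP (hS : S.IsStrictNearlyKahler) {z : Param} (hz : z ∈ liftDom ε c) :
    3 * famP S φ c z = ∑ i, fderiv ℝ (famW S φ c i) z (eX i) := by
  have h := AlmostHermitian.deriv_pullOm (isOpen_liftDom ε c) (hφ.contMDiffOn_lift c) hz hS
    (eX 0) (eX 1) (eX 2)
  rw [famP, ← h, Fin.sum_univ_three]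
  rfl

omit [IsManifold 𝓘(ℝ, Eucl 3) ∞ L] hφ in
lemma pullSig_swap (hS : S.IsStrictNearlyKahler) (a b d : Param) (z : Param) :
    S.pullSig (lift φ c) a b d z = -S.pullSig (lift φ c) a d b z := by
  rw [AlmostHermitian.pullSig, AlmostHermitian.pullSig, ← AlmostHermitian.psiForm_apply,
    ← AlmostHermitian.psiForm_apply, (AlmostHermitian.isPureForm_at hS _).alt₂]

omit [IsManifold 𝓘(ℝ, Eucl 3) ∞ L] hφ in
lemma pullOm_swap (a b : Param) (z : Param) :
    S.pullOm (lift φ c) a b z = -S.pullOm (lift φ c) b a z := by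
  have h := S.isHermitianPair_at (lift φ c z)
  rw [AlmostHermitian.pullOm, AlmostHermitian.pullOm, AlmostHermitian.omAt, AlmostHermitian.omAt,
    h.skew, h.symm]

/-- The first variation of `ψ(J·, ·, ·)` on the 3-manifold. -/
lemma fderiv_famSig (hS : S.IsStrictNearlyKahler) {z : Param} (hz : z ∈ liftDom ε c) :
    fderiv ℝ (famSig S φ c) z eT = ∑ i, fderiv ℝ (famT S φ c i) z (eX i) +
      4 * S.nrm (lift φ c z) ^ 2 * ∑ i, S.pullOm (lift φ c) eT (eX i) z * famW S φ c i z := by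
  have h := AlmostHermitian.deriv_pullSig (isOpen_liftDom ε c) (hφ.contMDiffOn_lift c) hz hS
    eT (eX 0) (eX 1) (eX 2)
  have e1 : famT S φ c 1 = fun z => -S.pullSig (lift φ c) eT (eX 0) (eX 2) z := by
    ext z
    exact pullSig_swap S hS _ _ _ z
  have e2 : famW S φ c 1 z = -S.pullOm (lift φ c) (eX 0) (eX 2) z := pullOm_swap S _ _ _
  rw [Fin.sum_univ_three, Fin.sum_univ_three, e1, e2, fderiv_fun_neg]
  simp only [_root_.neg_apply]
  have e0 : famT S φ c 0 = S.pullSig (lift φ c) eT (eX 1) (eX 2) := rfl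
  have e3 : famT S φ c 2 = S.pullSig (lift φ c) eT (eX 0) (eX 1) := rfl
  have e4 : famW S φ c 0 z = S.pullOm (lift φ c) (eX 1) (eX 2) z := rfl
  have e5 : famW S φ c 2 z = S.pullOm (lift φ c) (eX 0) (eX 1) z := rfl
  rw [e0, e3, e4, e5, famSig]
  linear_combination h

lemma contDiffAt_famW (hS : S.IsStrictNearlyKahler) {z : Param} (hz : z ∈ liftDom ε c)
    (i : Fin 3) : ContDiffAt ℝ ∞ (famW S φ c i) z :=
  AlmostHermitian.contDiffAt_pullOm (isOpen_liftDom ε c) (hφ.contMDiffOn_lift c) hz hS _ _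

lemma contDiffAt_famT (hS : S.IsStrictNearlyKahler) {z : Param} (hz : z ∈ liftDom ε c)
    (i : Fin 3) : ContDiffAt ℝ ∞ (famT S φ c i) z :=
  AlmostHermitian.contDiffAt_pullSig (isOpen_liftDom ε c) (hφ.contMDiffOn_lift c) hz hS _ _ _

lemma contDiffAt_famSig (hS : S.IsStrictNearlyKahler) {z : Param} (hz : z ∈ liftDom ε c) :
    ContDiffAt ℝ ∞ (famSig S φ c) z :=
  AlmostHermitian.contDiffAt_pullSig (isOpen_liftDom ε c) (hφ.contMDiffOn_lift c) hz hS _ _ _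

lemma contDiffAt_famP (hS : S.IsStrictNearlyKahler) {z : Param} (hz : z ∈ liftDom ε c) :
    ContDiffAt ℝ ∞ (famP S φ c) z :=
  AlmostHermitian.contDiffAt_pullPsi (isOpen_liftDom ε c) (hφ.contMDiffOn_lift c) hz hS _ _ _

include hL hy hε

lemma famW_base (i : Fin 3) : famW S φ c i (0, 0, y) = 0 := pullOm_base S hφ hε hL hy _ _

/-- On a Lagrangian submanifold `ψ` vanishes, because `3ψ = dω`. -/
lemma famP_base (hS : S.IsStrictNearlyKahler) : famP S φ c (0, 0, y) = 0 := by
  have h := three_famP S hφ (c := c) hS (mem_liftDom hε hy)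
  have h0 : ∀ i, fderiv ℝ (famW S φ c i) (0, 0, y) (eX i) = 0 := by
    intro i
    rw [fderiv_eX ((contDiffAt_famW S hφ hS (mem_liftDom hε hy) i).differentiableAt
      (by simp))]
    have e : (fun y => famW S φ c i (0, 0, y)) =ᶠ[𝓝 y] fun _ => 0 := by
      filter_upwards [(isOpen_target c).mem_nhds hy] with x hx
      exact famW_base S hφ hε hL hx i
    rw [pderiv, e.fderiv_eq]
    simp
  simp only [h0, Finset.sum_const_zero] at h
  linarith

/-- On a Lagrangian submanifold `ψ(J·, ·, ·)` is `± k` times the volume density. -/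
lemma famSig_base (hS : S.IsStrictNearlyKahler) :
    famSig S φ c (0, 0, y) ^ 2 = S.nrm (lift φ c (0, 0, y)) ^ 2 * famQ S φ c (0, 0, y) := by
  have h := famNorm S hφ (c := c) hS (mem_liftDom hε hy)
  simp only [famP_base S hφ hε hL hy hS, famW_base S hφ hε hL hy] at h
  simpa using h.symm

/-- The first and second variations of the volume density of a Lagrangian submanifold. -/
theorem fderiv_famVol (hS : S.IsStrictNearlyKahler) :
    famVol S φ c (0, 0, y) = famKappa S φ c y * famSig S φ c (0, 0, y) ∧
    fderiv ℝ (famVol S φ c) (0, 0, y) eT =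
      famKappa S φ c y * ∑ i, fderiv ℝ (famT S φ c i) (0, 0, y) (eX i) ∧
    fderiv ℝ (fun z => fderiv ℝ (famVol S φ c) z eT) (0, 0, y) eS =
      famKappa S φ c y * ∑ i, fderiv ℝ (fun z => fderiv ℝ (famT S φ c i) z eS) (0, 0, y) (eX i)
        + hessRest S φ c y := by
  have hz := mem_liftDom hε hy
  have hk := AlmostHermitian.nrm_pos hS (lift φ c (0, 0, y))
  have hq0 : famSig S φ c (0, 0, y) ≠ 0 := by
    intro h0
    have h1 := famSig_base S hφ hε hL hy hS
    rw [h0] at h1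
    have := mul_pos (pow_pos hk 2) (famQ_pos S hφ hε hL hy)
    simp only [ne_eq, OfNat.ofNat_ne_zero, not_false_eq_true, zero_pow] at h1
    linarith
  set e : ℝ := ((SignType.sign (famSig S φ c (0, 0, y)) : SignType) : ℝ) with he
  have hee : e * e = 1 := by
    rcases lt_or_gt_of_ne hq0 with h0 | h0 <;> simp [he, h0]
  have heq : 0 < e * famSig S φ c (0, 0, y) := by
    rw [he, sign_mul_self]
    exact abs_pos.2 hq0
  have hnev : ∀ᶠ z in 𝓝 ((0, 0, y) : Param), z ∈ liftDom ε c ∧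
      S.nrm (lift φ c z) = S.nrm (lift φ c (0, 0, y)) :=
    ((isOpen_liftDom ε c).mem_nhds hz |> fun h => eventually_mem_set.2 h).and
      (AlmostHermitian.eventually_nrm_eq (isOpen_liftDom ε c) (hφ.contMDiffOn_lift c) hz hS)
  have h2 : (2 : WithTop ℕ∞) ≤ ∞ := ENat.LEInfty.out
  obtain ⟨d0, d1, d2⟩ := fderiv_density (z := ((0, 0, y) : Param)) (Q := famQ S φ c)
    (p := famP S φ c) (q := famSig S φ c) (w := famW S φ c)
    (G := fun i j => S.pullG (lift φ c) (eX i) (eX j)) hk hee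
    ((contDiffAt_famQ S hφ hz).of_le h2) ((contDiffAt_famP S hφ hS hz).of_le h2)
    ((contDiffAt_famSig S hφ hS hz).of_le h2)
    (fun i => (contDiffAt_famW S hφ hS hz i).of_le h2)
    (fun i j => (contDiffAt_famG S hφ hz _ _).of_le h2) (famQ_pos S hφ hε hL hy)
    (famP_base S hφ hε hL hy hS) heq (famW_base S hφ hε hL hy) (by
      filter_upwards [hnev] with z hz
      rw [← hz.2]
      exact famNorm S hφ hS hz.1)
  have hκ : e / S.nrm (lift φ c (0, 0, y)) = famKappa S φ c y := rfl
  rw [hκ] at d0 d1 d2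
  refine ⟨d0, ?_, ?_⟩
  · rw [show famVol S φ c = fun z => √(famQ S φ c z) from rfl, d1, fderiv_famSig S hφ hS hz]
    simp only [famW_base S hφ hε hL hy, mul_zero, Finset.sum_const_zero, add_zero]
  · have hev : (fun z => fderiv ℝ (famSig S φ c) z eT) =ᶠ[𝓝 ((0, 0, y) : Param)] fun z =>
        ∑ i, fderiv ℝ (famT S φ c i) z (eX i) + 4 * S.nrm (lift φ c (0, 0, y)) ^ 2 *
          ∑ i, S.pullOm (lift φ c) eT (eX i) z * famW S φ c i z := by
      filter_upwards [hnev] with z hz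
      rw [← hz.2]
      exact fderiv_famSig S hφ hS hz.1
    have hT := fun i => (contDiffAt_famT S hφ hS hz i).of_le h2
    have hTd := fun i => hasFDerivAt_fderiv_apply (hT i) (eX i)
    have hOd := fun i => ((AlmostHermitian.contDiffAt_pullOm (isOpen_liftDom ε c)
      (hφ.contMDiffOn_lift c) hz hS eT (eX i)).differentiableAt (by simp)).hasFDerivAt
    have hWd := fun i => ((contDiffAt_famW S hφ hS hz i).differentiableAt
      (by simp)).hasFDerivAt
    have hsum := (HasFDerivAt.fun_sum (u := Finset.univ) fun i _ => hTd i).fun_add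
      ((HasFDerivAt.fun_sum (u := Finset.univ) fun i _ => (hOd i).mul (hWd i)).const_mul
        (4 * S.nrm (lift φ c (0, 0, y)) ^ 2))
    have hD : fderiv ℝ (fun z => fderiv ℝ (famSig S φ c) z eT) (0, 0, y) eS =
        ∑ i, fderiv ℝ (fun z => fderiv ℝ (famT S φ c i) z eS) (0, 0, y) (eX i)
        + 4 * S.nrm (lift φ c (0, 0, y)) ^ 2 * ∑ i, S.pullOm (lift φ c) eT (eX i) (0, 0, y) *
          fderiv ℝ (famW S φ c i) (0, 0, y) eS := by
      rw [hev.fderiv_eq]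
      have h3 := DFunLike.congr_fun hsum.fderiv eS
      refine h3.trans ?_
      simp only [_root_.add_apply, _root_.sum_apply, _root_.smul_apply, smul_eq_mul,
        ContinuousLinearMap.flip_apply, famW_base S hφ hε hL hy, zero_mul, add_zero]
      congr 1
      refine Finset.sum_congr rfl fun i _ => ?_
      rw [fderiv_fderiv_apply (hT i), fderiv_fderiv_symm (hT i)]
    rw [show famVol S φ c = fun z => √(famQ S φ c z) from rfl, d2, hD, hessRest]
    change _ = _ + (_ + _ / (_ * √(famQ S φ c (0, 0, y))) +
      ∑ i, ∑ j, _ / (2 * √(famQ S φ c (0, 0, y))))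
    ring

end Base

end Family

/-! ### Changes of charts for the variation fields -/

section Alternating

variable {E : Type*} [NormedAddCommGroup E] [NormedSpace ℝ E]

/-- A 2-form on a 3-space behaves like a vector times a volume form: if `v i = ∑ A l i • u l`, the
matrix `A` applied to the vector with components `B (v (i + 1)) (v (i + 2))` is `det A` times the
vector with components `B (u (k + 1)) (u (k + 2))`. -/
lemma alternating_bilinear_det {B : E →L[ℝ] E →L[ℝ] ℝ} (hB : ∀ u v, B u v = -B v u)
    (A : Matrix (Fin 3) (Fin 3) ℝ) (u : Fin 3 → E) (k : Fin 3) :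
    ∑ i, A k i * B (∑ l, A l (i + 1) • u l) (∑ l, A l (i + 2) • u l) =
      A.det * B (u (k + 1)) (u (k + 2)) := by
  have h0 : ∀ v, B v v = 0 := fun v => by have := hB v v; linarith
  rw [Matrix.det_fin_three]
  simp only [Fin.sum_univ_three, map_add, map_smul, _root_.add_apply, _root_.smul_apply,
    smul_eq_mul, h0, hB (u 1) (u 0), hB (u 2) (u 0), hB (u 2) (u 1)]
  fin_cases k <;> simp [hB (u 2) (u 0)] <;> ring

lemma alternating_trilinear_det {T : E →L[ℝ] E →L[ℝ] E →L[ℝ] ℝ}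
    (h₁ : ∀ u v w, T u v w = -T v u w) (h₂ : ∀ u v w, T u v w = -T u w v)
    (A : Matrix (Fin 3) (Fin 3) ℝ) (u : Fin 3 → E) :
    T (∑ l, A l 0 • u l) (∑ l, A l 1 • u l) (∑ l, A l 2 • u l) = A.det * T (u 0) (u 1) (u 2) := by
  have d1 : ∀ v w, T v v w = 0 := fun v w => by have := h₁ v v w; linarith
  have d2 : ∀ v w, T v w w = 0 := fun v w => by have := h₂ v w w; linarith
  have d3 : ∀ v w, T v w v = 0 := fun v w => by rw [h₂, d1, neg_zero]
  rw [Matrix.det_fin_three]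
  simp only [Fin.sum_univ_three, map_add, map_smul, _root_.add_apply, _root_.smul_apply,
    smul_eq_mul, d1, d2, d3, h₁ (u 1) (u 0) (u 2), h₂ (u 0) (u 2) (u 1),
    h₁ (u 2) (u 0) (u 1), h₁ (u 2) (u 1) (u 0), h₂ (u 1) (u 2) (u 0)]
  ring

end Alternating

section Family

variable {M : Type*} [TopologicalSpace M] [ChartedSpace (Eucl 6) M]
  [IsManifold 𝓘(ℝ, Eucl 6) ∞ M] {S : AlmostHermitian M}
  {L : Type*} [TopologicalSpace L] [ChartedSpace (Eucl 3) L]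

/-- The vector density whose divergence is the first variation of the volume density. -/
def firstField (S : AlmostHermitian M) (φ : ℝ → ℝ → L → M) (c : L) (y : Eucl 3) (i : Fin 3) : ℝ :=
  famKappa S φ c y * famT S φ c i (0, 0, y)

/-- The derivative of the previous vector density with respect to the first parameter. -/
def secondField (S : AlmostHermitian M) (φ : ℝ → ℝ → L → M) (c : L) (y : Eucl 3) (i : Fin 3) : ℝ :=
  famKappa S φ c y * fderiv ℝ (famT S φ c i) (0, 0, y) eS

/-- The form `ψ(J·, ·, ·)` at a point, as a continuous trilinear map. -/
def sigForm (S : AlmostHermitian M) (x : M) : Eucl 6 →L[ℝ] Eucl 6 →L[ℝ] Eucl 6 →L[ℝ] ℝ :=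
  (S.psiForm x).comp (S.JAt x)

lemma sigForm_alt₁ (hS : S.IsStrictNearlyKahler) (x : M) (u v w : Eucl 6) :
    sigForm S x u v w = -sigForm S x v u w := by
  have h := AlmostHermitian.isPureForm_at hS x
  rw [sigForm, ContinuousLinearMap.comp_apply, ContinuousLinearMap.comp_apply, h.shift, h.alt₁]

lemma sigForm_alt₂ (hS : S.IsStrictNearlyKahler) (x : M) (u v w : Eucl 6) :
    sigForm S x u v w = -sigForm S x u w v := by
  have h := AlmostHermitian.isPureForm_at hS x
  rw [sigForm, ContinuousLinearMap.comp_apply, h.alt₂]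

variable [IsManifold 𝓘(ℝ, Eucl 3) ∞ L] {φ : ℝ → ℝ → L → M} {ε : ℝ} (hφ : IsFamily φ ε)

section Line

omit [TopologicalSpace M] [ChartedSpace (Eucl 6) M] [IsManifold 𝓘(ℝ, Eucl 6) ∞ M] in
lemma hasDerivAt_line {f : Param → ℝ} {z : Param} (hf : DifferentiableAt ℝ f z) (a : Param) :
    HasDerivAt (fun r : ℝ => f (z + r • a)) (fderiv ℝ f z a) 0 := by
  have hc : HasDerivAt (fun r : ℝ => z + r • a) a 0 := by
    simpa using ((hasDerivAt_id (0 : ℝ)).smul_const a).const_add z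
  have h0 : z + (0 : ℝ) • a = z := by simp
  have h1 : HasFDerivAt f (fderiv ℝ f z) (z + (0 : ℝ) • a) := by
    rw [h0]; exact hf.hasFDerivAt
  exact h1.comp_hasDerivAt 0 hc

end Line

include hφ

omit [IsManifold 𝓘(ℝ, Eucl 6) ∞ M] in
lemma dmap_eX_trans {c c' : L} {s t : ℝ} {y : Eucl 3}
    (hz : ((s, t, y) : Param) ∈ liftDom ε c)
    (hy' : (chart c).symm y ∈ (chart (n := 3) c').source) (i : Fin 3) :
    dmap (lift φ c) (s, t, y) (eX i) =
      ∑ l, jac c c' y l i • dmap (lift φ c') (s, t, trans c c' y) (eX l) := by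
  rw [eX, hφ.dmap_trans hz hy']
  have e : ((0, 0, fderiv ℝ (trans c c') y (EuclideanSpace.single i 1)) : Param) =
      ∑ l, jac c c' y l i • eX l := by
    refine Prod.ext ?_ (Prod.ext ?_ ?_)
    · simp [Prod.fst_sum, eX]
    · simp [Prod.fst_sum, Prod.snd_sum, eX]
    · simp only [Prod.snd_sum, Prod.smul_snd, eX]
      exact eucl_sum _
  rw [e]
  simp only [map_sum, map_smul]

omit [IsManifold 𝓘(ℝ, Eucl 6) ∞ M] in
lemma dmap_eT_trans {c c' : L} {s t : ℝ} {y : Eucl 3}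
    (hz : ((s, t, y) : Param) ∈ liftDom ε c)
    (hy' : (chart c).symm y ∈ (chart (n := 3) c').source) :
    dmap (lift φ c) (s, t, y) eT = dmap (lift φ c') (s, t, trans c c' y) eT := by
  rw [eT, hφ.dmap_trans hz hy', map_zero]

omit [TopologicalSpace M] [ChartedSpace (Eucl 6) M] [IsManifold 𝓘(ℝ, Eucl 6) ∞ M]
  [IsManifold 𝓘(ℝ, Eucl 3) ∞ L] hφ in
lemma lift_trans {c c' : L} {s t : ℝ} {y : Eucl 3}
    (hy' : (chart c).symm y ∈ (chart (n := 3) c').source) :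
    lift φ c (s, t, y) = lift φ c' (s, t, trans c c' y) := by
  simp only [lift, symm_trans hy']

/-- `famT` transforms like a vector times a 3-form. -/
lemma famT_trans (hS : S.IsStrictNearlyKahler) {c c' : L} {s t : ℝ} {y : Eucl 3}
    (hz : ((s, t, y) : Param) ∈ liftDom ε c)
    (hy' : (chart c).symm y ∈ (chart (n := 3) c').source) (k : Fin 3) :
    ∑ i, jac c c' y k i * famT S φ c i (s, t, y) =
      (jac c c' y).det * famT S φ c' k (s, t, trans c c' y) := by
  have e : ∀ c i z, famT S φ c i z = sigForm S (lift φ c z) (dmap (lift φ c) z eT)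
      (dmap (lift φ c) z (eX (i + 1))) (dmap (lift φ c) z (eX (i + 2))) := fun _ _ _ => rfl
  simp only [e, lift_trans hy', dmap_eT_trans hφ hz hy', dmap_eX_trans hφ hz hy']
  exact alternating_bilinear_det (sigForm_alt₂ hS _ _) (jac c c' y)
    (fun l => dmap (lift φ c') (s, t, trans c c' y) (eX l)) k

lemma famSig_trans (hS : S.IsStrictNearlyKahler) {c c' : L} {s t : ℝ} {y : Eucl 3}
    (hz : ((s, t, y) : Param) ∈ liftDom ε c)
    (hy' : (chart c).symm y ∈ (chart (n := 3) c').source) :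
    famSig S φ c (s, t, y) = (jac c c' y).det * famSig S φ c' (s, t, trans c c' y) := by
  have e : ∀ c z, famSig S φ c z = sigForm S (lift φ c z) (dmap (lift φ c) z (eX 0))
      (dmap (lift φ c) z (eX 1)) (dmap (lift φ c) z (eX 2)) := fun _ _ => rfl
  simp only [e, lift_trans hy', dmap_eX_trans hφ hz hy']
  exact alternating_trilinear_det (sigForm_alt₁ hS _) (sigForm_alt₂ hS _) (jac c c' y)
    (fun l => dmap (lift φ c') (s, t, trans c c' y) (eX l))

variable (hε : 0 < ε) (hL : IsLagrangianImmersion S (φ 0 0)) (hS : S.IsStrictNearlyKahler)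
include hε hL hS

lemma famSig_ne_zero {c : L} {y : Eucl 3} (hy : y ∈ (chart c).target) :
    famSig S φ c (0, 0, y) ≠ 0 := by
  intro h0
  have h1 := famSig_base S hφ hε hL hy hS
  rw [h0] at h1
  have := mul_pos (pow_pos (AlmostHermitian.nrm_pos hS (lift φ c (0, 0, y))) 2)
    (famQ_pos S hφ hε hL hy)
  simp only [ne_eq, OfNat.ofNat_ne_zero, not_false_eq_true, zero_pow] at h1
  linarith

omit hL in
lemma famKappa_trans {c c' : L} {y : Eucl 3} (hy : y ∈ (chart c).target)
    (hy' : (chart c).symm y ∈ (chart (n := 3) c').source) :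
    famKappa S φ c y * (jac c c' y).det =
      |(jac c c' y).det| * famKappa S φ c' (trans c c' y) := by
  rw [famKappa, famKappa, famSig_trans hφ hS (mem_liftDom hε hy) hy', sign_mul, lift_trans hy',
    SignType.coe_mul]
  have := sign_mul_self (jac c c' y).det
  rw [← this]
  ring

/-- The factor `κ` is locally constant. -/
lemma eventually_famKappa_eq {c : L} {y : Eucl 3} (hy : y ∈ (chart c).target) :
    ∀ᶠ x in 𝓝 y, famKappa S φ c x = famKappa S φ c y := by
  have hz := mem_liftDom hε hy
  have hc : ContinuousAt (fun x : Eucl 3 => ((0, 0, x) : Param)) y := by fun_prop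
  have h1 := hc.eventually (AlmostHermitian.eventually_nrm_eq (isOpen_liftDom ε c)
    (hφ.contMDiffOn_lift c) hz hS)
  have hcs : ContinuousAt (fun x : Eucl 3 => famSig S φ c (0, 0, x)) y :=
    ContinuousAt.comp (f := fun x : Eucl 3 => ((0, 0, x) : Param))
      (contDiffAt_famSig S hφ hS hz).continuousAt hc
  have h0 := famSig_ne_zero hφ hε hL hS hy
  have h2 : ∀ᶠ x in 𝓝 y, SignType.sign (famSig S φ c (0, 0, x)) =
      SignType.sign (famSig S φ c (0, 0, y)) := by
    rcases lt_or_gt_of_ne h0 with h | h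
    · filter_upwards [hcs.eventually_lt_const h] with x hx
      rw [sign_neg hx, sign_neg h]
    · filter_upwards [hcs.eventually_const_lt h] with x hx
      rw [sign_pos hx, sign_pos h]
  filter_upwards [h1, h2] with x hx hx2
  rw [famKappa, famKappa, hx, hx2]

/-- A locally constant multiple of a smooth function. -/
lemma kappa_mul_smooth {c : L} {y : Eucl 3} (hy : y ∈ (chart c).target) {f : Param → ℝ}
    (hf : ContDiffAt ℝ ∞ f (0, 0, y)) :
    ContDiffAt ℝ ∞ (fun x => famKappa S φ c x * f (0, 0, x)) y ∧
    ∀ i, pderiv i (fun x => famKappa S φ c x * f (0, 0, x)) y =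
      famKappa S φ c y * fderiv ℝ f (0, 0, y) (eX i) := by
  have hev : (fun x => famKappa S φ c x * f (0, 0, x)) =ᶠ[𝓝 y]
      fun x => famKappa S φ c y * f (0, 0, x) := by
    filter_upwards [eventually_famKappa_eq hφ hε hL hS hy] with x hx
    rw [hx]
  have hc : ContDiffAt ℝ ∞ (fun x : Eucl 3 => f (0, 0, x)) y :=
    ContDiffAt.comp (f := fun x : Eucl 3 => ((0, 0, x) : Param)) y hf
      (contDiffAt_const.prodMk (contDiffAt_const.prodMk contDiffAt_id))
  refine ⟨(contDiffAt_const.mul hc).congr_of_eventuallyEq hev, fun i => ?_⟩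
  rw [pderiv, hev.fderiv_eq, fderiv_const_mul (hc.differentiableAt (by simp)),
    fderiv_eX (hf.differentiableAt (by simp))]
  rfl

omit hε hL in
lemma contDiffAt_fderiv_famT {c : L} {z : Param} (hz : z ∈ liftDom ε c) (i : Fin 3) (a : Param) :
    ContDiffAt ℝ ∞ (fun z => fderiv ℝ (famT S φ c i) z a) z :=
  ((contDiffAt_famT S hφ hS hz i).fderiv_right (m := ∞) (by simp)).clm_apply contDiffAt_const

lemma contDiffOn_firstField (c : L) (i : Fin 3) :
    ContDiffOn ℝ ∞ (fun y => firstField S φ c y i) (chart c).target := fun _ hy =>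
  (kappa_mul_smooth hφ hε hL hS hy
    (contDiffAt_famT S hφ hS (mem_liftDom hε hy) i)).1.contDiffWithinAt

lemma contDiffOn_secondField (c : L) (i : Fin 3) :
    ContDiffOn ℝ ∞ (fun y => secondField S φ c y i) (chart c).target := fun _ hy =>
  (kappa_mul_smooth hφ hε hL hS hy
    (contDiffAt_fderiv_famT hφ hS (mem_liftDom hε hy) i eS)).1.contDiffWithinAt

/-- The first and second variations of the volume density are divergences, up to `hessRest`. -/
lemma fderiv_famVol_eq_div {c : L} {y : Eucl 3} (hy : y ∈ (chart c).target) :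
    fderiv ℝ (famVol S φ c) (0, 0, y) eT = ∑ i, pderiv i (fun x => firstField S φ c x i) y ∧
    fderiv ℝ (fun z => fderiv ℝ (famVol S φ c) z eT) (0, 0, y) eS =
      ∑ i, pderiv i (fun x => secondField S φ c x i) y + hessRest S φ c y := by
  obtain ⟨-, h1, h2⟩ := fderiv_famVol S hφ hε hL hy hS
  rw [h1, h2, Finset.mul_sum, Finset.mul_sum]
  have e1 := fun i => (kappa_mul_smooth hφ hε hL hS hy
    (contDiffAt_famT S hφ hS (mem_liftDom hε hy) i)).2 i
  have e2 := fun i => (kappa_mul_smooth hφ hε hL hS hy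
    (contDiffAt_fderiv_famT hφ hS (mem_liftDom hε hy) i eS)).2 i
  simp only [firstField, secondField, e1, e2, and_self]

omit hL hS in
/-- Outside the support of the variation in the second parameter, the vector densities vanish. -/
lemma famT_eq_zero {K : Set L} (hK : ∀ s ∈ Ioo (-ε) ε, ∀ t ∈ Ioo (-ε) ε, ∀ x ∉ K, φ s t x = φ s 0 x)
    {c : L} {s : ℝ} (hs : s ∈ Ioo (-ε) ε) {y : Eucl 3} (hy : y ∈ (chart c).target)
    (hyK : (chart c).symm y ∉ K) (i : Fin 3) : famT S φ c i (s, 0, y) = 0 := by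
  have h0 : (0 : ℝ) ∈ Ioo (-ε) ε := ⟨by linarith, hε⟩
  have hd : dmap (lift φ c) (s, 0, y) eT = 0 := by
    rw [dmap_eq_curve (isOpen_liftDom ε c) (hφ.contMDiffOn_lift c) ⟨hs, h0, hy⟩]
    have hev : (fun r : ℝ => lift φ c ((s, 0, y) + r • eT)) =ᶠ[𝓝 0]
        fun _ => φ s 0 ((chart c).symm y) := by
      filter_upwards [isOpen_Ioo.mem_nhds h0] with r hr
      simp only [lift, eT, Prod.smul_mk, smul_eq_mul, mul_zero, mul_one, smul_zero, Prod.mk_add_mk,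
        add_zero, zero_add]
      exact hK s hs r hr _ hyK
    have h1 := hev.mfderiv_eq (I := 𝓘(ℝ, ℝ)) (I' := 𝓘(ℝ, Eucl 6))
    rw [mfderiv_const] at h1
    with_unfolding_all exact DFunLike.congr_fun h1 (1 : ℝ)
  change sigForm S (lift φ c (s, 0, y)) (dmap (lift φ c) (s, 0, y) eT) _ _ = 0
  rw [hd]
  simp

/-- The determinants in `famT_trans` and `famSig_trans` differ from those required of densities by
their signs, which `κ` makes up for. -/
lemma isVectorDensity_firstField {K : Set L}
    (hK : ∀ s ∈ Ioo (-ε) ε, ∀ t ∈ Ioo (-ε) ε, ∀ x ∉ K, φ s t x = φ s 0 x) :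
    IsVectorDensity (firstField S φ) K := by
  refine ⟨fun c i => (contDiffOn_firstField hφ hε hL hS c i).of_le (by norm_cast),
    fun c y hy hyK i => ?_, fun c c' y hy hy' => transform_of_mulVec (X := L) ?_⟩
  · rw [firstField, famT_eq_zero hφ hε hK ⟨by linarith, hε⟩ hy hyK, mul_zero]
  · ext k
    have h := famT_trans hφ hS (mem_liftDom hε hy) hy' k
    have h2 := famKappa_trans hφ hε hS hy hy'
    simp only [Matrix.mulVec, dotProduct, firstField, Pi.smul_apply, smul_eq_mul]
    rw [← mul_assoc, ← h2, mul_assoc, ← h, Finset.mul_sum]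
    exact Finset.sum_congr rfl fun i _ => by ring

lemma isVectorDensity_secondField {K : Set L}
    (hK : ∀ s ∈ Ioo (-ε) ε, ∀ t ∈ Ioo (-ε) ε, ∀ x ∉ K, φ s t x = φ s 0 x) :
    IsVectorDensity (secondField S φ) K := by
  have hd : ∀ c i, ∀ y ∈ (chart (n := 3) c).target, HasDerivAt (fun r : ℝ => famT S φ c i (r, 0, y))
      (fderiv ℝ (famT S φ c i) (0, 0, y) eS) 0 := by
    intro c i y hy
    have h := hasDerivAt_line ((contDiffAt_famT S hφ hS (mem_liftDom hε hy) i).differentiableAt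
      (by simp)) eS
    simpa only [eS, Prod.smul_mk, smul_eq_mul, mul_zero, mul_one, smul_zero, Prod.mk_add_mk,
      add_zero, zero_add] using h
  have hIoo : ∀ᶠ r : ℝ in 𝓝 0, r ∈ Ioo (-ε) ε := isOpen_Ioo.mem_nhds ⟨by linarith, hε⟩
  refine ⟨fun c i => (contDiffOn_secondField hφ hε hL hS c i).of_le (by norm_cast),
    fun c y hy hyK i => ?_, fun c c' y hy hy' => transform_of_mulVec (X := L) ?_⟩
  · have hev : (fun r : ℝ => famT S φ c i (r, 0, y)) =ᶠ[𝓝 0] fun _ => 0 := by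
      filter_upwards [hIoo] with r hr using famT_eq_zero hφ hε hK hr hy hyK i
    have h0 : fderiv ℝ (famT S φ c i) (0, 0, y) eS = 0 :=
      (hd c i y hy).unique ((hasDerivAt_const (0 : ℝ) (0 : ℝ)).congr_of_eventuallyEq hev)
    rw [secondField, h0, mul_zero]
  · ext k
    have h : ∑ i, jac c c' y k i * fderiv ℝ (famT S φ c i) (0, 0, y) eS =
        (jac c c' y).det * fderiv ℝ (famT S φ c' k) (0, 0, trans c c' y) eS := by
      have h1 := HasDerivAt.fun_sum (u := Finset.univ) fun i _ =>
        (hd c i y hy).const_mul (jac c c' y k i)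
      have h2 := (hd c' k (trans c c' y) (trans_mem hy')).const_mul (jac c c' y).det
      refine h1.unique (h2.congr_of_eventuallyEq ?_)
      filter_upwards [hIoo] with r hr
      exact famT_trans hφ hS ⟨hr, ⟨by linarith, hε⟩, hy⟩ hy' k
    have h2 := famKappa_trans hφ hε hS hy hy'
    simp only [Matrix.mulVec, dotProduct, secondField, Pi.smul_apply, smul_eq_mul]
    rw [← mul_assoc, ← h2, mul_assoc, ← h, Finset.mul_sum]
    exact Finset.sum_congr rfl fun i _ => by ring

end Family

/-! ### The second variation of the volume -/

/-- Differentiation of an integral over a compact set with respect to a parameter. -/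
lemma hasDerivAt_setIntegral_compact {C : Set (Eucl 3)} (hC : IsCompact C) {O : Set (ℝ × Eucl 3)}
    (hO : IsOpen O) {t₀ : ℝ} (hCO : ∀ y ∈ C, (t₀, y) ∈ O) {f f' : ℝ → Eucl 3 → ℝ}
    (hf : ContinuousOn (fun p : ℝ × Eucl 3 => f p.1 p.2) O)
    (hf' : ContinuousOn (fun p : ℝ × Eucl 3 => f' p.1 p.2) O)
    (hd : ∀ p ∈ O, HasDerivAt (fun t => f t p.2) (f' p.1 p.2) p.1) :
    HasDerivAt (fun t => ∫ y in C, f t y) (∫ y in C, f' t₀ y) t₀ := by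
  obtain ⟨u, v, hu, -, htu, hCv, huv⟩ :=
    generalized_tube_lemma (isCompact_singleton (x := t₀)) hC hO
      (by rintro ⟨t, y⟩ ⟨rfl, hy⟩; exact hCO y hy)
  obtain ⟨δ, hδ, hball⟩ := Metric.nhds_basis_closedBall.mem_iff.1 (hu.mem_nhds (htu rfl))
  have hsub : ∀ t ∈ Metric.closedBall t₀ δ, ∀ y ∈ C, (t, y) ∈ O := fun t ht y hy =>
    huv ⟨hball ht, hCv hy⟩
  have hprod : Metric.closedBall t₀ δ ×ˢ C ⊆ O := fun p hp => hsub p.1 hp.1 p.2 hp.2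
  obtain ⟨B, hB⟩ := ((isCompact_closedBall t₀ δ).prod hC).exists_bound_of_continuousOn
    (hf'.mono hprod)
  have hslice : ∀ (g : ℝ × Eucl 3 → ℝ), ContinuousOn g O → ∀ t ∈ Metric.closedBall t₀ δ,
      ContinuousOn (fun y => g (t, y)) C := fun g hg t ht =>
    hg.comp (by fun_prop) fun y hy => hsub t ht y hy
  have ht₀ : t₀ ∈ Metric.closedBall t₀ δ := Metric.mem_closedBall_self hδ.le
  refine (hasDerivAt_integral_of_dominated_loc_of_deriv_le (μ := volume.restrict C)
    (Metric.closedBall_mem_nhds t₀ hδ) (F := f) (F' := f') (bound := fun _ => B)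
    ?_ ?_ ?_ ?_ ?_ ?_).2
  · filter_upwards [Metric.closedBall_mem_nhds t₀ hδ] with t ht
    exact (hslice _ hf t ht).aestronglyMeasurable hC.measurableSet
  · exact (hslice _ hf t₀ ht₀).integrableOn_compact hC
  · exact (hslice _ hf' t₀ ht₀).aestronglyMeasurable hC.measurableSet
  · exact (ae_restrict_iff' hC.measurableSet).2 (ae_of_all _ fun y hy t ht => hB (t, y) ⟨ht, hy⟩)
  · exact (continuousOn_const (c := B)).integrableOn_compact hC
  · exact (ae_restrict_iff' hC.measurableSet).2
      (ae_of_all _ fun y hy t ht => hd (t, y) (hsub t ht y hy))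

section Family

variable {M : Type*} [TopologicalSpace M] [ChartedSpace (Eucl 6) M]
  [IsManifold 𝓘(ℝ, Eucl 6) ∞ M] {S : AlmostHermitian M}
  {L : Type*} [TopologicalSpace L] [ChartedSpace (Eucl 3) L]
  [IsManifold 𝓘(ℝ, Eucl 3) ∞ L]
  {φ : ℝ → ℝ → L → M} {ε : ℝ}

section Vol

variable [T2Space L] [SigmaCompactSpace L]

lemma rho_eq_zero_of_notMem {c : L} {K : Set L} {y : Eucl 3} (hy : y ∈ (chart c).target)
    (hyK : (chart c).symm y ∈ K) (hyC : y ∉ chartCompact c K) : rho c c y = 0 := by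
  rw [mem_chartCompact hy, not_and_or] at hyC
  rcases hyC with h | h
  · rw [rho, image_eq_zero_of_notMem_tsupport h]
  · exact absurd hyK h

/-- The volume as a finite sum of integrals over compact sets which do not depend on the
parameters. -/
lemma vol_eq (hφ : IsFamily φ ε) {K : Set L} (hK : IsCompact K) {s t : ℝ} (hs : s ∈ Ioo (-ε) ε)
    (ht : t ∈ Ioo (-ε) ε) :
    vol S (φ s t) K = ∑ c ∈ (finite_meets hK).toFinset,
      ∫ y in chartCompact c K, rho c c y * famVol S φ c (s, t, y) := by
  have hmeas : ∀ c : L, MeasurableSet ((chart (n := 3) c).target ∩ (chart c).symm ⁻¹' K) := by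
    intro c
    have h1 : IsOpen ((chart (n := 3) c).target ∩ (chart c).symm ⁻¹' Kᶜ) :=
      (continuousOn_extChartAt_symm c).isOpen_inter_preimage (isOpen_target c)
        hK.isClosed.isOpen_compl
    convert (isOpen_target c).measurableSet.diff h1.measurableSet using 1
    ext y
    simp only [mem_inter_iff, mem_preimage, mem_compl_iff, Set.mem_sdiff]
    tauto
  rw [vol, finsum_eq_sum_of_support_subset (s := (finite_meets hK).toFinset)]
  · refine Finset.sum_congr rfl fun c _ => ?_
    rw [setIntegral_eq_of_subset_of_forall_sdiff_eq_zero (s := chartCompact c K) (hmeas c)]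
    · refine setIntegral_congr_fun (isCompact_chartCompact c hK).measurableSet fun y hy => ?_
      rw [density_eq_famVol S hφ ⟨hs, ht, chartCompact_subset c K hy⟩]
      rfl
    · intro y hy
      have hyt := chartCompact_subset c K hy
      exact ⟨hyt, ((mem_chartCompact hyt).1 hy).2⟩
    · intro y hy
      have : rho c c y = 0 := rho_eq_zero_of_notMem hy.1.1 hy.1.2 hy.2
      rw [rho] at this
      rw [this, zero_mul]
  · intro c hc
    by_contra h
    refine hc (setIntegral_eq_zero_of_forall_eq_zero fun y hy => ?_)
    have h0 : rho c c y = 0 := rho_eq_zero (fun hh => h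
      (Finset.mem_coe.2 ((finite_meets hK).mem_toFinset.2 hh))) hy.2
    rw [rho] at h0
    rw [h0, zero_mul]

end Vol

/-- The open set of those parameters for which the family consists of immersions. -/
def regDom (S : AlmostHermitian M) (φ : ℝ → ℝ → L → M) (ε : ℝ) (c : L) : Set Param :=
  {z | z ∈ liftDom ε c ∧ 0 < famQ S φ c z}

lemma isOpen_regDom (hφ : IsFamily φ ε) (c : L) : IsOpen (regDom S φ ε c) := by
  refine isOpen_iff_mem_nhds.2 fun z hz => ?_
  exact inter_mem ((isOpen_liftDom ε c).mem_nhds hz.1)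
    ((contDiffAt_famQ S hφ hz.1).continuousAt.eventually_const_lt hz.2)

lemma contDiffAt_famVol_of_mem (hφ : IsFamily φ ε) {c : L} {z : Param} (hz : z ∈ regDom S φ ε c) :
    ContDiffAt ℝ ∞ (famVol S φ c) z := contDiffAt_famVol S hφ hz.1 hz.2

lemma contDiffAt_fderiv_famVol (hφ : IsFamily φ ε) {c : L} {z : Param} (hz : z ∈ regDom S φ ε c)
    (a : Param) : ContDiffAt ℝ ∞ (fun z => fderiv ℝ (famVol S φ c) z a) z :=
  ((contDiffAt_famVol_of_mem hφ hz).fderiv_right (m := ∞) (by simp)).clm_apply contDiffAt_const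

variable [T2Space L] [SigmaCompactSpace L]

/-- The first derivative of the volume in the second parameter. -/
lemma hasDerivAt_vol (hφ : IsFamily φ ε) (hε : 0 < ε) (hL : IsLagrangianImmersion S (φ 0 0))
    {K : Set L} (hK : IsCompact K) :
    ∀ᶠ s in 𝓝 0, HasDerivAt (fun t => vol S (φ s t) K)
      (∑ c ∈ (finite_meets hK).toFinset,
        ∫ y in chartCompact c K, rho c c y * fderiv ℝ (famVol S φ c) (s, 0, y) eT) 0 := by
  have hI : Ioo (-ε) ε ∈ 𝓝 (0 : ℝ) := isOpen_Ioo.mem_nhds ⟨by linarith, hε⟩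
  have hev : ∀ c : L, ∀ᶠ s : ℝ in 𝓝 0, ∀ y ∈ chartCompact c K,
      ((s, 0, y) : Param) ∈ regDom S φ ε c := by
    intro c
    have hO : IsOpen ((fun p : ℝ × Eucl 3 => ((p.1, 0, p.2) : Param)) ⁻¹' regDom S φ ε c) :=
      (isOpen_regDom hφ c).preimage (by fun_prop)
    obtain ⟨u, v, hu, -, h0u, hCv, huv⟩ := generalized_tube_lemma
      (isCompact_singleton (x := (0 : ℝ))) (isCompact_chartCompact c hK) hO (by
        rintro ⟨s, y⟩ ⟨rfl, hy⟩
        have hyt := chartCompact_subset c K hy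
        exact ⟨mem_liftDom hε hyt, famQ_pos S hφ hε hL hyt⟩)
    filter_upwards [hu.mem_nhds (h0u rfl)] with s hs y hy
    exact huv (mk_mem_prod hs (hCv hy))
  have hall := (Finset.eventually_all (finite_meets hK).toFinset).2 fun c _ => hev c
  filter_upwards [hall, hI] with s hs hsI
  have hsum := HasDerivAt.fun_sum (u := (finite_meets hK).toFinset) fun c hc =>
    hasDerivAt_setIntegral_compact (isCompact_chartCompact c hK) (t₀ := 0)
      (O := (fun p : ℝ × Eucl 3 => ((s, p.1, p.2) : Param)) ⁻¹' regDom S φ ε c)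
      ((isOpen_regDom hφ c).preimage (by fun_prop)) (hs c hc)
      (f := fun t y => rho c c y * famVol S φ c (s, t, y))
      (f' := fun t y => rho c c y * fderiv ℝ (famVol S φ c) (s, t, y) eT) (by
        intro p hp
        refine ContinuousAt.continuousWithinAt (ContinuousAt.mul ?_ ?_)
        · exact ContinuousAt.comp (x := p) (f := fun p : ℝ × Eucl 3 => p.2)
            (((contDiffOn_rho c c).contDiffAt ((isOpen_target c).mem_nhds hp.1.2.2)).continuousAt)
            (by fun_prop)
        · exact ContinuousAt.comp (f := fun p : ℝ × Eucl 3 => ((s, p.1, p.2) : Param))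
            (contDiffAt_famVol_of_mem hφ hp).continuousAt (by fun_prop)) (by
        intro p hp
        refine ContinuousAt.continuousWithinAt (ContinuousAt.mul ?_ ?_)
        · exact ContinuousAt.comp (x := p) (f := fun p : ℝ × Eucl 3 => p.2)
            (((contDiffOn_rho c c).contDiffAt ((isOpen_target c).mem_nhds hp.1.2.2)).continuousAt)
            (by fun_prop)
        · exact ContinuousAt.comp (f := fun p : ℝ × Eucl 3 => ((s, p.1, p.2) : Param))
            (contDiffAt_fderiv_famVol hφ hp eT).continuousAt (by fun_prop)) (by
        intro p hp
        have h1 : HasDerivAt (fun t : ℝ => ((s, t, p.2) : Param)) eT p.1 :=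
          (hasDerivAt_const p.1 s).prodMk ((hasDerivAt_id p.1).prodMk (hasDerivAt_const p.1 p.2))
        exact (((contDiffAt_famVol_of_mem hφ hp).differentiableAt
          (by simp)).hasFDerivAt.comp_hasDerivAt p.1 h1).const_mul _)
  refine hsum.congr_of_eventuallyEq ?_
  filter_upwards [hI] with t ht
  exact vol_eq hφ hK hsI ht

/-- The second derivative of the volume in the two parameters. -/
lemma hasDerivAt_integral_fderiv_famVol (hφ : IsFamily φ ε) (hε : 0 < ε)
    (hL : IsLagrangianImmersion S (φ 0 0)) {K : Set L} (hK : IsCompact K) :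
    HasDerivAt (fun s => ∑ c ∈ (finite_meets hK).toFinset,
        ∫ y in chartCompact c K, rho c c y * fderiv ℝ (famVol S φ c) (s, 0, y) eT)
      (∑ c ∈ (finite_meets hK).toFinset, ∫ y in chartCompact c K, rho c c y *
        fderiv ℝ (fun z => fderiv ℝ (famVol S φ c) z eT) (0, 0, y) eS) 0 := by
  refine HasDerivAt.fun_sum fun c _ =>
    hasDerivAt_setIntegral_compact (isCompact_chartCompact c hK) (t₀ := 0)
      (O := (fun p : ℝ × Eucl 3 => ((p.1, 0, p.2) : Param)) ⁻¹' regDom S φ ε c)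
      ((isOpen_regDom hφ c).preimage (by fun_prop)) (fun y hy => ?_)
      (f := fun s y => rho c c y * fderiv ℝ (famVol S φ c) (s, 0, y) eT)
      (f' := fun s y => rho c c y *
        fderiv ℝ (fun z => fderiv ℝ (famVol S φ c) z eT) (s, 0, y) eS) ?_ ?_ ?_
  · have hyt := chartCompact_subset c K hy
    exact ⟨mem_liftDom hε hyt, famQ_pos S hφ hε hL hyt⟩
  · intro p hp
    refine ContinuousAt.continuousWithinAt (ContinuousAt.mul ?_ ?_)
    · exact ContinuousAt.comp (x := p) (f := fun p : ℝ × Eucl 3 => p.2)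
        (((contDiffOn_rho c c).contDiffAt ((isOpen_target c).mem_nhds hp.1.2.2)).continuousAt)
        (by fun_prop)
    · exact ContinuousAt.comp (f := fun p : ℝ × Eucl 3 => ((p.1, 0, p.2) : Param))
        (contDiffAt_fderiv_famVol hφ hp eT).continuousAt (by fun_prop)
  · intro p hp
    refine ContinuousAt.continuousWithinAt (ContinuousAt.mul ?_ ?_)
    · exact ContinuousAt.comp (x := p) (f := fun p : ℝ × Eucl 3 => p.2)
        (((contDiffOn_rho c c).contDiffAt ((isOpen_target c).mem_nhds hp.1.2.2)).continuousAt)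
        (by fun_prop)
    · exact ContinuousAt.comp (f := fun p : ℝ × Eucl 3 => ((p.1, 0, p.2) : Param))
        (((contDiffAt_fderiv_famVol hφ hp eT).fderiv_right (m := ∞) (by simp)).clm_apply
          contDiffAt_const).continuousAt (by fun_prop)
  · intro p hp
    have h1 : HasDerivAt (fun s : ℝ => ((s, 0, p.2) : Param)) eS p.1 :=
      (hasDerivAt_id p.1).prodMk ((hasDerivAt_const p.1 (0 : ℝ)).prodMk (hasDerivAt_const p.1 p.2))
    exact (((contDiffAt_fderiv_famVol hφ hp eT).differentiableAt
      (by simp)).hasFDerivAt.comp_hasDerivAt p.1 h1).const_mul _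

/-- The divergence theorem, with the integrals taken over compact sets in the charts. -/
lemma IsVectorDensity.sum_integral_div_compact {W : L → Eucl 3 → Fin 3 → ℝ} {K : Set L}
    (hK : IsCompact K) (hW : IsVectorDensity W K) :
    ∑ c ∈ (finite_meets hK).toFinset,
      ∫ y in chartCompact c K, rho c c y * ∑ i, pderiv i (fun z => W c z i) y = 0 := by
  rw [← hW.sum_integral_div hK]
  refine Finset.sum_congr rfl fun c _ => Eq.symm ?_
  refine setIntegral_eq_of_subset_of_forall_sdiff_eq_zero (isOpen_target c).measurableSet
    (chartCompact_subset c K) fun y hy => ?_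
  by_cases hyK : (chart c).symm y ∈ K
  · rw [rho_eq_zero_of_notMem hy.1 hyK hy.2, zero_mul]
  · have hO : IsOpen ((chart (n := 3) c).target ∩ (chart c).symm ⁻¹' Kᶜ) :=
      (continuousOn_extChartAt_symm c).isOpen_inter_preimage (isOpen_target c)
        hK.isClosed.isOpen_compl
    have h0 : ∀ i, pderiv i (fun z => W c z i) y = 0 := by
      intro i
      have hev : (fun z => W c z i) =ᶠ[𝓝 y] fun _ => 0 := by
        filter_upwards [hO.mem_nhds ⟨hy.1, hyK⟩] with z hz using hW.eq_zero c z hz.1 hz.2 i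
      rw [pderiv, hev.fderiv_eq]
      simp
    simp only [h0, Finset.sum_const_zero, mul_zero]

omit [T2Space L] [SigmaCompactSpace L] in
/-- Although `κ` involves a sign, `hessRest` is continuous: it is the difference of the second
variation of the volume density and a divergence. -/
lemma continuousOn_hessRest (hφ : IsFamily φ ε) (hε : 0 < ε)
    (hL : IsLagrangianImmersion S (φ 0 0)) (hS : S.IsStrictNearlyKahler) (c : L) :
    ContinuousOn (hessRest S φ c) (chart c).target := by
  have h1 : ContinuousOn (fun y => fderiv ℝ (fun z => fderiv ℝ (famVol S φ c) z eT) (0, 0, y) eS -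
      ∑ i, pderiv i (fun x => secondField S φ c x i) y) (chart c).target := by
    refine ContinuousOn.sub (fun y hy => ContinuousAt.continuousWithinAt ?_) ?_
    · have hp : ((0, 0, y) : Param) ∈ regDom S φ ε c :=
        ⟨mem_liftDom hε hy, famQ_pos S hφ hε hL hy⟩
      exact ContinuousAt.comp (f := fun y : Eucl 3 => ((0, 0, y) : Param))
        (((contDiffAt_fderiv_famVol hφ hp eT).fderiv_right (m := ∞) (by simp)).clm_apply
          contDiffAt_const).continuousAt (by fun_prop)
    · exact continuousOn_finsetSum _ fun i _ => (contDiffOn_pderiv (isOpen_target c)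
        (contDiffOn_secondField hφ hε hL hS c i) i).continuousOn
  refine h1.congr fun y hy => ?_
  beta_reduce
  rw [(fderiv_famVol_eq_div hφ hε hL hS hy).2]
  ring

/-- The volume of a two-parameter variation of a Lagrangian submanifold: it is critical, and the
mixed second derivative is the integral of `hessRest`. -/
theorem exists_second_variation (hφ : IsFamily φ ε) (hε : 0 < ε)
    (hL : IsLagrangianImmersion S (φ 0 0)) (hS : S.IsStrictNearlyKahler) {K : Set L}
    (hK : IsCompact K)
    (hKφ : ∀ s ∈ Ioo (-ε) ε, ∀ t ∈ Ioo (-ε) ε, ∀ x ∉ K, φ s t x = φ s 0 x) :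
    ∃ D : ℝ → ℝ, (∀ᶠ s in 𝓝 0, HasDerivAt (fun t => vol S (φ s t) K) (D s) 0) ∧ D 0 = 0 ∧
      HasDerivAt D (∑ c ∈ (finite_meets hK).toFinset,
        ∫ y in chartCompact c K, rho c c y * hessRest S φ c y) 0 := by
  refine ⟨_, hasDerivAt_vol hφ hε hL hK, ?_, ?_⟩
  · refine Eq.trans ?_ ((isVectorDensity_firstField hφ hε hL hS hKφ).sum_integral_div_compact hK)
    refine Finset.sum_congr rfl fun c _ => setIntegral_congr_fun
      (isCompact_chartCompact c hK).measurableSet fun y hy => ?_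
    beta_reduce
    rw [(fderiv_famVol_eq_div hφ hε hL hS (chartCompact_subset c K hy)).1]
  · convert hasDerivAt_integral_fderiv_famVol hφ hε hL hK using 1
    have h0 := (isVectorDensity_secondField hφ hε hL hS hKφ).sum_integral_div_compact hK
    refine (zero_add _).symm.trans ((congrArg (· + _) h0.symm).trans
      (Finset.sum_add_distrib.symm.trans ?_))
    refine Finset.sum_congr rfl fun c _ => ?_
    have hsub := chartCompact_subset c K
    have hρ := (contDiffOn_rho c c).continuousOn.mono hsub
    rw [← integral_add]
    · refine setIntegral_congr_fun (isCompact_chartCompact c hK).measurableSet fun y hy => ?_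
      beta_reduce
      rw [(fderiv_famVol_eq_div hφ hε hL hS (hsub hy)).2]
      ring
    · refine ContinuousOn.integrableOn_compact (isCompact_chartCompact c hK) (hρ.mul ?_)
      exact (continuousOn_finsetSum _ fun i _ => (contDiffOn_pderiv (isOpen_target c)
        (contDiffOn_secondField hφ hε hL hS c i) i).continuousOn).mono hsub
    · exact (hρ.mul ((continuousOn_hessRest hφ hε hL hS c).mono hsub)).integrableOn_compact
        (isCompact_chartCompact c hK)

end Family

/-! ### Infinitesimal Lagrangian deformations are Jacobi fields -/

section Family

variable {M : Type*} [TopologicalSpace M] [ChartedSpace (Eucl 6) M]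
  [IsManifold 𝓘(ℝ, Eucl 6) ∞ M] {S : AlmostHermitian M}
  {L : Type*} [TopologicalSpace L] [ChartedSpace (Eucl 3) L]
  [IsManifold 𝓘(ℝ, Eucl 3) ∞ L]
  {φ : ℝ → ℝ → L → M} {ε : ℝ}

omit [IsManifold 𝓘(ℝ, Eucl 6) ∞ M] [IsManifold 𝓘(ℝ, Eucl 3) ∞ L] in
/-- A one-parameter variation `φ` gives the two-parameter family `φ_{s + t}`. -/
lemma isFamily_add {φ : ℝ → L → M} (hφ : ContMDiffOn (𝓘(ℝ, ℝ).prod 𝓘(ℝ, Eucl 3)) 𝓘(ℝ, Eucl 6) ∞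
    (fun p : ℝ × L => φ p.1 p.2) (Ioo (-ε) ε ×ˢ univ)) :
    IsFamily (fun s t => φ (s + t)) (ε / 2) := by
  have h1 : ContMDiff (𝓘(ℝ, ℝ).prod (𝓘(ℝ, ℝ).prod 𝓘(ℝ, Eucl 3))) (𝓘(ℝ, ℝ).prod 𝓘(ℝ, Eucl 3)) ∞
      (fun p : ℝ × ℝ × L => ((p.1 + p.2.1, p.2.2) : ℝ × L)) :=
    (contMDiff_fst.add (contMDiff_fst.comp contMDiff_snd)).prodMk
      (contMDiff_snd.comp contMDiff_snd)
  refine ContMDiffOn.comp hφ h1.contMDiffOn ?_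
  rintro ⟨s, t, x⟩ ⟨⟨h1, h2⟩, ⟨h3, h4⟩, -⟩
  exact ⟨⟨by dsimp only at *; linarith, by dsimp only at *; linarith⟩, mem_univ _⟩

omit [IsManifold 𝓘(ℝ, Eucl 6) ∞ M] [TopologicalSpace L] [ChartedSpace (Eucl 3) L]
  [IsManifold 𝓘(ℝ, Eucl 3) ∞ L] in
/-- The base points in an equality of velocities. -/
lemma eq_of_velocity {φ : ℝ → L → M} {ι : L → M} {V : ∀ x : L, TangentSpace 𝓘(ℝ, Eucl 6) (ι x)}
    (h : ∀ x, velocity φ x = ⟨ι x, V x⟩) : φ 0 = ι :=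
  funext fun x => congrArg (fun p : TangentBundle 𝓘(ℝ, Eucl 6) M => p.1) (h x)

omit [IsManifold 𝓘(ℝ, Eucl 6) ∞ M] in
/-- The variation field of a family in the first parameter. -/
lemma IsFamily.dmap_eS (hφ : IsFamily φ ε) (hε : 0 < ε) {ι : L → M}
    {V : ∀ x : L, TangentSpace 𝓘(ℝ, Eucl 6) (ι x)}
    (hV : ∀ x, velocity (fun s => φ s 0) x = ⟨ι x, V x⟩) {c : L} {y : Eucl 3}
    (hy : y ∈ (chart c).target) :
    dmap (lift φ c) (0, 0, y) eS = (V ((chart c).symm y) : Eucl 6) := by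
  rw [dmap_eq_curve (isOpen_liftDom ε c) (hφ.contMDiffOn_lift c) (mem_liftDom hε hy)]
  have h := congrArg (fun p : TangentBundle 𝓘(ℝ, Eucl 6) M => (p.2 : Eucl 6))
    (hV ((chart c).symm y))
  refine Eq.trans ?_ h
  have e : (fun r : ℝ => lift φ c ((0, 0, y) + r • eS)) = fun r => φ r 0 ((chart c).symm y) := by
    ext r
    simp only [lift, eS, Prod.smul_mk, smul_eq_mul, mul_zero, mul_one, smul_zero, Prod.mk_add_mk,
      add_zero, zero_add]
  have h1 := (EventuallyEq.of_eq e).mfderiv_eq (x := (0 : ℝ)) (I := 𝓘(ℝ, ℝ)) (I' := 𝓘(ℝ, Eucl 6))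
  with_unfolding_all exact DFunLike.congr_fun h1 (1 : ℝ)

/-- The first variation of `ω` on the 3-manifold in terms of the variation field `a`, from the
structure equation `dω = 3 ψ`. -/
lemma fderiv_famW_eq (hS : S.IsStrictNearlyKahler) (hφ : IsFamily φ ε) (hε : 0 < ε) {c : L}
    {y : Eucl 3} (hy : y ∈ (chart c).target) (i : Fin 3) (a : Param) :
    fderiv ℝ (famW S φ c i) (0, 0, y) a =
      3 * S.pullPsi (lift φ c) a (eX (i + 1)) (eX (i + 2)) (0, 0, y)
      + pderiv (i + 1) (fun y => S.pullOm (lift φ c) a (eX (i + 2)) (0, 0, y)) y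
      - pderiv (i + 2) (fun y => S.pullOm (lift φ c) a (eX (i + 1)) (0, 0, y)) y := by
  have hz := mem_liftDom hε hy
  have h := AlmostHermitian.deriv_pullOm (isOpen_liftDom ε c) (hφ.contMDiffOn_lift c) hz hS
    a (eX (i + 1)) (eX (i + 2))
  have hd := fun j => (AlmostHermitian.contDiffAt_pullOm (isOpen_liftDom ε c)
    (hφ.contMDiffOn_lift c) hz hS a (eX j)).differentiableAt (by simp)
  have e : S.pullOm (lift φ c) (eX (i + 2)) a =
      fun z => -S.pullOm (lift φ c) a (eX (i + 2)) z := funext fun z => pullOm_swap S _ _ z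
  rw [e, fderiv_fun_neg, _root_.neg_apply, fderiv_eX (hd _), fderiv_eX (hd _)] at h
  rw [← h, famW]
  ring

/-- The first variation of `ω` on the 3-manifold depends only on the variation field. -/
lemma fderiv_famW_congr (hS : S.IsStrictNearlyKahler) (hφ : IsFamily φ ε) (hε : 0 < ε)
    {φ' : ℝ → ℝ → L → M} {ε' : ℝ} (hφ' : IsFamily φ' ε') (hε' : 0 < ε') (h0 : φ 0 0 = φ' 0 0)
    {c : L} {a a' : Param} (hV : ∀ y ∈ (chart (n := 3) c).target,
      dmap (lift φ c) (0, 0, y) a = dmap (lift φ' c) (0, 0, y) a')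
    {y : Eucl 3} (hy : y ∈ (chart c).target) (i : Fin 3) :
    fderiv ℝ (famW S φ c i) (0, 0, y) a = fderiv ℝ (famW S φ' c i) (0, 0, y) a' := by
  have hX : ∀ y ∈ (chart (n := 3) c).target, ∀ j,
      dmap (lift φ c) (0, 0, y) (eX j) = dmap (lift φ' c) (0, 0, y) (eX j) := by
    intro y hy j
    rw [eX, ← hφ.diff_eq (mem_liftDom hε hy), ← hφ'.diff_eq (mem_liftDom hε' hy), h0]
  have hl : ∀ y, lift φ c (0, 0, y) = lift φ' c (0, 0, y) := fun y => by
    simp only [lift, h0]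
  have hp : ∀ j k, pderiv k (fun y => S.pullOm (lift φ c) a (eX j) (0, 0, y)) y =
      pderiv k (fun y => S.pullOm (lift φ' c) a' (eX j) (0, 0, y)) y := by
    intro j k
    have hev : (fun y => S.pullOm (lift φ c) a (eX j) (0, 0, y)) =ᶠ[𝓝 y]
        fun y => S.pullOm (lift φ' c) a' (eX j) (0, 0, y) := by
      filter_upwards [(isOpen_target c).mem_nhds hy] with x hx
      rw [AlmostHermitian.pullOm, AlmostHermitian.pullOm, hl, hX x hx, hV x hx]
    rw [pderiv, pderiv, hev.fderiv_eq]
  rw [fderiv_famW_eq hS hφ hε hy, fderiv_famW_eq hS hφ' hε' hy, hp, hp, AlmostHermitian.pullPsi,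
    AlmostHermitian.pullPsi, hl, hV y hy, hX y hy, hX y hy]

/-- The first variation of `ψ` is a third of the divergence of that of `ω`. -/
lemma three_fderiv_famP (hS : S.IsStrictNearlyKahler) (hφ : IsFamily φ ε) (hε : 0 < ε) {c : L}
    {y : Eucl 3} (hy : y ∈ (chart c).target) (a : Param) :
    3 * fderiv ℝ (famP S φ c) (0, 0, y) a =
      ∑ i, pderiv i (fun y => fderiv ℝ (famW S φ c i) (0, 0, y) a) y := by
  have hz := mem_liftDom hε hy
  have h2 : (2 : WithTop ℕ∞) ≤ ∞ := ENat.LEInfty.out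
  have hW := fun i => (contDiffAt_famW S hφ hS hz i).of_le h2
  have hev : (fun z => 3 * famP S φ c z) =ᶠ[𝓝 ((0, 0, y) : Param)]
      fun z => ∑ i, fderiv ℝ (famW S φ c i) z (eX i) := by
    filter_upwards [(isOpen_liftDom ε c).mem_nhds hz] with z hz
    exact three_famP S hφ hS hz
  have h1 := hev.fderiv_eq (𝕜 := ℝ)
  rw [fderiv_const_mul ((contDiffAt_famP S hφ hS hz).differentiableAt (by simp)),
    fderiv_fun_sum fun i _ => (hasFDerivAt_fderiv_apply (hW i) (eX i)).differentiableAt] at h1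
  have h3 := DFunLike.congr_fun h1 a
  simp only [_root_.smul_apply, smul_eq_mul, _root_.sum_apply] at h3
  rw [h3]
  refine Finset.sum_congr rfl fun i _ => ?_
  rw [fderiv_fderiv_apply (hW i), ← fderiv_eX (hasFDerivAt_fderiv_apply (hW i) a).differentiableAt,
    fderiv_fderiv_apply (hW i), fderiv_fderiv_symm (hW i)]

/-- Every term of `hessRest` contains the first variation of `ω` or of `ψ` in the direction of the
first parameter. -/
lemma hessRest_eq_zero (hS : S.IsStrictNearlyKahler) (hφ : IsFamily φ ε) (hε : 0 < ε) {c : L}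
    (hW : ∀ y ∈ (chart (n := 3) c).target, ∀ i, fderiv ℝ (famW S φ c i) (0, 0, y) eS = 0)
    {y : Eucl 3} (hy : y ∈ (chart c).target) : hessRest S φ c y = 0 := by
  have hP : fderiv ℝ (famP S φ c) (0, 0, y) eS = 0 := by
    have h := three_fderiv_famP hS hφ hε hy eS
    have h0 : ∀ i, pderiv i (fun y => fderiv ℝ (famW S φ c i) (0, 0, y) eS) y = 0 := by
      intro i
      have hev : (fun y => fderiv ℝ (famW S φ c i) (0, 0, y) eS) =ᶠ[𝓝 y] fun _ => 0 := by
        filter_upwards [(isOpen_target c).mem_nhds hy] with x hx using hW x hx i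
      rw [pderiv, hev.fderiv_eq]
      simp
    simp only [h0, Finset.sum_const_zero] at h
    linarith
  simp only [hessRest, hW y hy, hP, mul_zero, zero_mul, Finset.sum_const_zero, zero_div, add_zero]

/-- An infinitesimal Lagrangian deformation is a Jacobi field, because `hessRest` vanishes for every
second variation field of compact support. -/
theorem isJacobiField_of_isFormalLagrangianDeformation [T2Space L] [SigmaCompactSpace L]
    (hS : S.IsStrictNearlyKahler) {ι : L → M} (hι : IsLagrangianImmersion S ι)
    {V : ∀ x : L, TangentSpace 𝓘(ℝ, Eucl 6) (ι x)} (hV : IsFormalLagrangianDeformation S ι V) :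
    IsJacobiField S ι V := by
  obtain ⟨hVn, φ', ⟨⟨ε', hε', hφ'⟩, hvel'⟩, hder⟩ := hV
  refine ⟨hVn, fun φ W K ε hε hφ hvel _ _ hK hKφ => ?_⟩
  have hφ0 : φ 0 0 = ι := eq_of_velocity (φ := fun s => φ s 0) hvel
  have hφ0' : φ' 0 = ι := eq_of_velocity hvel'
  have hF : IsFamily φ ε := hφ
  have hF' := isFamily_add hφ'
  have hε2 : 0 < ε' / 2 := by linarith
  have hvel2 : ∀ x, velocity (fun s => (fun s t => φ' (s + t)) s 0) x = ⟨ι x, V x⟩ := by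
    intro x
    simpa only [add_zero] using hvel' x
  have hL : IsLagrangianImmersion S (φ 0 0) := hφ0 ▸ hι
  -- along `φ` the first variation of `ω` is the same as along the variation `φ'` for which it is
  -- known to vanish
  have hW : ∀ c, ∀ y ∈ (chart (n := 3) c).target, ∀ i,
      fderiv ℝ (famW S φ c i) (0, 0, y) eS = 0 := by
    intro c y hy i
    rw [fderiv_famW_congr hS hF hε hF' hε2 (by simp only [add_zero, hφ0, hφ0'])
      (fun x hx => (hF.dmap_eS hε hvel hx).trans (hF'.dmap_eS hε2 hvel2 hx).symm) hy]
    have h1 := hasDerivAt_line ((contDiffAt_famW S hF' hS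
      (mem_liftDom hε2 hy) i).differentiableAt (by simp)) eS
    refine h1.unique ((hder ((chart c).symm y) (dsymm c y (EuclideanSpace.single (i + 1) 1))
      (dsymm c y (EuclideanSpace.single (i + 2) 1))).congr_of_eventuallyEq ?_)
    have hI : Ioo (-(ε' / 2)) (ε' / 2) ∈ 𝓝 (0 : ℝ) := isOpen_Ioo.mem_nhds ⟨by linarith, hε2⟩
    filter_upwards [hI] with r hr
    have e : ((0, 0, y) : Param) + r • eS = (r, 0, y) := by
      simp only [eS, Prod.smul_mk, smul_eq_mul, mul_zero, mul_one, smul_zero, Prod.mk_add_mk,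
        add_zero, zero_add]
    have hz : ((r, 0, y) : Param) ∈ liftDom (ε' / 2) c := ⟨hr, ⟨by linarith, hε2⟩, hy⟩
    have ha := hF'.diff_eq hz (EuclideanSpace.single (i + 1) 1)
    have hb := hF'.diff_eq hz (EuclideanSpace.single (i + 2) 1)
    rw [e, famW, AlmostHermitian.pullOm, eX, eX, ← ha, ← hb]
    -- `r + 0` is replaced by `r` in the type of the tangent vectors
    have key : ∀ u, u = r → ∀ v w : Eucl 3,
        S.omAt (φ' u ((chart c).symm y)) (diff (φ' u) ((chart c).symm y) (dsymm c y v))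
          (diff (φ' u) ((chart c).symm y) (dsymm c y w)) =
        S.omega (φ' r ((chart c).symm y)) (diff (φ' r) ((chart c).symm y) (dsymm c y v))
          (diff (φ' r) ((chart c).symm y) (dsymm c y w)) := by
      rintro _ rfl v w
      rfl
    exact key (r + 0) (add_zero r) _ _
  obtain ⟨D, hD, -, hD2⟩ := exists_second_variation hF hε hL hS hK hKφ
  refine ⟨D, hD, ?_⟩
  convert hD2 using 1
  refine (Finset.sum_eq_zero fun c _ => setIntegral_eq_zero_of_forall_eq_zero fun y hy => ?_).symm
  rw [hessRest_eq_zero hS hF hε (hW c) (chartCompact_subset c K hy), mul_zero]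

end Family

/-! ### The second variation in the direction of a harmonic 1-form -/

section LinearAlgebra

open scoped Matrix

variable {E : Type*} [NormedAddCommGroup E] [NormedSpace ℝ E] {g : E →L[ℝ] E →L[ℝ] ℝ}
  {J : E →L[ℝ] E}

/-- A vector normal to a Lagrangian subspace with basis `u` is recovered from its contraction
with `ω`, because the vectors `u i` and `J (u i)` span. -/
lemma IsHermitianPair.normal_eq [FiniteDimensional ℝ E] (h : IsHermitianPair g J)
    (hd : Module.finrank ℝ E = 6) {u : Fin 3 → E} {G : Matrix (Fin 3) (Fin 3) ℝ}
    (hG : ∀ i j, G i j = g (u i) (u j)) (hdet : G.det ≠ 0) (hL : ∀ i j, g (J (u i)) (u j) = 0)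
    {V : E} (hV : ∀ i, g V (u i) = 0) :
    V = -∑ i, (G⁻¹ *ᵥ fun j => g (J V) (u j)) i • J (u i) := by
  let f : (Fin 3 → ℝ) × (Fin 3 → ℝ) →ₗ[ℝ] E :=
    { toFun := fun p => ∑ i, p.1 i • u i + ∑ i, p.2 i • J (u i)
      map_add' := fun p q => by
        simp only [Prod.fst_add, Prod.snd_add, Pi.add_apply, add_smul, Finset.sum_add_distrib]
        abel
      map_smul' := fun r p => by
        simp only [Prod.smul_fst, Prod.smul_snd, Pi.smul_apply, smul_eq_mul, mul_smul,
          ← Finset.smul_sum, smul_add, RingHom.id_apply] }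
  have hf : ∀ p, f p = ∑ i, p.1 i • u i + ∑ i, p.2 i • J (u i) := fun _ => rfl
  have h1 : ∀ p j, g (f p) (u j) = (G *ᵥ p.1) j := by
    intro p j
    simp only [hf, map_add, map_sum, map_smul, _root_.add_apply, _root_.sum_apply,
      _root_.smul_apply, smul_eq_mul, hL, mul_zero, Finset.sum_const_zero, add_zero,
      Matrix.mulVec, dotProduct, hG]
    exact Finset.sum_congr rfl fun i _ => by rw [h.symm (u j), mul_comm]
  have h2 : ∀ p j, g (J (f p)) (u j) = -(G *ᵥ p.2) j := by
    intro p j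
    simp only [hf, map_add, map_sum, map_smul, _root_.add_apply, _root_.sum_apply,
      _root_.smul_apply, smul_eq_mul, hL, mul_zero, Finset.sum_const_zero, zero_add, h.J_J,
      Matrix.mulVec, dotProduct, hG, map_neg, _root_.neg_apply, ← Finset.sum_neg_distrib]
    exact Finset.sum_congr rfl fun i _ => by rw [h.symm (u j)]; ring
  have hinj : Function.Injective f := by
    rw [← LinearMap.ker_eq_bot, LinearMap.ker_eq_bot']
    intro p hp
    refine Prod.ext (Matrix.eq_zero_of_mulVec_eq_zero hdet ?_)
      (Matrix.eq_zero_of_mulVec_eq_zero hdet ?_)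
    · ext j
      rw [← h1, hp]
      simp
    · ext j
      have := h2 p j
      rw [hp] at this
      simpa using this
  have hsurj : Function.Surjective f :=
    (LinearMap.injective_iff_surjective_of_finrank_eq_finrank (by simp [hd])).1 hinj
  obtain ⟨p, rfl⟩ := hsurj V
  have hp1 : p.1 = 0 := Matrix.eq_zero_of_mulVec_eq_zero hdet (by
    ext j
    rw [← h1, hV]
    rfl)
  have hp2 : (G⁻¹ *ᵥ fun j => g (J (f p)) (u j)) = -p.2 := by
    have : (fun j => g (J (f p)) (u j)) = -(G *ᵥ p.2) := funext fun j => h2 p j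
    rw [this, Matrix.mulVec_neg, Matrix.mulVec_mulVec, Matrix.nonsing_inv_mul _
      (isUnit_iff_ne_zero.2 hdet), Matrix.one_mulVec]
  rw [hp2, hf, hp1]
  simp

end LinearAlgebra

section Family

open scoped Matrix

variable {M : Type*} [TopologicalSpace M] [ChartedSpace (Eucl 6) M]
  [IsManifold 𝓘(ℝ, Eucl 6) ∞ M] {S : AlmostHermitian M}
  {L : Type*} [TopologicalSpace L] [ChartedSpace (Eucl 3) L]
  [IsManifold 𝓘(ℝ, Eucl 3) ∞ L]
  {φ : ℝ → ℝ → L → M} {ε : ℝ}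

lemma isFormFamily_formComp {β : ∀ x : L, TangentSpace 𝓘(ℝ, Eucl 3) x →L[ℝ] ℝ}
    (hβ : IsSmoothForm β) : IsFormFamily (formComp β) := by
  refine ⟨hβ, fun c c' y hy hy' => ?_⟩
  have key : ∀ x x' : L, x = x' → ∀ v : Eucl 3, β x v = β x' v := by
    rintro x _ rfl v
    rfl
  let B : Eucl 3 →L[ℝ] ℝ := β ((chart c').symm (trans c c' y))
  ext i
  have h1 : formComp β c y i = B.comp (dsymm c' (trans c c' y))
      (fderiv ℝ (trans c c') y (EuclideanSpace.single i 1)) := by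
    rw [ContinuousLinearMap.comp_apply, dsymm_trans hy hy']
    exact key _ _ (symm_trans hy').symm _
  rw [h1, clm_apply_eq_sum]
  rfl

lemma isMetricFamily_inducedMetric (hφ : IsFamily φ ε) (hε : 0 < ε)
    (hL : IsLagrangianImmersion S (φ 0 0)) :
    IsMetricFamily (fun c : L => inducedMetric S (φ 0 0) c) := by
  refine ⟨fun c i j => ?_, fun c y hy => posDef_inducedMetric S hL.immersive hy,
    fun c c' y hy hy' => ?_⟩
  · have h : ContDiffOn ℝ ∞ (fun y => S.pullG (lift φ c) (eX i) (eX j) (0, 0, y))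
        (chart c).target := fun y hy => (ContDiffAt.comp
      (f := fun x : Eucl 3 => ((0, 0, x) : Param)) y
      (contDiffAt_famG S hφ (mem_liftDom hε hy) _ _)
      (contDiffAt_const.prodMk (contDiffAt_const.prodMk contDiffAt_id))).contDiffWithinAt
    exact h.congr fun y hy => inducedMetric_eq S hφ (mem_liftDom hε hy) i j
  · ext i j
    rw [inducedMetric_eq S hφ (mem_liftDom hε hy), AlmostHermitian.pullG,
      dmap_eX_trans hφ (mem_liftDom hε hy) hy', dmap_eX_trans hφ (mem_liftDom hε hy) hy',
      lift_trans hy']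
    simp only [map_sum, map_smul, _root_.sum_apply, _root_.smul_apply, smul_eq_mul,
      Matrix.mul_apply, Matrix.transpose_apply, Finset.sum_mul, Finset.mul_sum]
    refine Finset.sum_congr rfl fun k _ => Finset.sum_congr rfl fun l _ => ?_
    rw [inducedMetric_eq S hφ (mem_liftDom hε (trans_mem hy')), AlmostHermitian.pullG]
    ring

section Base

variable (hφ : IsFamily φ ε) (hε : 0 < ε) (hL : IsLagrangianImmersion S (φ 0 0))
  (hS : S.IsStrictNearlyKahler) {b : Eucl 3 → Fin 3 → ℝ} {c : L}
  (hb : ∀ y ∈ (chart (n := 3) c).target, ∀ i, S.pullOm (lift φ c) eS (eX i) (0, 0, y) = b y i)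
  (hn : ∀ y ∈ (chart (n := 3) c).target, ∀ i, S.pullG (lift φ c) eS (eX i) (0, 0, y) = 0)
include hφ hε hL hS hb hn

/-- If `V` is normal and `β = V ⌟ ω` is closed, then the first variation of `ω`, that is
`3 V ⌟ ψ`, is a multiple of the Hodge dual of `β`. -/
lemma kappa_mul_fderiv_famW {y : Eucl 3} (hy : y ∈ (chart c).target)
    (hd : ∀ i j, extDeriv₁ b y i j = 0) (i : Fin 3) :
    famKappa S φ c y * fderiv ℝ (famW S φ c i) (0, 0, y) eS =
      -3 * raiseDensity (inducedMetric S (φ 0 0) c) b y i := by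
  have hz := mem_liftDom hε hy
  set x := lift φ c (0, 0, y) with hx
  set u : Fin 3 → Eucl 6 := fun j => dmap (lift φ c) (0, 0, y) (eX j) with hu
  set V : Eucl 6 := dmap (lift φ c) (0, 0, y) eS with hVdef
  set X := (inducedMetric S (φ 0 0) c y)⁻¹ *ᵥ b y with hX
  have hV : V = -∑ l, X l • S.JAt x (u l) := by
    have h := (S.isHermitianPair_at x).normal_eq (by simp) (u := u) (V := V)
      (G := inducedMetric S (φ 0 0) c y) (fun i j => inducedMetric_eq S hφ hz i j)
      (posDef_inducedMetric S hL.immersive hy).det_pos.ne'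
      (fun i j => pullOm_base S hφ hε hL hy i j) (hn y hy)
    have e : (fun j => S.gAt x (S.JAt x V) (u j)) = b y := funext fun j => hb y hy j
    rwa [e] at h
  have hp : ∀ j k, pderiv k (fun y => S.pullOm (lift φ c) eS (eX j) (0, 0, y)) y =
      pderiv k (fun y => b y j) y := by
    intro j k
    have hev : (fun y => S.pullOm (lift φ c) eS (eX j) (0, 0, y)) =ᶠ[𝓝 y] fun y => b y j := by
      filter_upwards [(isOpen_target c).mem_nhds hy] with x hx using hb x hx j
    rw [pderiv, pderiv, hev.fderiv_eq]
  have hdi := hd (i + 1) (i + 2)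
  rw [extDeriv₁] at hdi
  -- in `ψ(V, u (i + 1), u (i + 2))` only the `i`-th term of the sum for `V` survives
  have hψ : S.pullPsi (lift φ c) eS (eX (i + 1)) (eX (i + 2)) (0, 0, y) =
      -(X i * famSig S φ c (0, 0, y)) := by
    have e1 : S.pullPsi (lift φ c) eS (eX (i + 1)) (eX (i + 2)) (0, 0, y) =
        S.psiForm x V (u (i + 1)) (u (i + 2)) := (S.psiForm_apply x _ _ _).symm
    have e2 : famSig S φ c (0, 0, y) = sigForm S x (u 0) (u 1) (u 2) :=
      (S.psiForm_apply x _ _ _).symm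
    have e3 : ∀ l, S.psiForm x (S.JAt x (u l)) = sigForm S x (u l) := fun _ => rfl
    have a1 := sigForm_alt₁ hS x
    have a2 := sigForm_alt₂ hS x
    have d1 : ∀ v w, sigForm S x v v w = 0 := fun v w => by have := a1 v v w; linarith
    have d3 : ∀ v w, sigForm S x v w v = 0 := fun v w => by rw [a2, d1, neg_zero]
    rw [e1, e2, hV, map_neg, map_sum]
    simp only [map_smul, _root_.neg_apply, _root_.add_apply, _root_.smul_apply, smul_eq_mul, e3,
      Fin.sum_univ_three]
    fin_cases i
    · simp [d1, d3]
    · simp [d1, d3, a2 (u 1) (u 2), a1 (u 1) (u 0)]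
    · simp [d1, d3, a1 (u 2) (u 0), a2 (u 0) (u 2)]
  have hvol := (fderiv_famVol S hφ hε hL hy hS).1
  have hden := density_eq_famVol S hφ hz
  rw [fderiv_famW_eq hS hφ hε hy, hp, hp, hψ, raiseDensity, hden, hvol]
  change _ = -3 * (_ * X i)
  linear_combination famKappa S φ c y * hdi

/-- If `V ⌟ ω` is also coclosed, the first variation of `ψ` vanishes. -/
lemma fderiv_famP_eq_zero {y : Eucl 3} (hy : y ∈ (chart c).target)
    (hd : ∀ᶠ y in 𝓝 y, ∀ i j, extDeriv₁ b y i j = 0)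
    (hc : codiff₁ (inducedMetric S (φ 0 0) c) b y = 0) :
    fderiv ℝ (famP S φ c) (0, 0, y) eS = 0 := by
  have hz := mem_liftDom hε hy
  have h2 : (2 : WithTop ℕ∞) ≤ ∞ := ENat.LEInfty.out
  have hW := fun i => ((contDiffAt_famW S hφ hS hz i).fderiv_right (m := ∞) (by simp)).clm_apply
    (contDiffAt_const (c := eS))
  have h3 := three_fderiv_famP hS hφ hε hy eS
  have hv : 0 < density (inducedMetric S (φ 0 0) c) y :=
    Real.sqrt_pos.2 (posDef_inducedMetric S hL.immersive hy).det_pos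
  have hκ : famKappa S φ c y ≠ 0 := by
    intro h0
    have := (fderiv_famVol S hφ hε hL hy hS).1
    rw [h0, zero_mul, ← density_eq_famVol S hφ hz] at this
    exact hv.ne' this
  have hi : ∀ i, famKappa S φ c y * pderiv i (fun y => fderiv ℝ (famW S φ c i) (0, 0, y) eS) y =
      -3 * pderiv i (fun y => raiseDensity (inducedMetric S (φ 0 0) c) b y i) y := by
    intro i
    have hsm := kappa_mul_smooth hφ hε hL hS hy (hW i)
    have hev : (fun x => famKappa S φ c x * fderiv ℝ (famW S φ c i) (0, 0, x) eS) =ᶠ[𝓝 y]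
        fun x => -3 * raiseDensity (inducedMetric S (φ 0 0) c) b x i := by
      filter_upwards [hd, (isOpen_target c).mem_nhds hy] with x hx hxt
      exact kappa_mul_fderiv_famW hφ hε hL hS hb hn hxt hx i
    have hr : DifferentiableAt ℝ (fun y => raiseDensity (inducedMetric S (φ 0 0) c) b y i) y := by
      refine ((hsm.1.differentiableAt (by simp)).const_mul (-1 / 3)).congr_of_eventuallyEq ?_
      filter_upwards [hev] with x hx
      rw [hx]
      ring
    rw [← fderiv_eX ((hW i).differentiableAt (by simp)), ← hsm.2 i, pderiv, hev.fderiv_eq]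
    exact congrArg (fun A : Eucl 3 →L[ℝ] ℝ => A (EuclideanSpace.single i 1))
      (fderiv_const_mul hr (-3))
  have hdiv : ∑ i, pderiv i (fun y => raiseDensity (inducedMetric S (φ 0 0) c) b y i) y = 0 := by
    rw [codiff₁, neg_eq_zero] at hc
    exact (mul_eq_zero.1 hc).resolve_left (inv_pos.2 hv).ne'
  have h4 : famKappa S φ c y * (3 * fderiv ℝ (famP S φ c) (0, 0, y) eS) = 0 := by
    rw [h3, Finset.mul_sum]
    simp only [hi]
    rw [← Finset.mul_sum, hdiv, mul_zero]
  have h5 := (mul_eq_zero.1 h4).resolve_left hκ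
  linarith

/-- For a closed and coclosed 1-form the integrand of the second variation is
`-3 k² |β|² √(det g)`. -/
lemma hessRest_nonpos {y : Eucl 3} (hy : y ∈ (chart c).target)
    (hd : ∀ᶠ y in 𝓝 y, ∀ i j, extDeriv₁ b y i j = 0)
    (hc : codiff₁ (inducedMetric S (φ 0 0) c) b y = 0)
    (hT : ∀ y ∈ (chart (n := 3) c).target,
      dmap (lift φ c) (0, 0, y) eT = dmap (lift φ c) (0, 0, y) eS) :
    hessRest S φ c y ≤ 0 ∧ (b y ≠ 0 → hessRest S φ c y < 0) := by
  have hz := mem_liftDom hε hy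
  have hp := posDef_inducedMetric S hL.immersive (c := c) hy
  set G := inducedMetric S (φ 0 0) c y with hG
  set X := G⁻¹ *ᵥ b y with hX
  set κ := famKappa S φ c y with hκ
  set k := S.nrm (lift φ c (0, 0, y)) with hk
  set v := famVol S φ c (0, 0, y) with hv
  have hk0 : 0 < k := AlmostHermitian.nrm_pos hS _
  have hv0 : 0 < v := Real.sqrt_pos.2 (famQ_pos S hφ hε hL hy)
  -- with `s` the component of `ψ(J·, ·, ·)`, one has `v = κ s` and `s² = k² v²`
  have hκk : κ * κ * k ^ 2 = 1 := by
    have hvol := (fderiv_famVol S hφ hε hL hy hS).1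
    have hsig := famSig_base S hφ hε hL hy hS
    have hQ : v * v = famQ S φ c (0, 0, y) := Real.mul_self_sqrt (famQ_pos S hφ hε hL hy).le
    rw [← hQ] at hsig
    have h1 : v * v * (κ * κ * k ^ 2) = v * v := by
      linear_combination -κ ^ 2 * hsig + -(v + κ * famSig S φ c (0, 0, y)) * hvol
    exact mul_left_cancel₀ (mul_pos hv0 hv0).ne' (h1.trans (mul_one _).symm)
  have hW : ∀ i, fderiv ℝ (famW S φ c i) (0, 0, y) eS = -3 * v * (κ * k ^ 2) * X i := by
    intro i
    have h1 := kappa_mul_fderiv_famW hφ hε hL hS hb hn hy hd.self_of_nhds i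
    rw [raiseDensity, density_eq_famVol S hφ hz] at h1
    change κ * _ = -3 * (v * X i) at h1
    linear_combination (κ * k ^ 2) * h1 - fderiv ℝ (famW S φ c i) (0, 0, y) eS * hκk
  have hWT : ∀ i, fderiv ℝ (famW S φ c i) (0, 0, y) eT = -3 * v * (κ * k ^ 2) * X i := fun i =>
    (fderiv_famW_congr hS hφ hε hφ hε rfl hT hy i).trans (hW i)
  have hP := fderiv_famP_eq_zero hφ hε hL hS hb hn hy hd hc
  have hO : ∀ i, S.pullOm (lift φ c) eT (eX i) (0, 0, y) = b y i := by
    intro i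
    rw [← hb y hy, AlmostHermitian.pullOm, AlmostHermitian.pullOm, hT y hy]
  have hGX : ∀ i, ∑ j, X j * G i j = b y i := by
    intro i
    have h1 : G *ᵥ X = b y := by
      rw [hX, Matrix.mulVec_mulVec, Matrix.mul_nonsing_inv _ (isUnit_iff_ne_zero.2 hp.det_pos.ne'),
        Matrix.one_mulVec]
    rw [← h1]
    exact Finset.sum_congr rfl fun j _ => mul_comm _ _
  have hE : hessRest S φ c y = -3 * v * (κ * k ^ 2) ^ 2 * (b y ⬝ᵥ X) := by
    have e1 : ∑ i, S.pullOm (lift φ c) eT (eX i) (0, 0, y) *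
        fderiv ℝ (famW S φ c i) (0, 0, y) eS = -3 * v * (κ * k ^ 2) * (b y ⬝ᵥ X) := by
      rw [dotProduct, Finset.mul_sum]
      exact Finset.sum_congr rfl fun i _ => by rw [hO, hW]; ring
    have e2 : ∑ i, ∑ j, (fderiv ℝ (famW S φ c i) (0, 0, y) eS *
        fderiv ℝ (famW S φ c j) (0, 0, y) eT + fderiv ℝ (famW S φ c i) (0, 0, y) eT *
        fderiv ℝ (famW S φ c j) (0, 0, y) eS) * S.pullG (lift φ c) (eX i) (eX j) (0, 0, y) /
        (2 * famVol S φ c (0, 0, y)) = 9 * v * (κ * k ^ 2) ^ 2 * (b y ⬝ᵥ X) := by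
      rw [dotProduct, Finset.mul_sum]
      refine Finset.sum_congr rfl fun i _ => ?_
      rw [← hGX i, Finset.sum_mul, Finset.mul_sum]
      refine Finset.sum_congr rfl fun j _ => ?_
      rw [hW, hW, hWT, hWT, ← inducedMetric_eq S hφ hz, ← hG, ← hv]
      field_simp
      ring
    -- `4 κ k² · (-3 κ k²) + 9 (κ k²)² = -3 (κ k²)²`
    rw [hessRest, e1, e2, hP]
    ring
  have hT2 : 0 < (κ * k ^ 2) ^ 2 := by
    refine sq_pos_of_ne_zero fun h0 => ?_
    rw [mul_assoc, h0, mul_zero] at hκk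
    exact zero_ne_one hκk
  have hpos : b y ≠ 0 → 0 < b y ⬝ᵥ X := fun h => by
    simpa using hp.inv.dotProduct_mulVec_pos h
  have hneg : b y ≠ 0 → hessRest S φ c y < 0 := fun h => by
    rw [hE]
    have := mul_pos (mul_pos hv0 hT2) (hpos h)
    linarith
  refine ⟨?_, hneg⟩
  by_cases h : b y = 0
  · rw [hE, h, zero_dotProduct, mul_zero]
  · exact (hneg h).le

end Base

end Family

section Family

variable {M : Type*} [TopologicalSpace M] [ChartedSpace (Eucl 6) M]
  [IsManifold 𝓘(ℝ, Eucl 6) ∞ M] {S : AlmostHermitian M}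
  {L : Type*} [TopologicalSpace L] [ChartedSpace (Eucl 3) L]
  [IsManifold 𝓘(ℝ, Eucl 3) ∞ L] [T2Space L] [SigmaCompactSpace L]

/-- The second variation is negative in the direction of a nonzero harmonic 1-form. -/
theorem second_variation_neg [CompactSpace L] (hS : S.IsStrictNearlyKahler)
    {φ : ℝ → ℝ → L → M} {ε : ℝ} (hφ : IsFamily φ ε) (hε : 0 < ε)
    (hL : IsLagrangianImmersion S (φ 0 0))
    {β : ∀ x : L, TangentSpace 𝓘(ℝ, Eucl 3) x →L[ℝ] ℝ} (hβ : IsSmoothForm β)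
    (hΔ : IsHarmonic S (φ 0 0) β) (h0 : ∃ x, β x ≠ 0)
    (hb : ∀ c : L, ∀ y ∈ (chart (n := 3) c).target, ∀ i,
      S.pullOm (lift φ c) eS (eX i) (0, 0, y) = formComp β c y i)
    (hn : ∀ c : L, ∀ y ∈ (chart (n := 3) c).target, ∀ i,
      S.pullG (lift φ c) eS (eX i) (0, 0, y) = 0)
    (hT : ∀ c : L, ∀ y ∈ (chart (n := 3) c).target,
      dmap (lift φ c) (0, 0, y) eT = dmap (lift φ c) (0, 0, y) eS) :
    ∑ c ∈ (finite_meets (isCompact_univ (X := L))).toFinset,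
      ∫ y in chartCompact c univ, rho c c y * hessRest S φ c y < 0 := by
  have hh := isMetricFamily_inducedMetric hφ hε hL
  have hcc : ∀ c : L, ∀ y ∈ (chart (n := 3) c).target, rho c c y ≠ 0 →
      codiff₁ (inducedMetric S (φ 0 0) c) (formComp β c) y = 0 ∧
        ∀ i j, extDeriv₁ (formComp β c) y i j = 0 := fun c y hy hρ =>
    closed_coclosed_of_harmonic hh (isFormFamily_formComp hβ) hΔ hy hρ
  have hH : ∀ c : L, ∀ y ∈ (chart (n := 3) c).target, rho c c y ≠ 0 →
      hessRest S φ c y ≤ 0 ∧ (formComp β c y ≠ 0 → hessRest S φ c y < 0) := by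
    intro c y hy hρ
    refine hessRest_nonpos hφ hε hL hS (hb c) (hn c) hy ?_ (hcc c y hy hρ).1 (hT c)
    have hcont : ContinuousAt (rho c c) y :=
      ((contDiffOn_rho c c).contDiffAt ((isOpen_target c).mem_nhds hy)).continuousAt
    filter_upwards [hcont.eventually_ne hρ, (isOpen_target c).mem_nhds hy] with x hx hxt
    exact (hcc c x hxt hx).2
  have hnonpos : ∀ c : L, ∀ y ∈ (chart (n := 3) c).target, rho c c y * hessRest S φ c y ≤ 0 := by
    intro c y hy
    by_cases hρ : rho c c y = 0
    · rw [hρ, zero_mul]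
    · exact mul_nonpos_of_nonneg_of_nonpos (rho_nonneg _ _ _) (hH c y hy hρ).1
  have hle : ∀ c ∈ (finite_meets (isCompact_univ (X := L))).toFinset,
      ∫ y in chartCompact c univ, rho c c y * hessRest S φ c y ≤ 0 := fun c _ =>
    setIntegral_nonpos (isCompact_chartCompact c isCompact_univ).measurableSet fun y hy =>
      hnonpos c y (chartCompact_subset c univ hy)
  refine lt_of_le_of_ne (Finset.sum_nonpos hle) fun hsum => ?_
  -- if the sum of integrals vanished, so would the integrand in a chart where `β` does not
  obtain ⟨x, hx⟩ := h0
  obtain ⟨c, hc⟩ : ∃ c, chartPartition L c x ≠ 0 := by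
    by_contra! h
    have h1 := (chartPartition L).sum_eq_one (mem_univ x)
    simp only [h, finsum_zero] at h1
    exact zero_ne_one h1
  have hxs : x ∈ (chart (n := 3) c).source := tsupport_chartPartition c (subset_tsupport _ hc)
  have hy := (chart c).map_source hxs
  have hρ : rho c c (chart c x) ≠ 0 := by rwa [rho, (chart c).left_inv hxs]
  have hcT : c ∈ (finite_meets (isCompact_univ (X := L))).toFinset := by
    simp only [Finite.mem_toFinset, mem_ofPred_eq, inter_univ]
    exact ⟨_, subset_tsupport _ hc⟩
  have hint := (Finset.sum_eq_zero_iff_of_nonpos hle).1 hsum c hcT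
  have hzero : ∀ y ∈ (chart (n := 3) c).target, y ∉ chartCompact c univ →
      rho c c y * hessRest S φ c y = 0 := fun y hy hyC => by
    rw [rho_eq_zero_of_notMem hy (mem_univ _) hyC, zero_mul]
  have hcont : ContinuousOn (fun y => rho c c y * hessRest S φ c y) (chart c).target :=
    (contDiffOn_rho c c).continuousOn.mul (continuousOn_hessRest hφ hε hL hS c)
  rw [← setIntegral_eq_of_subset_of_forall_sdiff_eq_zero (isOpen_target c).measurableSet
    (chartCompact_subset c univ) fun y hy => hzero y hy.1 hy.2] at hint
  have hval := eq_zero_of_setIntegral_eq_zero (isOpen_target c) hcont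
    (integrableOn_of_continuousOn_of_zero (isOpen_target c)
      (isCompact_chartCompact c isCompact_univ) (chartCompact_subset c univ) hcont hzero)
    (hnonpos c) hint hy
  refine ((hH c _ hy hρ).2 fun hb0 => hx ?_).ne ((mul_eq_zero.1 hval).resolve_left hρ)
  let B : Eucl 3 →L[ℝ] ℝ := β ((chart (n := 3) c).symm (chart (n := 3) c x))
  have hB : B = 0 := by
    ext v
    rw [← dsymm_dchart_symm hy v, ← ContinuousLinearMap.comp_apply, clm_apply_eq_sum,
      _root_.zero_apply]
    refine Finset.sum_eq_zero fun i _ => ?_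
    have h1 : B.comp (dsymm c (chart (n := 3) c x)) (EuclideanSpace.single i 1) = 0 :=
      congrFun hb0 i
    rw [h1, mul_zero]
  have key : ∀ x' : L, x' = x → (β x' : Eucl 3 →L[ℝ] ℝ) = 0 → β x = 0 := by
    rintro _ rfl h
    exact h
  exact key _ ((chart (n := 3) c).left_inv hxs) hB

omit [IsManifold 𝓘(ℝ, Eucl 6) ∞ M] [T2Space L] [SigmaCompactSpace L] in
/-- For the family `φ_{s + t}` the two variation fields agree. -/
lemma dmap_eT_eq_eS {φ : ℝ → L → M} {ε : ℝ} (hφ : IsFamily (fun s t => φ (s + t)) ε) (hε : 0 < ε)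
    {c : L} {y : Eucl 3} (hy : y ∈ (chart c).target) :
    dmap (lift (fun s t => φ (s + t)) c) (0, 0, y) eT =
      dmap (lift (fun s t => φ (s + t)) c) (0, 0, y) eS := by
  have hz := mem_liftDom hε hy
  rw [dmap_eq_curve (isOpen_liftDom ε c) (hφ.contMDiffOn_lift c) hz,
    dmap_eq_curve (isOpen_liftDom ε c) (hφ.contMDiffOn_lift c) hz]
  have e : (fun r : ℝ => lift (fun s t => φ (s + t)) c ((0, 0, y) + r • eT)) =
      fun r => lift (fun s t => φ (s + t)) c ((0, 0, y) + r • eS) := by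
    ext r
    simp only [lift, eS, eT, Prod.smul_mk, smul_eq_mul, mul_zero, mul_one, smul_zero,
      Prod.mk_add_mk, add_zero, zero_add]
  have h1 := (EventuallyEq.of_eq e).mfderiv_eq (x := (0 : ℝ)) (I := 𝓘(ℝ, ℝ)) (I' := 𝓘(ℝ, Eucl 6))
  with_unfolding_all exact DFunLike.congr_fun h1 (1 : ℝ)

end Family

/-! ### The second derivative test -/

/-- The second derivative test for a strict local maximum. -/
lemma eventually_lt_of_second_deriv_neg {f D : ℝ → ℝ} {A : ℝ}
    (hf : ∀ᶠ t in 𝓝 0, HasDerivAt f (D t) t) (h0 : D 0 = 0) (hD : HasDerivAt D A 0) (hA : A < 0) :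
    ∀ᶠ t in 𝓝[≠] 0, f t < f 0 := by
  have hs : ∀ᶠ t in 𝓝[≠] (0 : ℝ), t⁻¹ * D t < 0 := by
    have h := (hasDerivAt_iff_tendsto_slope.1 hD).eventually_lt_const hA
    filter_upwards [h] with t ht
    simpa [slope, h0] using ht
  obtain ⟨δ, hδ, hball⟩ := Metric.eventually_nhds_iff.1 (hf.and (eventually_nhdsWithin_iff.1 hs))
  -- `D t` and `t` have opposite signs, so `f` increases up to `0` and decreases from there
  have hin : ∀ {t}, |t| < δ → HasDerivAt f (D t) t ∧ (t ≠ 0 → t⁻¹ * D t < 0) := fun {t} ht => by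
    have := hball (y := t) (by simpa using ht)
    simpa using this
  rw [eventually_nhdsWithin_iff, Metric.eventually_nhds_iff]
  refine ⟨δ, hδ, fun t ht ht0 => ?_⟩
  rw [Real.dist_0_eq_abs, abs_lt] at ht
  have hcont : ∀ a b, -δ < a → b < δ → ContinuousOn f (Icc a b) := fun a b ha hb u hu =>
    (hin (abs_lt.2 ⟨by linarith [hu.1], by linarith [hu.2]⟩)).1.continuousAt.continuousWithinAt
  have hder : ∀ a b, -δ < a → b < δ → ∀ u ∈ Ioo a b, HasDerivAt f (D u) u := fun a b ha hb u hu =>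
    (hin (abs_lt.2 ⟨by linarith [hu.1], by linarith [hu.2]⟩)).1
  rcases lt_or_gt_of_ne (show t ≠ 0 from ht0) with h | h
  · obtain ⟨u, hu, hu'⟩ := exists_hasDerivAt_eq_slope f D h (hcont t 0 ht.1 hδ)
      (hder t 0 ht.1 hδ)
    have h1 := (hin (t := u) (abs_lt.2 ⟨by linarith [hu.1], by linarith [hu.2]⟩)).2 hu.2.ne
    have h2 : 0 < D u := by
      by_contra! h3
      exact absurd (mul_nonneg_of_nonpos_of_nonpos (inv_nonpos.2 hu.2.le) h3) (not_le.2 h1)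
    rw [hu'] at h2
    have := (div_pos_iff_of_pos_right (by linarith : 0 < 0 - t)).1 h2
    linarith
  · obtain ⟨u, hu, hu'⟩ := exists_hasDerivAt_eq_slope f D h
      (hcont 0 t (by linarith) ht.2) (hder 0 t (by linarith) ht.2)
    have h1 := (hin (t := u) (abs_lt.2 ⟨by linarith [hu.1], by linarith [hu.2]⟩)).2 hu.1.ne'
    have h2 : D u < 0 := by
      by_contra! h3
      exact absurd (mul_nonneg (inv_nonneg.2 hu.1.le) h3) (not_le.2 h1)
    rw [hu'] at h2
    have := (div_lt_iff₀ (by linarith : 0 < t - 0)).1 h2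
    linarith

end NearlyKahler

end

theorem mainTheorem7
    {M : Type*} [TopologicalSpace M] [ChartedSpace (NearlyKahler.Eucl 6) M]
    [IsManifold 𝓘(ℝ, NearlyKahler.Eucl 6) ∞ M] [T2Space M] [SigmaCompactSpace M]
    (S : NearlyKahler.AlmostHermitian M) (hS : S.IsStrictNearlyKahler)
    {L : Type*} [TopologicalSpace L] [ChartedSpace (NearlyKahler.Eucl 3) L]
    [IsManifold 𝓘(ℝ, NearlyKahler.Eucl 3) ∞ L] [T2Space L] [SigmaCompactSpace L]
    (ι : L → M) (hι : NearlyKahler.IsLagrangianImmersion S ι) :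
    -- compactly supported formal infinitesimal Lagrangian deformations are Jacobi fields
    (∀ V : (∀ x : L, TangentSpace 𝓘(ℝ, NearlyKahler.Eucl 6) (ι x)),
      IsCompact (closure {x | V x ≠ 0}) →
      NearlyKahler.IsFormalLagrangianDeformation S ι V →
      NearlyKahler.IsJacobiField S ι V) ∧
    -- if `L` is compact and `V = L_ω⁻¹(β)` with `β ≠ 0` harmonic, then every variation generated
    -- by `V` decreases the volume, to second order
    (CompactSpace L →
      ∀ β : (∀ x : L, TangentSpace 𝓘(ℝ, NearlyKahler.Eucl 3) x →L[ℝ] ℝ),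
      NearlyKahler.IsSmoothForm β → NearlyKahler.IsHarmonic S ι β → (∃ x, β x ≠ 0) →
      ∀ V : (∀ x : L, TangentSpace 𝓘(ℝ, NearlyKahler.Eucl 6) (ι x)),
      NearlyKahler.IsNormalField S ι V →
      (∀ x u, S.omega (ι x) (V x) (NearlyKahler.diff ι x u) = β x u) →
      ∀ φ : ℝ → L → M, NearlyKahler.IsVariation ι V φ →
        (∃ (D : ℝ → ℝ) (A : ℝ),
          (∀ᶠ t in 𝓝 0, HasDerivAt (fun τ => NearlyKahler.vol S (φ τ) univ) (D t) t) ∧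
          D 0 = 0 ∧ HasDerivAt D A 0 ∧ A < 0) ∧
        ∀ᶠ t in 𝓝[≠] 0,
          NearlyKahler.vol S (φ t) univ < NearlyKahler.vol S ι univ) := by
  refine ⟨fun V _ hV => NearlyKahler.isJacobiField_of_isFormalLagrangianDeformation hS hι hV,
    fun hcomp β hβ hΔ hβ0 V hV hVβ φ hφ => ?_⟩
  obtain ⟨⟨ε, hε, hsm⟩, hvel⟩ := hφ
  have hφ0 : φ 0 = ι := NearlyKahler.eq_of_velocity hvel
  have h00 : φ (0 + 0) = ι := by rw [add_zero, hφ0]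
  -- the second derivative of `t ↦ vol(φ_t)` is the mixed one of `(s, t) ↦ vol(φ_{s + t})`
  have hF := NearlyKahler.isFamily_add hsm
  have hε2 : 0 < ε / 2 := by linarith
  have hL : NearlyKahler.IsLagrangianImmersion S (φ (0 + 0)) := h00 ▸ hι
  have hvel2 : ∀ x, NearlyKahler.velocity (fun s => (fun s t => φ (s + t)) s 0) x = ⟨ι x, V x⟩ := by
    intro x
    simpa only [add_zero] using hvel x
  have hX : ∀ (c : L) (y : NearlyKahler.Eucl 3), y ∈ (NearlyKahler.chart (n := 3) c).target →
      -- the base point `ι x` of `V x` agrees with `φ (0 + 0) x` only propositionally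
      ∀ f : L → M, f = ι → ∀ i,
      S.omAt (f ((NearlyKahler.chart c).symm y)) (V ((NearlyKahler.chart c).symm y))
        (NearlyKahler.diff f ((NearlyKahler.chart c).symm y)
          (NearlyKahler.dsymm c y (EuclideanSpace.single i 1))) =
        NearlyKahler.formComp β c y i ∧
      S.gAt (f ((NearlyKahler.chart c).symm y)) (V ((NearlyKahler.chart c).symm y))
        (NearlyKahler.diff f ((NearlyKahler.chart c).symm y)
          (NearlyKahler.dsymm c y (EuclideanSpace.single i 1))) = 0 := by
    rintro c y hy f rfl i
    exact ⟨hVβ _ _, hV.normal _ _⟩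
  have hpull : ∀ c : L, ∀ y ∈ (NearlyKahler.chart (n := 3) c).target, ∀ i,
      S.pullOm (NearlyKahler.lift (fun s t => φ (s + t)) c) NearlyKahler.eS (NearlyKahler.eX i)
        (0, 0, y) = NearlyKahler.formComp β c y i ∧
      S.pullG (NearlyKahler.lift (fun s t => φ (s + t)) c) NearlyKahler.eS (NearlyKahler.eX i)
        (0, 0, y) = 0 := by
    intro c y hy i
    have h := hX c y hy _ h00 i
    have hd := hF.diff_eq (NearlyKahler.mem_liftDom hε2 hy) (EuclideanSpace.single i 1)
    rw [NearlyKahler.AlmostHermitian.pullOm, NearlyKahler.AlmostHermitian.pullG,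
      hF.dmap_eS hε2 hvel2 hy, NearlyKahler.eX, ← hd]
    exact h
  have hneg := NearlyKahler.second_variation_neg hS hF hε2 hL hβ
    (show NearlyKahler.IsHarmonic S (φ (0 + 0)) β from h00 ▸ hΔ) hβ0
    (fun c y hy i => (hpull c y hy i).1) (fun c y hy i => (hpull c y hy i).2)
    (fun c y hy => NearlyKahler.dmap_eT_eq_eS hF hε2 hy)
  obtain ⟨D, hD, hD0, hD2⟩ := NearlyKahler.exists_second_variation hF hε2 hL hS
    (isCompact_univ (X := L)) fun s _ t _ x hx => absurd (Set.mem_univ x) hx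
  have hD1 : ∀ᶠ t in 𝓝 0, HasDerivAt (fun τ => NearlyKahler.vol S (φ τ) Set.univ) (D t) t := by
    filter_upwards [hD] with s hs
    have h1 : HasDerivAt (fun t => NearlyKahler.vol S (φ (s + t)) Set.univ) (D s) (s - s) := by
      rwa [sub_self]
    simpa only [add_sub_cancel] using h1.comp_sub_const s s
  refine ⟨⟨D, _, hD1, hD0, hD2, hneg⟩, ?_⟩
  have h := NearlyKahler.eventually_lt_of_second_deriv_neg hD1 hD0 hD2 hneg
  simpa only [hφ0] using h
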